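/- Let $k$ be a field and let $(X,\Delta=\sum_{i} D_i)$ be an snc pair over $k$: $X$ is a smooth variety over $k$ (integral, separated, of finite type), the $D_i$ are finitely many irreducible divisors, and every $x\in X$ has an affine open neighbourhood $U$ with étale coordinates $t=(t_1,\dots,t_n):U\to\mathbb A^n_k$ such that the $D_i$ passing through $x$ are given on $U$ by distinct equations $t_{c(i)}=0$ and the other $D_i$ do not meet $U$ (in particular all intersections of the $D_i$ are smooth over $k$). A *stratum* is an irreducible component of an intersection $D_{i_1}\cap\dots\cap D_{i_r}$, $r\ge 0$. A quasi-coherent (equivalently, coherent) ideal sheaf $I\subset\mathcal O_X$ is *toroidal* if $X$ is covered by open sets $U_j$ with $$I|_{U_j}=\sum_s \mathcal O_{U_j}\Bigl(-\sum_i m_{ijs}D_i|_{U_j}\Bigr)$$ for suitable (finitely many, possibly no) exponent vectors $(m_{ijs})_i$ of natural numbers. **Proposition.** Let $I\subset\mathcal O_X$ be a quasi-coherent ideal sheaf that is invariant under all stratification preserving local isomorphisms in one of the following three senses. 1. (Complex analytic; $k=\mathbb C$.) For every isomorphism $\phi:U_1\to U_2$ between analytic open subsets of $X^{\rm an}$ such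 that $Z\cap U_1=\phi^{-1}(Z\cap U_2)$ for every stratum $Z$, one has $\phi^*(I^{\rm an}|_{U_2})=I^{\rm an}|_{U_1}$. 2. (Étale local.) For every pair of étale $k$-morphisms $\tau_1,\tau_2:U\to X$ such that $\tau_1^{-1}(Z)=\tau_2^{-1}(Z)$ for every stratum $Z$, one has $\tau_1^*I=\tau_2^*I$ as ideal sheaves on $U$. 3. (Formal local.) For every finite field extension $K/k$, all $K$-rational points $x_1,x_2$ of $X_K=X\times_kK$, and every isomorphism of $K$-algebras $\phi^*:\widehat{\mathcal O}_{x_2,X_K}\to\widehat{\mathcal O}_{x_1,X_K}$ that maps $I_Z\widehat{\mathcal O}_{x_2,X_K}$ onto $I_Z\widehat{\mathcal O}_{x_1,X_K}$ for every stratum $Z$ of $X$ (where $I_Z\subset\mathcal O_X$ is the ideal sheaf of $Z$), the map $\phi^*$ maps $I\,\widehat{\mathcal O}_{x_2,X_K}$ onto $I\,\widehat{\mathcal O}_{x_1,X_K}$. Then $I$ is toroidal. -/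

import Mathlib

open CategoryTheory CategoryTheory.Limits AlgebraicGeometry TopologicalSpace Topology

universe u w

noncomputable section

namespace StratifiedPair

/-! ### Schemes over a field: constants, rational points, values of functions -/

/-- The constants: the ring homomorphism `K → Γ(X, U)` coming from `f : X ⟶ Spec K`. -/
def constants {K : Type u} [Field K] {X : Scheme.{u}} (f : X ⟶ Spec (.of K)) (U : X.Opens) :
    K →+* Γ(X, U) :=
  (X.presheaf.map (homOfLE (le_top : U ≤ ⊤)).op).hom.comp
    (f.appTop.hom.comp (Scheme.ΓSpecIso (.of K)).inv.hom)

/-- The `K`-rational points of a `K`-scheme `f : X ⟶ Spec K`, i.e. the sections of `f`. -/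
def RatPoint {K : Type u} [Field K] {X : Scheme.{u}} (f : X ⟶ Spec (.of K)) : Type u :=
  {s : Spec (.of K) ⟶ X // s ≫ f = 𝟙 _}

namespace RatPoint

variable {K : Type u} [Field K] {X : Scheme.{u}} {f : X ⟶ Spec (.of K)}

/-- The point of the underlying topological space of `X`. -/
def pt (x : RatPoint f) : X := x.1 (IsLocalRing.closedPoint K)

/-- The value `φ(x) ∈ K` of a regular function `φ` on `U` at a rational point `x ∈ U`. -/
def eval (x : RatPoint f) (U : X.Opens) (hx : x.pt ∈ U) (φ : Γ(X, U)) : K :=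
  (Scheme.stalkClosedPointTo x.1).hom ((X.presheaf.germ U x.pt hx).hom φ)

end RatPoint

/-! ### Ideal sheaves at a point -/

/-- The stalk `I_x`, an ideal of the local ring of `X` at `x`. -/
def stalkIdeal {X : Scheme.{u}} (I : X.IdealSheafData) (x : X) : Ideal (X.presheaf.stalk x) :=
  ⨆ (U : X.affineOpens) (hx : x ∈ U.1), (I.ideal U).map (X.presheaf.germ U.1 x hx).hom

/-- The completion of the local ring of `X` at `x` with respect to its maximal ideal. -/
abbrev CompletedStalk (X : Scheme.{u}) (x : X) : Type u :=
  AdicCompletion (IsLocalRing.maximalIdeal (X.presheaf.stalk x)) (X.presheaf.stalk x)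

/-- The constants `K → Ô_{x,X}`. -/
def completedConstants {K : Type u} [Field K] {X : Scheme.{u}} (f : X ⟶ Spec (.of K)) (x : X) :
    K →+* CompletedStalk X x :=
  (algebraMap (X.presheaf.stalk x) (CompletedStalk X x)).comp
    ((X.presheaf.germ ⊤ x trivial).hom.comp (constants f ⊤))

/-- For `p : Y ⟶ X` and `y : Y`, the ideal `I · Ô_{y,Y}` generated by the ideal sheaf `I` on `X`. -/
def completedIdeal {X Y : Scheme.{u}} (p : Y ⟶ X) (I : X.IdealSheafData) (y : Y) :
    Ideal (CompletedStalk Y y) :=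
  ((stalkIdeal I (p y)).map (p.stalkMap y).hom).map
    (algebraMap (Y.presheaf.stalk y) (CompletedStalk Y y))

/-! ### Snc pairs, strata and toroidal ideal sheaves -/

/-- `(X, ∑ D i)` is an snc pair over the field `k`: `X` is a smooth variety over `k`, the `D i` are
irreducible divisors (given by their ideal sheaves), and every `x : X` has an affine open
neighbourhood `U` with étale coordinates `t : U → 𝔸ⁿ` over `k` such that the divisors through `x`
are given on `U` by distinct coordinates, and the other ones do not meet `U`. -/
structure IsSNCPair {k : Type u} [Field k] {X : Scheme.{u}} (f : X ⟶ Spec (.of k))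
    {ι : Type w} (D : ι → X.IdealSheafData) : Prop where
  isIntegral : IsIntegral X
  isSeparated : IsSeparated f
  locallyOfFiniteType : LocallyOfFiniteType f
  quasiCompact : QuasiCompact f
  smooth : Smooth f
  irreducible : ∀ i, IsIrreducible ((D i).support : Set X)
  exists_coordinates : ∀ x : X, ∃ (U : X.affineOpens) (n : ℕ) (t : Fin n → Γ(X, U.1))
    (c : ι → Fin n), x ∈ U.1 ∧
      (MvPolynomial.eval₂Hom (constants f U.1) t).Etale ∧
      Set.InjOn c {i | x ∈ (D i).support} ∧
      (∀ i, x ∈ (D i).support → (D i).ideal U = Ideal.span {t (c i)}) ∧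
      (∀ i, x ∉ (D i).support → (D i).ideal U = ⊤)

/-- The (closed) strata: the irreducible components of the intersections `⋂ i ∈ S, D i`.
For `S = ∅` the intersection is `X`. -/
def IsStratum {X : Scheme.{u}} {ι : Type w} (D : ι → X.IdealSheafData) (Z : Closeds X) : Prop :=
  ∃ S : Finset ι,
    Maximal (fun T : Set X => IsIrreducible T ∧ T ⊆ ⋂ i ∈ S, ((D i).support : Set X)) (Z : Set X)

/-- `I` is toroidal: locally it is a sum `∑ₘ 𝒪(-∑ i, m i • D i)` over exponent vectors `m`. -/
def IsToroidal {X : Scheme.{u}} {ι : Type w} [Fintype ι] (D : ι → X.IdealSheafData)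
    (I : X.IdealSheafData) : Prop :=
  ∀ x : X, ∃ U : X.affineOpens, x ∈ U.1 ∧ ∃ S : Finset (ι → ℕ),
    I.ideal U = ⨆ m ∈ S, ∏ i, (D i).ideal U ^ m i

/-! ### The complex analytic setting -/

/-- The analytic topology on `X(ℂ)`: the coarsest topology such that, for every Zariski open `U`,
`U(ℂ)` is open and the regular functions on `U` are continuous on `U(ℂ)`. -/
instance analyticTopology {X : Scheme.{0}} (f : X ⟶ Spec (.of ℂ)) :
    TopologicalSpace (RatPoint f) :=
  .generateFrom {V | ∃ (U : X.Opens) (φ : Γ(X, U)) (W : Set ℂ), IsOpen W ∧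
    V = {x | ∃ hx : x.pt ∈ U, x.eval U hx φ ∈ W}}

/-- `g` is holomorphic at `x ∈ X(ℂ)` (for reduced `X`): near `x` it is a convergent power series in
finitely many regular functions, i.e. the restriction of a holomorphic function under a local
embedding of `X` in an affine space. -/
def HolomorphicAt {X : Scheme.{0}} {f : X ⟶ Spec (.of ℂ)} (g : RatPoint f → ℂ)
    (x : RatPoint f) : Prop :=
  ∃ (U : X.Opens) (hx : x.pt ∈ U) (N : ℕ) (φ : Fin N → Γ(X, U)) (G : (Fin N → ℂ) → ℂ),
    AnalyticAt ℂ G (fun j => x.eval U hx (φ j)) ∧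
    ∀ᶠ y in 𝓝 x, ∃ hy : y.pt ∈ U, g y = G (fun j => y.eval U hy (φ j))

/-- The germ of `g` at `x` belongs to the stalk at `x` of `Iᵃⁿ`, the ideal sheaf generated by `I`
in the sheaf of holomorphic functions. -/
def MemAnalyticIdeal {X : Scheme.{0}} {f : X ⟶ Spec (.of ℂ)} (I : X.IdealSheafData)
    (g : RatPoint f → ℂ) (x : RatPoint f) : Prop :=
  ∃ (U : X.affineOpens) (_ : x.pt ∈ U.1) (N : ℕ) (φ : Fin N → Γ(X, U.1))
    (h : Fin N → RatPoint f → ℂ),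
    (∀ j, φ j ∈ I.ideal U) ∧ (∀ j, HolomorphicAt (h j) x) ∧
    ∀ᶠ y in 𝓝 x, ∃ hy : y.pt ∈ U.1, g y = ∑ j, h j y * y.eval U.1 hy (φ j)

/-- A homeomorphism `e : U₁ → U₂` between open subsets of `Xᵃⁿ` is biholomorphic. -/
def IsBiholomorphic {X : Scheme.{0}} {f : X ⟶ Spec (.of ℂ)}
    (e : OpenPartialHomeomorph (RatPoint f) (RatPoint f)) : Prop :=
  (∀ x ∈ e.source, ∀ g, HolomorphicAt g (e x) → HolomorphicAt (g ∘ e) x) ∧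
  (∀ x ∈ e.target, ∀ g, HolomorphicAt g (e.symm x) → HolomorphicAt (g ∘ e.symm) x)

/-- `Iᵃⁿ` is invariant under all stratification preserving isomorphisms `e : U₁ → U₂` between
analytic open subsets of `Xᵃⁿ`. -/
def AnalyticInvariant {X : Scheme.{0}} (f : X ⟶ Spec (.of ℂ)) {ι : Type w}
    (D : ι → X.IdealSheafData) (I : X.IdealSheafData) : Prop :=
  ∀ e : OpenPartialHomeomorph (RatPoint f) (RatPoint f), IsBiholomorphic e →
    (∀ Z, IsStratum D Z → ∀ x ∈ e.source, x.pt ∈ Z ↔ (e x).pt ∈ Z) →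
    ∀ x ∈ e.source, ∀ g, MemAnalyticIdeal I g (e x) ↔ MemAnalyticIdeal I (g ∘ e) x

/-! ### The étale local setting -/

/-- `τ₁^* I = τ₂^* I` for all pairs of étale `k`-morphisms `τ₁, τ₂ : U ⟶ X` such that
`τ₁⁻¹(Z) = τ₂⁻¹(Z)` for every stratum `Z`. -/
def EtaleInvariant {k : Type u} [Field k] {X : Scheme.{u}} (f : X ⟶ Spec (.of k)) {ι : Type w}
    (D : ι → X.IdealSheafData) (I : X.IdealSheafData) : Prop :=
  ∀ (U : Scheme.{u}) (τ₁ τ₂ : U ⟶ X), Etale τ₁ → Etale τ₂ → τ₁ ≫ f = τ₂ ≫ f →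
    (∀ Z : Closeds X, IsStratum D Z → τ₁ ⁻¹' (Z : Set X) = τ₂ ⁻¹' (Z : Set X)) →
    I.comap τ₁ = I.comap τ₂

/-! ### The formal local setting -/

/-- Invariance under formal local isomorphisms, with finite extensions `K/k` of the residue field
allowed: for all `K`-rational points `x₁, x₂` of `X_K` and every isomorphism of `K`-algebras
`φ : Ô_{x₂, X_K} → Ô_{x₁, X_K}` which maps the ideal of `Z` to the ideal of `Z` for every stratum
`Z` of `X`, `φ` maps `I · Ô_{x₂, X_K}` to `I · Ô_{x₁, X_K}`. If `k` is algebraically closed,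
then `K = k`. -/
def FormalInvariant {k : Type u} [Field k] {X : Scheme.{u}} (f : X ⟶ Spec (.of k)) {ι : Type w}
    (D : ι → X.IdealSheafData) (I : X.IdealSheafData) : Prop :=
  ∀ (K : Type u) [Field K] [Algebra k K] [FiniteDimensional k K],
    let q := Spec.map (CommRingCat.ofHom (algebraMap k K))
    let p : pullback f q ⟶ X := pullback.fst f q
    let fK : pullback f q ⟶ Spec (.of K) := pullback.snd f q
    ∀ (x₁ x₂ : RatPoint fK)
      (φ : CompletedStalk (pullback f q) x₂.pt ≃+* CompletedStalk (pullback f q) x₁.pt),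
      (∀ c : K, φ (completedConstants fK x₂.pt c) = completedConstants fK x₁.pt c) →
      (∀ Z : Closeds X, IsStratum D Z →
        (completedIdeal p (Scheme.IdealSheafData.vanishingIdeal Z) x₂.pt).map φ =
          completedIdeal p (Scheme.IdealSheafData.vanishingIdeal Z) x₁.pt) →
      (completedIdeal p I x₂.pt).map φ = completedIdeal p I x₁.pt

end StratifiedPair

end

/-! Near a closed point take étale coordinates t in which the divisors through it are the
hyperplanes t_i = 0, i ∈ s, and shrink until every ideal generated by some of these t_i is prime.
Each stratum is then empty or cut out by some of the t_i (`IsAdaptedChart`). Étaleness gives every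
F-valued point x of the chart R a unique Taylor expansion R → F[[X]], t_i ↦ x(t_i) + X_i (`jet`).
The three kinds of invariance enter only through one consequence, `JetInvariant`: for points x₁, x₂
of the slice t_s = 0, expansions at x₂ of members of I, with X_i rescaled for i ∈ s, lie in the
ideal generated by the expansions at x₁, modulo every power of (X). Scalars and coordinate
differences range over an infinite subfield L of an algebraically closed F.

This forces I to be monomial (`JetInvariant.map_eq_span`). Rescaling makes the ideal of jets graded
in X_s. So for G ∈ I with transversal expansion ∑ a_m t^m, where the a_m are functions on the slice,
each a_m t^m lies in the ideal of jets at every point of the slice, modulo powers of (X). The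
function a_m may vanish at the given point x; but if its jet there is nonzero, it is nonzero at some
point y of the slice with y - x in L, because étale maps are open and a nonzero polynomial has a
nonzero value on any product of infinite sets. At y the coefficient is a unit, so t^m belongs to the
ideal of jets, and translating back it does so at x. Krull's intersection theorem and faithfully
flat descent carry the result from jets to the local ring, and noetherianity carries it to a
neighbourhood.

It remains to realise translations and rescalings. Étale: over a finite separable K/k, the fibre
product over affine space of the chart with an affinely twisted copy of itself has two étale maps to
X (`exists_etale_pair`). Formal: the completed local ring at a K-point of X_K is K[[X]], where
rescaling is an admissible automorphism. Analytic: the implicit function theorem provides charts,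
the affine maps T ↦ c(T - a) + b between them preserve strata, and analytic Taylor series agree with
jets. -/

noncomputable section

/-! ### Power series and the powers of the ideal of the variables -/

namespace MvPowerSeries

variable (σ A : Type*) [CommRing A]

/-- The ideal of power series generated by the variables. -/
abbrev varIdeal : Ideal (MvPowerSeries σ A) := .span (.range X)

variable {σ A}

/-- The nontrivial direction is that a series without terms of degree below N is a finite
combination of products of N variables. The power series ring is the adic completion of the
polynomial ring at a finitely generated ideal, and there the kernel of evaluation at level N is
generated by the N-th power of that ideal. -/
theorem mem_varIdeal_pow_iff [Finite σ] {N : ℕ} {p : MvPowerSeries σ A} :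
    p ∈ varIdeal σ A ^ N ↔ ∀ b : σ →₀ ℕ, b.degree < N → coeff b p = 0 := by
  have hker : truncTotalAlgHom σ A N p = 0 ↔ ∀ b : σ →₀ ℕ, b.degree < N → coeff b p = 0 := by
    rw [truncTotalAlgHom_apply, Ideal.Quotient.eq_zero_iff_mem, MvPolynomial.mem_pow_idealOfVars_iff']
    refine forall₂_congr fun b hb => ?_
    rw [coeff_truncTotal _ hb]
  rw [← hker]
  have hmap : (MvPolynomial.idealOfVars σ A).map (algebraMap (MvPolynomial σ A) (MvPowerSeries σ A))
      = varIdeal σ A := by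
    rw [Ideal.map_span, ← Set.range_comp]
    congr 2
    ext1 i
    simp [algebraMap_apply']
  constructor
  · intro hp
    rw [← hmap, ← Ideal.map_pow] at hp
    have : (MvPolynomial.idealOfVars σ A ^ N).map
        (algebraMap (MvPolynomial σ A) (MvPowerSeries σ A)) ≤
        RingHom.ker (truncTotalAlgHom σ A N).toRingHom := by
      rw [Ideal.map_le_iff_le_comap]
      intro q hq
      rw [Ideal.mem_comap, RingHom.mem_ker]
      erw [AlgHom.commutes]
      exact Ideal.Quotient.eq_zero_iff_mem.2 hq
    exact this hp
  · intro hp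
    have h1 : AdicCompletion.eval _ _ N (toAdicCompletionAlgEquiv σ A p) = 0 := by
      change (toAdicCompletion σ A p).val N = 0
      rw [toAdicCompletion_apply_eq_mk_truncTotal, Ideal.Quotient.eq_zero_iff_mem]
      simpa using Ideal.Quotient.eq_zero_iff_mem.1 hp
    have h2 : toAdicCompletionAlgEquiv σ A p ∈ (MvPolynomial.idealOfVars σ A ^ N • ⊤ :
        Submodule (MvPolynomial σ A)
          (AdicCompletion (MvPolynomial.idealOfVars σ A) (MvPolynomial σ A))) := by
      rw [AdicCompletion.pow_smul_top_eq_ker_eval (MvPolynomial.idealOfVars_fg σ A)]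
      exact h1
    have h3 := Submodule.mem_map_of_mem
      (f := ((toAdicCompletionAlgEquiv σ A).symm.toLinearMap)) h2
    rw [Submodule.map_smul''] at h3
    simp only [AlgEquiv.toLinearMap_apply, AlgEquiv.symm_apply_apply] at h3
    have h4 : p ∈ (MvPolynomial.idealOfVars σ A ^ N • ⊤ :
        Submodule (MvPolynomial σ A) (MvPowerSeries σ A)) :=
      Submodule.smul_mono le_rfl le_top h3
    rw [Ideal.smul_top_eq_map] at h4
    rw [← hmap, ← Ideal.map_pow]
    exact h4

theorem varIdeal_pow_antitone {M N : ℕ} (h : M ≤ N) : varIdeal σ A ^ N ≤ varIdeal σ A ^ M :=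
  Ideal.pow_le_pow_right h

theorem iInf_varIdeal_pow [Finite σ] : ⨅ N, varIdeal σ A ^ N = ⊥ := by
  rw [eq_bot_iff]
  intro p hp
  rw [Ideal.mem_iInf] at hp
  rw [Ideal.mem_bot]
  ext b
  exact mem_varIdeal_pow_iff.1 (hp (b.degree + 1)) b (Nat.lt_succ_self _)

theorem mem_varIdeal_iff [Finite σ] {p : MvPowerSeries σ A} :
    p ∈ varIdeal σ A ↔ constantCoeff p = 0 := by
  rw [← pow_one (varIdeal σ A), mem_varIdeal_pow_iff, ← coeff_zero_eq_constantCoeff_apply]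
  refine ⟨fun h => h 0 (by simp), fun h b hb => ?_⟩
  have : b = 0 := by
    rw [← Finsupp.degree_eq_zero_iff]; omega
  rw [this, h]

theorem sub_truncTotal_mem [Finite σ] (N : ℕ) (p : MvPowerSeries σ A) :
    p - (truncTotal N p : MvPolynomial σ A) ∈ varIdeal σ A ^ N := by
  rw [mem_varIdeal_pow_iff]
  intro b hb
  rw [map_sub, MvPolynomial.coeff_coe, coeff_truncTotal _ hb, sub_self]

end MvPowerSeries

/-! ### Étale coordinates and Taylor expansions -/

namespace EtaleCoord

open MvPowerSeries

section Lift

variable {k R B : Type*} [CommRing k] [CommRing R] [CommRing B] [Algebra k R] [Algebra k B] {n : ℕ}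
  {t : Fin n → R}

/-- This is formal smoothness of R over k[X₁, …, Xₙ]: once B is an algebra over it through X_i ↦
t'_i, the map g is linear over it and lifts along the complete ideal I. -/
theorem exists_lift (ht : (MvPolynomial.eval₂Hom (algebraMap k R) t).Etale) (I : Ideal B)
    [IsAdicComplete I B] (g : R →ₐ[k] B ⧸ I) (t' : Fin n → B)
    (hg : ∀ i, g (t i) = Ideal.Quotient.mk I (t' i)) :
    ∃ j : R →ₐ[k] B, (∀ i, j (t i) = t' i) ∧ ∀ r, Ideal.Quotient.mk I (j r) = g r := by
  let : Algebra (MvPolynomial (Fin n) k) R := (MvPolynomial.eval₂Hom (algebraMap k R) t).toAlgebra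
  have : Algebra.Etale (MvPolynomial (Fin n) k) R := ht
  let : Algebra (MvPolynomial (Fin n) k) B := (MvPolynomial.aeval (R := k) t').toAlgebra
  have : IsScalarTower k (MvPolynomial (Fin n) k) R := .of_algebraMap_eq fun x => by
    simp [RingHom.algebraMap_toAlgebra]
  have : IsScalarTower k (MvPolynomial (Fin n) k) B := .of_algebraMap_eq fun x => by
    simp [RingHom.algebraMap_toAlgebra]
  let g' : R →ₐ[MvPolynomial (Fin n) k] B ⧸ I :=
    { g with
      commutes' := fun p => by
        change g (MvPolynomial.eval₂Hom (algebraMap k R) t p) =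
          Ideal.Quotient.mk I (MvPolynomial.aeval (R := k) t' p)
        induction p using MvPolynomial.induction_on with
        | C a => simp
        | add p q hp hq => simp only [map_add, hp, hq]
        | mul_X p i hp => simp only [map_mul, hp]; simp [hg] }
  obtain ⟨j, hj⟩ := Algebra.FormallySmooth.exists_mkₐ_comp_eq_of_isAdicComplete g'
  refine ⟨j.restrictScalars k, fun i => ?_, fun r => DFunLike.congr_fun hj r⟩
  have := j.commutes (MvPolynomial.X i)
  simpa [RingHom.algebraMap_toAlgebra] using this

/-- Formal unramifiedness over k[X₁, …, Xₙ]. This rigidity identifies jets with all other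
constructions of Taylor expansions. -/
theorem algHom_ext (ht : (MvPolynomial.eval₂Hom (algebraMap k R) t).Etale) {I : Ideal B}
    (hI : ⨅ N, I ^ N = ⊥) {j₁ j₂ : R →ₐ[k] B} (h : ∀ i, j₁ (t i) = j₂ (t i))
    (hmk : ∀ r, j₁ r - j₂ r ∈ I) : j₁ = j₂ := by
  let : Algebra (MvPolynomial (Fin n) k) R := (MvPolynomial.eval₂Hom (algebraMap k R) t).toAlgebra
  have : Algebra.Etale (MvPolynomial (Fin n) k) R := ht
  let : Algebra (MvPolynomial (Fin n) k) B :=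
    (j₁.toRingHom.comp (algebraMap (MvPolynomial (Fin n) k) R)).toAlgebra
  let j₁' : R →ₐ[MvPolynomial (Fin n) k] B := { j₁ with commutes' := fun p => rfl }
  let j₂' : R →ₐ[MvPolynomial (Fin n) k] B :=
    { j₂ with
      commutes' := fun p => by
        change j₂ (MvPolynomial.eval₂Hom (algebraMap k R) t p) =
          j₁ (MvPolynomial.eval₂Hom (algebraMap k R) t p)
        induction p using MvPolynomial.induction_on with
        | C a => simp
        | add p q hp hq => simp only [map_add, hp, hq]
        | mul_X p i hp => simp only [map_mul, hp]; simp [h] }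
  have : j₁' = j₂' :=
    Algebra.FormallyUnramified.ext_of_iInf I hI fun x => Ideal.Quotient.eq.2 (hmk x)
  ext r
  exact DFunLike.congr_fun this r

end Lift

section Jet

variable {k R F : Type*} [CommRing k] [CommRing R] [CommRing F] [Algebra k R] [Algebra k F]
  {n : ℕ} {t : Fin n → R}

theorem exists_jet (ht : (MvPolynomial.eval₂Hom (algebraMap k R) t).Etale) (x : R →ₐ[k] F) :
    ∃ j : R →ₐ[k] MvPowerSeries (Fin n) F, (∀ i, j (t i) = C (x (t i)) + X i) ∧
      ∀ r, constantCoeff (j r) = x r := by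
  let g : R →ₐ[k] MvPowerSeries (Fin n) F ⧸ varIdeal (Fin n) F :=
    (Ideal.Quotient.mkₐ k _).comp ((Algebra.ofId F (MvPowerSeries (Fin n) F)).restrictScalars k
      |>.comp x)
  obtain ⟨j, h1, h2⟩ := exists_lift ht (varIdeal (Fin n) F) g (fun i => C (x (t i)) + X i)
    fun i => by
      change Ideal.Quotient.mk _ (algebraMap F (MvPowerSeries (Fin n) F) (x (t i))) = _
      rw [Ideal.Quotient.eq, mem_varIdeal_iff]
      simp [MvPowerSeries.algebraMap_apply]
  refine ⟨j, h1, fun r => ?_⟩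
  have := h2 r
  change _ = Ideal.Quotient.mk _ (algebraMap F (MvPowerSeries (Fin n) F) (x r)) at this
  rw [Ideal.Quotient.eq, mem_varIdeal_iff] at this
  simpa [MvPowerSeries.algebraMap_apply, sub_eq_zero] using this

/-- The Taylor expansion at the `F`-valued point `x` in the étale coordinates `t`. -/
def jet (ht : (MvPolynomial.eval₂Hom (algebraMap k R) t).Etale) (x : R →ₐ[k] F) :
    R →ₐ[k] MvPowerSeries (Fin n) F := (exists_jet ht x).choose

variable (ht : (MvPolynomial.eval₂Hom (algebraMap k R) t).Etale) (x : R →ₐ[k] F)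

@[simp]
theorem jet_coord (i : Fin n) : jet ht x (t i) = C (x (t i)) + X i :=
  (exists_jet ht x).choose_spec.1 i

@[simp]
theorem constantCoeff_jet (r : R) : constantCoeff (jet ht x r) = x r :=
  (exists_jet ht x).choose_spec.2 r

variable {ht x} in
theorem eq_jet {j : R →ₐ[k] MvPowerSeries (Fin n) F} (h : ∀ i, j (t i) = C (x (t i)) + X i)
    (hc : ∀ r, constantCoeff (j r) = x r) : j = jet ht x :=
  algHom_ext ht (I := varIdeal (Fin n) F) iInf_varIdeal_pow (fun i => by simp [h])
    fun r => by simp [mem_varIdeal_iff, hc]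

end Jet

end EtaleCoord

end

/-! ### Jets determine elements of a local ring modulo powers of the maximal ideal -/

noncomputable section

namespace EtaleCoord

open MvPowerSeries

section LocalRing

universe v

variable {k F R : Type*} {O : Type v} [CommRing k] [CommRing R] [Field F] [Algebra k R] [Algebra k F]
  {n : ℕ} {t : Fin n → R} [CommRing O] [Algebra F O] [Algebra k O] [IsScalarTower k F O]

/-- A jet on an `F`-algebra `O` which is generated, in the sense of epimorphisms, by `R` and whose
kernel at order one lies in `m`: then elements with vanishing `N`-jet lie in `m ^ N`. -/
theorem mem_pow_of_jet_mem (ht : (MvPolynomial.eval₂Hom (algebraMap k R) t).Etale)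
    (x : R →ₐ[k] F) (ι : R →ₐ[k] O)
    (hepi : ∀ (B : Type v) [CommRing B] [Algebra F B] (g₁ g₂ : O →ₐ[F] B),
      (∀ r, g₁ (ι r) = g₂ (ι r)) → g₁ = g₂)
    (j : O →ₐ[F] MvPowerSeries (Fin n) F) (hj : ∀ r, j (ι r) = jet ht x r)
    (m : Ideal O) (hm : ∀ o, constantCoeff (j o) = 0 → o ∈ m) {N : ℕ} {o : O}
    (ho : j o ∈ varIdeal (Fin n) F ^ N) : o ∈ m ^ N := by
  have hsub : ∀ o, o - algebraMap F O (constantCoeff (j o)) ∈ m := fun o => hm _ <| by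
    rw [map_sub, map_sub, AlgHom.commutes, MvPowerSeries.algebraMap_apply]
    simp
  have htm : ∀ i, ι (t i) - algebraMap F O (x (t i)) ∈ m := fun i => by
    have := hsub (ι (t i))
    rwa [hj, constantCoeff_jet] at this
  -- This goes back from jets to O modulo `m ^ N`: a polynomial is evaluated at t_i - x(t_i) ∈ m.
  -- Terms of degree at least N die, so a truncated jet contains enough information.
  let e : MvPolynomial (Fin n) F →ₐ[F] O ⧸ m ^ N :=
    MvPolynomial.aeval fun i => Ideal.Quotient.mk (m ^ N) (ι (t i) - algebraMap F O (x (t i)))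
  have he1 : ∀ q : MvPolynomial (Fin n) F,
      e q - Ideal.Quotient.mk _ (algebraMap F O (MvPolynomial.constantCoeff q)) ∈
        m.map (Ideal.Quotient.mk (m ^ N)) := by
    intro q
    have h : (Ideal.Quotient.mk (m.map (Ideal.Quotient.mk (m ^ N)))).comp e.toRingHom =
        (Ideal.Quotient.mk (m.map (Ideal.Quotient.mk (m ^ N)))).comp
          ((Ideal.Quotient.mk (m ^ N)).comp
            ((algebraMap F O).comp MvPolynomial.constantCoeff)) := by
      refine MvPolynomial.ringHom_ext (fun a => ?_) fun i => ?_
      · change Ideal.Quotient.mk _ (e (MvPolynomial.C a)) = Ideal.Quotient.mk _ (Ideal.Quotient.mk _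
          (algebraMap F O (MvPolynomial.constantCoeff (MvPolynomial.C a))))
        rw [MvPolynomial.aeval_C, MvPolynomial.constantCoeff_C]
        rfl
      · change Ideal.Quotient.mk _ (e (MvPolynomial.X i)) = Ideal.Quotient.mk _ (Ideal.Quotient.mk _
          (algebraMap F O (MvPolynomial.constantCoeff (MvPolynomial.X i))))
        rw [MvPolynomial.aeval_X, MvPolynomial.constantCoeff_X, map_zero, map_zero, map_zero]
        exact Ideal.Quotient.eq_zero_iff_mem.2 (Ideal.mem_map_of_mem _ (htm i))
    exact Ideal.Quotient.eq.1 (DFunLike.congr_fun h q)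
  have he2 : ∀ q ∈ MvPolynomial.idealOfVars (Fin n) F ^ N, e q = 0 := by
    have : MvPolynomial.idealOfVars (Fin n) F ≤ (m.map (Ideal.Quotient.mk (m ^ N))).comap e := by
      rw [Ideal.span_le]
      rintro _ ⟨i, rfl⟩
      rw [SetLike.mem_coe, Ideal.mem_comap, MvPolynomial.aeval_X]
      exact Ideal.mem_map_of_mem _ (htm i)
    intro q hq
    have h := Ideal.le_comap_pow e N (Ideal.pow_right_mono this N hq)
    rw [← Ideal.map_pow, Ideal.mem_comap, Ideal.map_quotient_self] at h
    exact h
  let E : MvPolynomial (Fin n) F ⧸ MvPolynomial.idealOfVars (Fin n) F ^ N →ₐ[F] O ⧸ m ^ N :=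
    Ideal.Quotient.liftₐ _ e he2
  let g₂ : O →ₐ[F] O ⧸ m ^ N := (E.comp ((truncTotalAlgHom (Fin n) F N).restrictScalars F)).comp j
  have hg₂ : ∀ o, g₂ o = e (truncTotal N (j o)) := fun o => rfl
  -- Taking residues and evaluating the truncated jet agree on the coordinates and modulo the
  -- nilpotent image of m, hence on R by rigidity. The orders N = 0 and N = 1 are separate because
  -- truncation then loses X_i itself.
  have key : ((Ideal.Quotient.mkₐ k (m ^ N)).comp ι) = (g₂.restrictScalars k).comp ι := by
    refine algHom_ext ht (I := m.map (Ideal.Quotient.mk (m ^ N))) ?_ ?_ ?_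
    · rw [eq_bot_iff]
      refine (iInf_le _ N).trans ?_
      rw [← Ideal.map_pow, Ideal.map_quotient_self]
    · intro i
      rcases Nat.lt_or_ge 1 N with hN | hN
      · change Ideal.Quotient.mk _ _ = e (truncTotal N (j (ι (t i))))
        have : truncTotal N (C (x (t i)) + X i) = MvPolynomial.C (x (t i)) + MvPolynomial.X i := by
          have h0 : (C (x (t i)) + X i : MvPowerSeries (Fin n) F) =
            ((MvPolynomial.C (x (t i)) + MvPolynomial.X i : MvPolynomial (Fin n) F) :
              MvPowerSeries (Fin n) F) := by simp
          rw [h0, truncTotal_coe_eq_self_iff _ (by omega)]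
          refine (MvPolynomial.totalDegree_add _ _).trans_lt ?_
          simpa using hN
        rw [hj, jet_coord, this]
        rw [map_add, MvPolynomial.aeval_X, MvPolynomial.aeval_C, map_sub]
        exact (add_sub_cancel _ _).symm
      · have hNm : N = 0 ∨ N = 1 := by omega
        rcases hNm with rfl | rfl
        · have : Subsingleton (O ⧸ m ^ 0) := by
            rw [pow_zero, Ideal.one_eq_top]; infer_instance
          exact Subsingleton.elim _ _
        · change Ideal.Quotient.mk _ _ = e (truncTotal 1 (j (ι (t i))))
          have : truncTotal 1 (C (x (t i)) + X i) = MvPolynomial.C (x (t i)) := by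
            ext b
            by_cases hb : b.degree < 1
            · have : b = 0 := by rw [← Finsupp.degree_eq_zero_iff]; omega
              subst this
              rw [coeff_truncTotal _ hb]
              simp
            · rw [coeff_truncTotal_eq_zero _ (by omega), MvPolynomial.coeff_C, if_neg]
              rintro rfl
              simp at hb
          rw [hj, jet_coord, this]
          simp only [e, MvPolynomial.aeval_C,
            IsScalarTower.algebraMap_apply F O (O ⧸ m ^ 1), Ideal.Quotient.algebraMap_eq]
          rw [Ideal.Quotient.eq, pow_one]
          exact htm i
    · intro r
      change Ideal.Quotient.mk _ (ι r) - e (truncTotal N (j (ι r))) ∈ _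
      have h1 := Ideal.mem_map_of_mem (Ideal.Quotient.mk (m ^ N)) (hsub (ι r))
      have h2 := he1 (truncTotal N (j (ι r)))
      rcases Nat.eq_zero_or_pos N with rfl | hN
      · have : m.map (Ideal.Quotient.mk (m ^ 0)) = ⊤ := by
          have : Subsingleton (O ⧸ m ^ 0) := by
            rw [pow_zero, Ideal.one_eq_top]; infer_instance
          exact Subsingleton.elim _ _
        rw [this]; trivial
      · rw [constantCoeff_truncTotal_eq_ite, if_pos (by omega)] at h2
        have := Ideal.sub_mem _ h1 h2
        rw [map_sub] at this
        rw [sub_sub_sub_cancel_right] at this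
        exact this
  have hg : Ideal.Quotient.mkₐ F (m ^ N) = g₂ :=
    hepi _ _ _ fun r => DFunLike.congr_fun key r
  have h0 : g₂ o = 0 := by
    rw [hg₂]
    refine he2 _ ?_
    rw [MvPolynomial.mem_pow_idealOfVars_iff']
    intro b hb
    rw [coeff_truncTotal _ hb]
    exact mem_varIdeal_pow_iff.1 ho b hb
  rw [← hg] at h0
  exact Ideal.Quotient.eq_zero_iff_mem.1 h0

end LocalRing

end EtaleCoord

end

/-! ### Testing ideal membership and primality on jets -/

noncomputable section

namespace MvPowerSeries

variable {σ A : Type*} [CommRing A]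

open Classical in
/-- The substitution `X i ↦ 0` for `i ∈ S`. -/
def killVars (S : Set σ) : MvPowerSeries σ A →+* MvPowerSeries σ A :=
  rescale fun i => if i ∈ S then 0 else 1

open Classical in
theorem coeff_killVars (S : Set σ) (p : MvPowerSeries σ A) (b : σ →₀ ℕ) :
    coeff b (killVars S p) = if ∀ i ∈ S, b i = 0 then coeff b p else 0 := by
  rw [killVars, coeff_rescale]
  split_ifs with h
  · rw [Finsupp.prod, Finset.prod_eq_one, one_mul]
    intro i hi
    rw [if_neg, one_pow]
    intro hS
    exact (Finsupp.mem_support_iff.1 hi) (h i hS)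
  · push Not at h
    obtain ⟨i, hS, hi⟩ := h
    rw [Finsupp.prod, Finset.prod_eq_zero (i := i) (by simpa using hi), zero_mul]
    rw [if_pos hS, zero_pow hi]

open Classical in
theorem killVars_X_of_mem {S : Set σ} {i : σ} (hi : i ∈ S) :
    killVars S (X i : MvPowerSeries σ A) = 0 := by
  ext b
  rw [coeff_killVars, map_zero, coeff_X]
  split_ifs with h1 h2
  · have := h1 i hi
    rw [h2] at this
    simp at this
  all_goals rfl

open Classical in
theorem killVars_X_of_notMem {S : Set σ} {i : σ} (hi : i ∉ S) :
    killVars S (X i : MvPowerSeries σ A) = X i := by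
  ext b
  rw [coeff_killVars, coeff_X]
  split_ifs with h1 h2 h2
  · rfl
  · rfl
  · refine absurd (fun i' hi' => ?_) h1
    rw [h2, Finsupp.single_eq_of_ne]
    rintro rfl
    exact hi hi'
  · rfl

open Classical in
theorem killVars_C (S : Set σ) (a : A) : killVars S (C a : MvPowerSeries σ A) = C a := by
  ext b
  rw [coeff_killVars, coeff_C]
  split_ifs with h1 h2 h2
  · rfl
  · rfl
  · exact absurd (fun i _ => by simp [h2]) h1
  · rfl

/-- Modulo the N-th power only the truncation matters. It is a finite sum of monomials each
divisible by one with exponent in M, so M may be infinite. -/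
theorem mem_span_monomial_sup_pow [Finite σ] {M : Set (σ →₀ ℕ)} {p : MvPowerSeries σ A} {N : ℕ}
    (h : ∀ b : σ →₀ ℕ, b.degree < N → coeff b p ≠ 0 → ∃ m ∈ M, m ≤ b) :
    p ∈ Ideal.span ((fun m => monomial m (1 : A)) '' M) ⊔ varIdeal σ A ^ N := by
  rw [← sub_add_cancel p (truncTotal N p : MvPolynomial σ A), add_comm]
  refine Submodule.add_mem_sup ?_ (sub_truncTotal_mem N p)
  rw [MvPolynomial.as_sum (truncTotal N p), ← MvPolynomial.coeToMvPowerSeries.ringHom_apply, map_sum]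
  refine Ideal.sum_mem _ fun b hb => ?_
  rw [MvPolynomial.coeToMvPowerSeries.ringHom_apply, MvPolynomial.coe_monomial]
  rw [MvPolynomial.mem_support_iff] at hb
  have hdeg : b.degree < N := by
    by_contra hN
    exact hb (coeff_truncTotal_eq_zero _ (by omega))
  rw [coeff_truncTotal _ hdeg] at hb ⊢
  obtain ⟨m, hm, hmb⟩ := h b hdeg hb
  have : monomial b (coeff b p) = monomial (b - m) (coeff b p) * monomial m 1 := by
    rw [monomial_mul_monomial, tsub_add_cancel_of_le hmb, mul_one]
  rw [this]
  exact Ideal.mul_mem_left _ _ (Ideal.subset_span ⟨m, hm, rfl⟩)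

open Classical in
theorem mem_span_X_sup_pow [Finite σ] {S : Set σ} {p : MvPowerSeries σ A} (h : killVars S p = 0)
    (N : ℕ) : p ∈ Ideal.span (X '' S) ⊔ varIdeal σ A ^ N := by
  have := mem_span_monomial_sup_pow (M := (fun i => Finsupp.single i 1) '' S) (p := p) (N := N) ?_
  · rwa [Set.image_image] at this
  · intro b _ hb
    have hb' := congrArg (coeff b) h
    rw [coeff_killVars, map_zero] at hb'
    split_ifs at hb' with h1
    · exact absurd hb' hb
    · push Not at h1
      obtain ⟨i, hi, hbi⟩ := h1
      exact ⟨_, ⟨i, hi, rfl⟩, by simpa [Nat.one_le_iff_ne_zero] using hbi⟩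

end MvPowerSeries

namespace EtaleCoord

open MvPowerSeries

/-- A Taylor expansion on a local `F`-algebra `O` with coordinates `t`, injective on all jets. -/
structure IsLocalJet {F O : Type*} [Field F] [CommRing O] [IsLocalRing O] [Algebra F O] {n : ℕ}
    (t : Fin n → O) (a : Fin n → F) (j : O →ₐ[F] MvPowerSeries (Fin n) F) : Prop where
  coord : ∀ i, j (t i) = C (a i) + X i
  mem_pow : ∀ N o, j o ∈ varIdeal (Fin n) F ^ N → o ∈ IsLocalRing.maximalIdeal O ^ N

namespace IsLocalJet

variable {F O : Type*} [Field F] [CommRing O] [IsLocalRing O] [Algebra F O] {n : ℕ} {t : Fin n → O}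
  {a : Fin n → F} {j : O →ₐ[F] MvPowerSeries (Fin n) F} (hj : IsLocalJet t a j)

include hj

/-- The truncation of p, evaluated at t_i - a_i, has that truncation as its jet; so jets are dense.
-/
theorem exists_sub_mem (p : MvPowerSeries (Fin n) F) (N : ℕ) :
    ∃ o, p - j o ∈ varIdeal (Fin n) F ^ N := by
  let e : MvPolynomial (Fin n) F →ₐ[F] O := MvPolynomial.aeval fun i => t i - algebraMap F O (a i)
  have : j.comp e = MvPolynomial.coeToMvPowerSeries.algHom F := by
    refine MvPolynomial.algHom_ext fun i => ?_
    simp only [AlgHom.comp_apply, e, MvPolynomial.aeval_X, map_sub, hj.coord, AlgHom.commutes]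
    simp [MvPowerSeries.algebraMap_apply]
  refine ⟨e (truncTotal N p), ?_⟩
  have h := DFunLike.congr_fun this (truncTotal N p)
  rw [AlgHom.comp_apply] at h
  rw [h]
  simpa using sub_truncTotal_mem N p

/-- By density, the power series coefficients in a combination of jets of 𝔠 can be replaced by jets
of elements of O up to order N. Since jets detect the powers of the maximal ideal, g ∈ 𝔠 + 𝔪^N for
all N, and Krull's intersection theorem for O/𝔠 concludes. -/
theorem mem_of_forall_mem [IsNoetherianRing O] {𝔠 : Ideal O} {g : O}
    (h : ∀ N, j g ∈ 𝔠.map j ⊔ varIdeal (Fin n) F ^ N) : g ∈ 𝔠 := by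
  have key : ∀ N, g ∈ 𝔠 ⊔ IsLocalRing.maximalIdeal O ^ N := by
    intro N
    obtain ⟨p, hp, q, hq, hpq⟩ := Submodule.mem_sup.1 (h N)
    have hex : ∃ c ∈ 𝔠, p - j c ∈ varIdeal (Fin n) F ^ N := by
      clear hpq
      induction hp using Submodule.span_induction with
      | mem p hp =>
        obtain ⟨c, hc, rfl⟩ := hp
        exact ⟨c, hc, by simp⟩
      | zero => exact ⟨0, zero_mem _, by simp⟩
      | add p p' _ _ h1 h2 =>
        obtain ⟨c, hc, h1⟩ := h1
        obtain ⟨c', hc', h2⟩ := h2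
        refine ⟨c + c', add_mem hc hc', ?_⟩
        rw [map_add, add_sub_add_comm]
        exact add_mem h1 h2
      | smul f p _ h1 =>
        obtain ⟨c, hc, h1⟩ := h1
        obtain ⟨o, ho⟩ := hj.exists_sub_mem f N
        refine ⟨o * c, Ideal.mul_mem_left _ _ hc, ?_⟩
        rw [map_mul, smul_eq_mul,
          show f * p - j o * j c = f * (p - j c) + j c * (f - j o) by ring]
        exact add_mem (Ideal.mul_mem_left _ _ h1) (Ideal.mul_mem_left _ _ ho)
    obtain ⟨c, hc, hcp⟩ := hex
    rw [← add_sub_cancel c g]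
    refine Submodule.add_mem_sup hc (hj.mem_pow N _ ?_)
    rw [map_sub, ← hpq, add_sub_right_comm]
    exact add_mem hcp hq
  have hcl := Ideal.iInf_pow_smul_eq_bot_of_isLocalRing (R := O) (M := O ⧸ 𝔠)
    (IsLocalRing.maximalIdeal O) (Ideal.IsPrime.ne_top inferInstance)
  rw [← Ideal.Quotient.eq_zero_iff_mem, ← Submodule.mem_bot O, ← hcl, Submodule.mem_iInf]
  intro N
  obtain ⟨c, hc, d, hd, hcd⟩ := Submodule.mem_sup.1 (key N)
  have : Ideal.Quotient.mk 𝔠 g = d • (1 : O ⧸ 𝔠) := by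
    rw [← hcd, map_add, Ideal.Quotient.eq_zero_iff_mem.2 hc, zero_add, Algebra.smul_def, mul_one]
    rfl
  rw [this]
  exact Submodule.smul_mem_smul hd trivial

/-- The ideal is the kernel of a map to the domain F[[X]]: expand, then set X_i = 0 for i ∈ S. -/
theorem isPrime_span [IsNoetherianRing O] {S : Set (Fin n)} (hS : ∀ i ∈ S, a i = 0) :
    (Ideal.span (t '' S)).IsPrime := by
  classical
  have hX : ∀ i ∈ S, j (t i) = X i := fun i hi => by rw [hj.coord, hS i hi]; simp
  have : Ideal.span (t '' S) = RingHom.ker ((killVars S).comp j.toRingHom) := by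
    apply le_antisymm
    · rw [Ideal.span_le]
      rintro _ ⟨i, hi, rfl⟩
      change killVars S (j (t i)) = 0
      rw [hX i hi, killVars_X_of_mem hi]
    · intro g hg
      refine hj.mem_of_forall_mem fun N => ?_
      have : (Ideal.span (t '' S)).map j = Ideal.span (X '' S) := by
        rw [Ideal.map_span, Set.image_image]
        congr 1
        exact Set.image_congr hX
      rw [this]
      exact mem_span_X_sup_pow hg N
  have : IsDomain (MvPowerSeries (Fin n) F) := NoZeroDivisors.to_isDomain _
  rw [‹Ideal.span _ = _›]
  exact RingHom.ker_isPrime _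

end IsLocalJet

section Localization

variable {k F R : Type*} [Field k] [CommRing R] [Field F] [Algebra k R] [Algebra k F]
  {n : ℕ} {t : Fin n → R}

open scoped TensorProduct

instance ker_algHom_isPrime (x : R →ₐ[k] F) : (RingHom.ker x).IsPrime := RingHom.ker_isPrime _

/-- The `F`-point of `F ⊗ R` defined by an `F`-valued point of `R`. -/
def tensorPoint (x : R →ₐ[k] F) : F ⊗[k] R →ₐ[F] F :=
  Algebra.TensorProduct.lift (Algebra.ofId F F) x fun _ _ => Commute.all _ _

instance ker_tensorPoint_isPrime (x : R →ₐ[k] F) : (RingHom.ker (tensorPoint x)).IsPrime :=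
  RingHom.ker_isPrime _

/-- F may be larger than the residue field of R at the kernel of x. Over F ⊗ R the point becomes
F-rational, and the jet extends to the local ring there because its constant term is the value at
the point. -/
theorem exists_isLocalJet (ht : (MvPolynomial.eval₂Hom (algebraMap k R) t).Etale)
    (x : R →ₐ[k] F) :
    ∃ j : Localization.AtPrime (RingHom.ker (tensorPoint x)) →ₐ[F] MvPowerSeries (Fin n) F,
      (∀ r : R, j (algebraMap (F ⊗[k] R) _ (1 ⊗ₜ r)) = jet ht x r) ∧
      IsLocalJet (fun i => algebraMap (F ⊗[k] R) _ (1 ⊗ₜ (t i))) (fun i => x (t i)) j := by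
  set q := RingHom.ker (tensorPoint x)
  let j₀ : F ⊗[k] R →ₐ[F] MvPowerSeries (Fin n) F :=
    Algebra.TensorProduct.lift (Algebra.ofId F _) (jet ht x) fun _ _ => Commute.all _ _
  have hj₀ : ∀ r, j₀ (1 ⊗ₜ r) = jet ht x r := fun r => by simp [j₀]
  have hc : ∀ z, constantCoeff (j₀ z) = tensorPoint x z := by
    intro z
    induction z using TensorProduct.induction_on with
    | zero => simp
    | tmul f r =>
      simp [j₀, tensorPoint, Algebra.ofId_apply, MvPowerSeries.algebraMap_apply]
    | add a b ha hb => rw [map_add, map_add, map_add, ha, hb]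
  let j : Localization.AtPrime q →ₐ[F] MvPowerSeries (Fin n) F :=
    IsLocalization.liftAlgHom (M := q.primeCompl) (f := j₀) fun y => by
      rw [MvPowerSeries.isUnit_iff_constantCoeff, hc, isUnit_iff_ne_zero]
      exact y.2
  have hj : ∀ z, j (algebraMap _ _ z) = j₀ z := fun z => by simp [j]
  refine ⟨j, fun r => by rw [hj, hj₀], fun i => by rw [hj, hj₀, jet_coord], fun N o ho => ?_⟩
  let ι : R →ₐ[k] Localization.AtPrime q :=
    ((IsScalarTower.toAlgHom F (F ⊗[k] R) (Localization.AtPrime q)).restrictScalars k).comp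
      Algebra.TensorProduct.includeRight
  refine mem_pow_of_jet_mem ht x ι ?_ j (fun r => (hj _).trans (hj₀ r)) _ ?_ ho
  · intro B _ _ g₁ g₂ h
    let := ((algebraMap F B).comp (algebraMap k F)).toAlgebra
    have : IsScalarTower k F B := .of_algebraMap_eq fun _ => rfl
    refine IsLocalization.algHom_ext q.primeCompl (Algebra.TensorProduct.ext (by ext) ?_)
    ext r
    exact h r
  · intro o ho
    rw [IsLocalRing.mem_maximalIdeal, mem_nonunits_iff]
    intro hu
    have := (hu.map j).map (constantCoeff (σ := Fin n) (R := F))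
    rw [ho] at this
    exact not_isUnit_zero this

theorem ker_tensorPoint_comap (x : R →ₐ[k] F) :
    RingHom.ker x = (RingHom.ker (tensorPoint x)).comap
      (Algebra.TensorProduct.includeRight : R →ₐ[k] F ⊗[k] R).toRingHom := by
  ext r
  simp [RingHom.mem_ker, tensorPoint]

section

variable (ht : (MvPolynomial.eval₂Hom (algebraMap k R) t).Etale) (x : R →ₐ[k] F)

include ht in
theorem finiteType : Algebra.FiniteType k R := by
  have h1 : (MvPolynomial.eval₂Hom (algebraMap k R) t).FiniteType :=
    RingHom.FiniteType.of_finitePresentation ht.finitePresentation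
  have h2 : (algebraMap k (MvPolynomial (Fin n) k)).FiniteType :=
    RingHom.finiteType_algebraMap.2 inferInstance
  have := h1.comp h2
  rw [← RingHom.finiteType_algebraMap]
  convert! this
  ext a
  simp

/-- The homomorphism from the local ring of `R` to that of `F ⊗ R`. -/
def tensorLocal : Localization.AtPrime (RingHom.ker x) →+*
    Localization.AtPrime (RingHom.ker (tensorPoint x)) :=
  Localization.localRingHom (RingHom.ker x) (RingHom.ker (tensorPoint x))
      (Algebra.TensorProduct.includeRight : R →ₐ[k] F ⊗[k] R).toRingHom
      (ker_tensorPoint_comap x)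

/-- R → F ⊗ R is flat, being a base change of k → F, and a flat local homomorphism is faithfully
flat. Ideals may therefore be compared after extending scalars to F. -/
theorem comap_map_tensorLocal (I : Ideal (Localization.AtPrime (RingHom.ker x))) :
    (I.map (tensorLocal x)).comap (tensorLocal x) = I := by
  have hflat : (Algebra.TensorProduct.includeRight : R →ₐ[k] F ⊗[k] R).toRingHom.Flat := by
    algebraize [(Algebra.TensorProduct.includeRight : R →ₐ[k] F ⊗[k] R).toRingHom]
    have h : Module.Flat R (R ⊗[k] F) := inferInstance
    exact Module.Flat.of_linearEquiv (M := R ⊗[k] F)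
      { (Algebra.TensorProduct.comm k F R) with
        map_smul' := fun r z => by
          have : r • z = (1 ⊗ₜ r : F ⊗[k] R) * z := rfl
          simp [this, Algebra.smul_def] }
  have hf := hflat.localRingHom (P := RingHom.ker (tensorPoint x)) (Q := RingHom.ker x)
    (ker_tensorPoint_comap x)
  let := (tensorLocal x).toAlgebra
  have : Module.Flat (Localization.AtPrime (RingHom.ker x))
    (Localization.AtPrime (RingHom.ker (tensorPoint x))) := hf
  have : IsLocalHom (algebraMap (Localization.AtPrime (RingHom.ker x))
      (Localization.AtPrime (RingHom.ker (tensorPoint x)))) :=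
    Localization.isLocalHom_localRingHom _ _ _ (ker_tensorPoint_comap x)
  have := Module.FaithfullyFlat.of_flat_of_isLocalHom (A := Localization.AtPrime (RingHom.ker x))
    (B := Localization.AtPrime (RingHom.ker (tensorPoint x)))
  exact Ideal.comap_map_eq_self_of_faithfullyFlat I

include ht in
theorem isNoetherianRing_localization :
    IsNoetherianRing (Localization.AtPrime (RingHom.ker (tensorPoint x))) := by
  have := finiteType ht
  have : IsNoetherianRing (F ⊗[k] R) := Algebra.FiniteType.isNoetherianRing F _
  infer_instance

theorem map_map_tensorLocal (𝔠 : Ideal R) :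
    (𝔠.map (algebraMap R (Localization.AtPrime (RingHom.ker x)))).map (tensorLocal x) =
    𝔠.map ((algebraMap (F ⊗[k] R) (Localization.AtPrime (RingHom.ker (tensorPoint x)))).comp
      (Algebra.TensorProduct.includeRight : R →ₐ[k] F ⊗[k] R).toRingHom) := by
  rw [Ideal.map_map]
  congr 1
  ext r
  simp [tensorLocal, Localization.localRingHom_to_map]

/-- Membership in an ideal of the local ring of `R` at `x` can be tested on all jets. -/
theorem mem_map_of_forall_jet_mem {𝔠 : Ideal R} {g : R}
    (h : ∀ N, jet ht x g ∈ 𝔠.map (jet ht x) ⊔ varIdeal (Fin n) F ^ N) :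
    algebraMap R (Localization.AtPrime (RingHom.ker x)) g ∈
      𝔠.map (algebraMap R (Localization.AtPrime (RingHom.ker x))) := by
  obtain ⟨j, hj, hloc⟩ := exists_isLocalJet ht x
  have := isNoetherianRing_localization ht x
  rw [← comap_map_tensorLocal x (𝔠.map _), Ideal.mem_comap, map_map_tensorLocal, tensorLocal,
    Localization.localRingHom_to_map]
  refine hloc.mem_of_forall_mem fun N => ?_
  have hg : j (algebraMap (F ⊗[k] R) _ ((Algebra.TensorProduct.includeRight :
    R →ₐ[k] F ⊗[k] R).toRingHom g)) = jet ht x g := hj g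
  have hc : (𝔠.map ((algebraMap (F ⊗[k] R)
      (Localization.AtPrime (RingHom.ker (tensorPoint x)))).comp
      (Algebra.TensorProduct.includeRight : R →ₐ[k] F ⊗[k] R).toRingHom)).map j =
      𝔠.map (jet ht x) := by
    rw [← Ideal.map_coe j, Ideal.map_map, ← Ideal.map_coe (jet ht x)]
    congr 1
    ext1 r
    exact hj r
  rw [hg, hc]
  exact h N

include ht in
theorem isPrime_map_span {S : Set (Fin n)} (hS : ∀ i ∈ S, x (t i) = 0) :
    ((Ideal.span (t '' S)).map
      (algebraMap R (Localization.AtPrime (RingHom.ker x)))).IsPrime := by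
  obtain ⟨j, hj, hloc⟩ := exists_isLocalJet ht x
  have := isNoetherianRing_localization ht x
  have hp := hloc.isPrime_span hS
  rw [← comap_map_tensorLocal x (Ideal.map _ _), map_map_tensorLocal, Ideal.map_span,
    Set.image_image]
  exact Ideal.IsPrime.comap (K := _) (hK := hp) _

end

end Localization

end EtaleCoord

end

/-! ### Graded pieces and expansions transversal to a coordinate slice -/

noncomputable section

namespace MvPowerSeries

variable {σ F : Type*} [Field F]

open Classical in
/-- The part of a power series consisting of the monomials with exponent in `B`. -/
def part (B : Set (σ →₀ ℕ)) : MvPowerSeries σ F →ₗ[F] MvPowerSeries σ F where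
  toFun p := fun b => if b ∈ B then coeff b p else 0
  map_add' p q := by
    ext b
    change (if b ∈ B then coeff b (p + q) else 0) =
      (if b ∈ B then coeff b p else 0) + (if b ∈ B then coeff b q else 0)
    split_ifs <;> simp
  map_smul' a p := by
    ext b
    change (if b ∈ B then coeff b (a • p) else 0) = a • (if b ∈ B then coeff b p else 0)
    split_ifs <;> simp

open Classical in
theorem coeff_part (B : Set (σ →₀ ℕ)) (p : MvPowerSeries σ F) (b : σ →₀ ℕ) :
    coeff b (part B p) = if b ∈ B then coeff b p else 0 := rfl

theorem part_part (B B' : Set (σ →₀ ℕ)) (p : MvPowerSeries σ F) :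
    part B (part B' p) = part (B ∩ B') p := by
  classical
  ext b
  simp only [coeff_part, Set.mem_inter_iff]
  split_ifs <;> tauto

variable [Finite σ]

open Classical in
/-- An ideal stable under rescaling of one variable by infinitely many scalars is graded with
respect to that variable. -/
theorem part_mem_of_rescale_mem {J : Ideal (MvPowerSeries σ F)} {N : ℕ}
    (hN : varIdeal σ F ^ N ≤ J) {i : σ} {Λ : Set F} (hΛ : Λ.Infinite) {p : MvPowerSeries σ F}
    (hJ : ∀ a ∈ Λ, rescale (Function.update 1 i a) p ∈ J) (d : ℕ) :
    part {b | b i = d} p ∈ J := by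
  rcases Nat.lt_or_ge d N with hd | hd
  swap
  · refine hN (mem_varIdeal_pow_iff.2 fun b hb => ?_)
    rw [coeff_part, if_neg]
    rintro (rfl : b i = d)
    exact absurd (Finsupp.le_degree i b) (by omega)
  -- Modulo the N-th power, the rescaled series is a polynomial in the scalar a whose coefficients
  -- are the graded pieces of p.
  have hsum : ∀ a, rescale (Function.update 1 i a) p -
      ∑ e ∈ Finset.range N, a ^ e • part {b | b i = e} p ∈ varIdeal σ F ^ N := by
    intro a
    rw [mem_varIdeal_pow_iff]
    intro b hb
    have hbi : b i < N := (Finsupp.le_degree i b).trans_lt hb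
    rw [map_sub, map_sum, coeff_rescale, Finset.sum_eq_single (b i), coeff_smul, coeff_part,
      if_pos (show b ∈ {b' : σ →₀ ℕ | b' i = b i} from rfl), sub_eq_zero]
    · congr 1
      rw [Finsupp.prod]
      by_cases h : i ∈ b.support
      · rw [Finset.prod_eq_single i]
        · simp
        · intro c _ hc
          simp [Function.update_of_ne hc]
        · exact fun h' => absurd h h'
      · rw [Finset.prod_eq_one, Finsupp.notMem_support_iff.1 h, pow_zero]
        intro c hc
        have : c ≠ i := fun h' => h (h' ▸ hc)
        simp [Function.update_of_ne this]
    · intro e _ he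
      rw [coeff_smul, coeff_part, if_neg (show b ∉ {b' : σ →₀ ℕ | b' i = e} from fun h => he h.symm),
        mul_zero]
    · intro h
      exact absurd (Finset.mem_range.2 hbi) h
  -- A linear functional on the quotient by J turns these pieces into the coefficients of a scalar
  -- polynomial with infinitely many roots. All its coefficients vanish, and functionals separate
  -- the elements of the quotient.
  rw [← Ideal.Quotient.eq_zero_iff_mem, ← Module.forall_dual_apply_eq_zero_iff F]
  intro f
  let v : ℕ → F := fun e => f (Ideal.Quotient.mk J (part {b | b i = e} p))
  let Q : Polynomial F := ∑ e ∈ Finset.range N, Polynomial.monomial e (v e)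
  have hQ : Q = 0 := by
    refine Polynomial.eq_zero_of_infinite_isRoot _ (hΛ.mono fun a ha => ?_)
    have h1 := sub_mem (hJ a ha) (hN (hsum a))
    rw [sub_sub_cancel, ← Ideal.Quotient.eq_zero_iff_mem] at h1
    have h2 := congrArg f h1
    rw [map_sum, map_sum, map_zero] at h2
    rw [Set.mem_ofPred_eq, Polynomial.IsRoot, Polynomial.eval_finsetSum, ← h2]
    refine Finset.sum_congr rfl fun e _ => ?_
    rw [Polynomial.eval_monomial, mul_comm, ← smul_eq_mul, ← map_smul]
    rfl
  have := congrArg (fun q => Polynomial.coeff q d) hQ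
  simpa [Q, Polynomial.finsetSum_coeff, Polynomial.coeff_monomial, hd] using this

theorem part_mem_of_forall_rescale_mem {J : Ideal (MvPowerSeries σ F)} {N : ℕ}
    [DecidableEq σ] (hN : varIdeal σ F ^ N ≤ J) (s : Finset σ) {Λ : Set F} (hΛ : Λ.Infinite)
    (hJ : ∀ i ∈ s, ∀ a ∈ Λ, ∀ p ∈ J, rescale (Function.update 1 i a) p ∈ J)
    {p : MvPowerSeries σ F} (hp : p ∈ J) (m : σ → ℕ) : part {b | ∀ i ∈ s, b i = m i} p ∈ J := by
  induction s using Finset.induction_on with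
  | empty =>
    convert! hp
    ext b
    simp [coeff_part]
  | insert i s _ ih =>
    have h1 := ih fun i' hi' => hJ i' (Finset.mem_insert_of_mem hi')
    have h2 := part_mem_of_rescale_mem hN hΛ
      (fun a ha => by
        convert! hJ i (Finset.mem_insert_self _ _) a ha _ h1) (m i)
    rw [part_part] at h2
    have : {b : σ →₀ ℕ | ∀ i' ∈ insert i s, b i' = m i'} =
        {b | b i = m i} ∩ {b | ∀ i ∈ s, b i = m i} := by
      ext b
      simp
    rwa [this]

end MvPowerSeries

namespace EtaleCoord

open MvPowerSeries

section Split

variable {k F R : Type*} [Field k] [CommRing R] [Field F] [Algebra k R] [Algebra k F]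
  {n : ℕ} {t : Fin n → R} (ht : (MvPolynomial.eval₂Hom (algebraMap k R) t).Etale)
  (s : Finset (Fin n))

/-- The Taylor expansion along the subvariety `t i = 0`, `i ∈ s`. -/
def sliceJet (x : R →ₐ[k] F) (hx : ∀ i ∈ s, x (t i) = 0) :
    R ⧸ Ideal.span (t '' s) →+* MvPowerSeries (Fin n) F :=
  Ideal.Quotient.lift _ ((killVars (s : Set (Fin n))).comp (jet ht x).toRingHom) fun a ha => by
    have : Ideal.span (t '' s) ≤
        RingHom.ker ((killVars (s : Set (Fin n))).comp (jet ht x).toRingHom) := by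
      rw [Ideal.span_le]
      rintro _ ⟨i, hi, rfl⟩
      change killVars _ (jet ht x (t i)) = 0
      rw [jet_coord, hx i hi, map_zero, zero_add, killVars_X_of_mem hi]
    exact RingHom.mem_ker.1 (this ha)

theorem sliceJet_mk (x : R →ₐ[k] F) (hx : ∀ i ∈ s, x (t i) = 0) (r : R) :
    sliceJet ht s x hx (Ideal.Quotient.mk _ r) = killVars s (jet ht x r) := rfl

variable {s}

theorem coeff_sliceJet_eq_zero {x : R →ₐ[k] F} (hx : ∀ i ∈ s, x (t i) = 0)
    (a : R ⧸ Ideal.span (t '' s)) {b : Fin n →₀ ℕ} {i : Fin n} (hi : i ∈ s) (hb : b i ≠ 0) :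
    coeff b (sliceJet ht s x hx a) = 0 := by
  classical
  obtain ⟨r, rfl⟩ := Ideal.Quotient.mk_surjective a
  rw [sliceJet_mk, coeff_killVars, if_neg]
  exact fun h => hb (h i hi)

theorem constantCoeff_sliceJet {x : R →ₐ[k] F} (hx : ∀ i ∈ s, x (t i) = 0) (r : R) :
    constantCoeff (sliceJet ht s x hx (Ideal.Quotient.mk _ r)) = x r := by
  classical
  rw [sliceJet_mk, ← coeff_zero_eq_constantCoeff_apply, coeff_killVars, if_pos (by simp),
    coeff_zero_eq_constantCoeff_apply, constantCoeff_jet]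

theorem sliceJet_coord {x : R →ₐ[k] F} (hx : ∀ i ∈ s, x (t i) = 0) {i : Fin n} (hi : i ∉ s) :
    sliceJet ht s x hx (Ideal.Quotient.mk _ (t i)) = C (x (t i)) + X i := by
  classical
  rw [sliceJet_mk, jet_coord, map_add, killVars_C, killVars_X_of_notMem (by simpa using hi)]

-- Slice jets involve only the variables outside s, while the substituted variables lie in s. An
-- exponent b therefore splits uniquely into a part selecting a coefficient of q and a part
-- selecting a term of its slice jet.
open Classical in
theorem coeff_eval₂_sliceJet {x : R →ₐ[k] F} (hx : ∀ i ∈ s, x (t i) = 0)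
    (q : MvPolynomial (Fin n) (R ⧸ Ideal.span (t '' s))) (b : Fin n →₀ ℕ) :
    coeff b (MvPolynomial.eval₂Hom (sliceJet ht s x hx) (fun i => if i ∈ s then X i else 0) q) =
      coeff (b.filter (· ∉ s)) (sliceJet ht s x hx (q.coeff (b.filter (· ∈ s)))) := by
  induction q using MvPolynomial.induction_on' with
  | add p q hp hq => simp only [map_add, MvPolynomial.coeff_add, hp, hq]
  | monomial m a =>
    rw [MvPolynomial.coe_eval₂Hom, MvPolynomial.eval₂_monomial, MvPolynomial.coeff_monomial]
    by_cases hm : ∀ i, i ∉ s → m i = 0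
    · have hprod : (m.prod fun i e => (if i ∈ s then X i else 0 : MvPowerSeries (Fin n) F) ^ e) =
          monomial m 1 := by
        rw [MvPowerSeries.monomial_one_eq]
        refine Finset.prod_congr rfl fun i hi => ?_
        beta_reduce
        rw [if_pos]
        by_contra h
        exact (Finsupp.mem_support_iff.1 hi) (hm i h)
      rw [hprod, coeff_mul_monomial, mul_one]
      split_ifs with h1 h2 h2
      · congr 2
        refine Finsupp.ext fun i => ?_
        rw [Finsupp.tsub_apply, Finsupp.filter_apply, h2, Finsupp.filter_apply]
        split_ifs <;> simp
      · rw [map_zero, map_zero]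
        have : ∃ i ∈ s, (b - m) i ≠ 0 := by
          by_contra! h
          refine h2 (Finsupp.ext fun i => ?_)
          rw [Finsupp.filter_apply]
          split_ifs with hi
          · have := h i hi
            have := h1 i
            rw [Finsupp.tsub_apply] at *
            omega
          · exact hm i hi
        obtain ⟨i, hi, hbi⟩ := this
        exact coeff_sliceJet_eq_zero ht hx _ hi hbi
      · refine absurd (fun i => ?_) h1
        rw [h2, Finsupp.filter_apply]
        split_ifs <;> simp
      · simp
    · push Not at hm
      obtain ⟨i, hi, hmi⟩ := hm
      rw [if_neg, Finsupp.prod, Finset.prod_eq_zero (i := i) (by simpa using hmi), mul_zero,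
        map_zero, map_zero, map_zero]
      · rw [if_neg hi, zero_pow hmi]
      · intro h
        rw [h, Finsupp.filter_apply, if_neg hi] at hmi
        exact hmi rfl

/-- The Taylor expansion of a function transversally to the subvariety `t i = 0`, `i ∈ s`. -/
theorem exists_transversal_expansion (s : Finset (Fin n)) (G : R) :
    ∃ g : MvPowerSeries (Fin n) (R ⧸ Ideal.span (t '' s)), ∀ (x : R →ₐ[k] F)
      (hx : ∀ i ∈ s, x (t i) = 0) (b : Fin n →₀ ℕ), coeff b (jet ht x G) =
        coeff (b.filter (· ∉ s)) (sliceJet ht s x hx (coeff (b.filter (· ∈ s)) g)) := by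
  classical
  set A := R ⧸ Ideal.span (t '' s)
  -- Étaleness makes the formal neighbourhood of the slice a product: R maps to A[[X]] with t_i ↦
  -- X_i on s and t_i ↦ its class otherwise. The coefficients are functions on the whole slice,
  -- chosen before any point x.
  obtain ⟨φ, hφt, hφ⟩ := exists_lift ht (varIdeal (Fin n) A)
    ((Ideal.Quotient.mkₐ k _).comp (((Algebra.ofId A (MvPowerSeries (Fin n) A)).restrictScalars k).comp
      (Ideal.Quotient.mkₐ k (Ideal.span (t '' s)))))
    (fun i => if i ∈ s then X i else C (Ideal.Quotient.mk _ (t i))) fun i => by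
      change Ideal.Quotient.mk _ (algebraMap A (MvPowerSeries (Fin n) A)
        (Ideal.Quotient.mk _ (t i))) = _
      rw [Ideal.Quotient.eq, mem_varIdeal_iff, MvPowerSeries.algebraMap_apply]
      split_ifs with hi
      · have : Ideal.Quotient.mk (Ideal.span (t '' s)) (t i) = 0 :=
          Ideal.Quotient.eq_zero_iff_mem.2 (Ideal.subset_span ⟨i, hi, rfl⟩)
        simp [this]
      · simp
  have hφc : ∀ r, constantCoeff (φ r) = Ideal.Quotient.mk _ r := fun r => by
    have := hφ r
    change _ = Ideal.Quotient.mk _ (algebraMap A (MvPowerSeries (Fin n) A)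
        (Ideal.Quotient.mk _ r)) at this
    rw [Ideal.Quotient.eq, mem_varIdeal_iff, MvPowerSeries.algebraMap_apply] at this
    simpa [sub_eq_zero] using this
  refine ⟨φ G, fun x hx b => ?_⟩
  -- The coefficient at b is visible modulo the N-th power exactly when N exceeds the degree of b.
  let N := b.degree + 1
  let e := MvPolynomial.eval₂Hom (sliceJet ht s x hx)
    (fun i => if i ∈ s then X i else (0 : MvPowerSeries (Fin n) F))
  let Ψ : MvPolynomial (Fin n) A ⧸ MvPolynomial.idealOfVars (Fin n) A ^ N →+*
      MvPowerSeries (Fin n) F ⧸ varIdeal (Fin n) F ^ N :=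
    Ideal.Quotient.lift _ ((Ideal.Quotient.mk _).comp e) fun q hq => by
      rw [RingHom.comp_apply, Ideal.Quotient.eq_zero_iff_mem]
      have : MvPolynomial.idealOfVars (Fin n) A ≤ (varIdeal (Fin n) F).comap e := by
        rw [Ideal.span_le]
        rintro _ ⟨i, rfl⟩
        rw [SetLike.mem_coe, Ideal.mem_comap, mem_varIdeal_iff]
        simp only [e, MvPolynomial.eval₂Hom_X']
        split_ifs <;> simp
      exact Ideal.le_comap_pow e N (Ideal.pow_right_mono this N hq)
  let ψ : R →+* MvPowerSeries (Fin n) F ⧸ varIdeal (Fin n) F ^ N :=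
    (Ψ.comp (truncTotalAlgHom (Fin n) A N).toRingHom).comp φ.toRingHom
  have hψ : ∀ r, ψ r = Ideal.Quotient.mk _ (e (truncTotal N (φ r))) := fun r => rfl
  have hψk : ∀ c : k, ψ (algebraMap k R c) = algebraMap k _ c := by
    intro c
    change Ψ (truncTotalAlgHom (Fin n) A N (φ (algebraMap k R c))) = _
    have h1 : φ (algebraMap k R c) = algebraMap (MvPolynomial (Fin n) A) _
        (MvPolynomial.C (algebraMap k A c)) := by
      rw [AlgHom.commutes, MvPowerSeries.algebraMap_apply', MvPolynomial.coe_C, map_C,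
        MvPowerSeries.algebraMap_apply, Algebra.algebraMap_self_apply]
    rw [h1, AlgHom.commutes]
    change Ideal.Quotient.mk _ (e _) = _
    rw [Algebra.algebraMap_self_apply]
    simp only [e, MvPolynomial.eval₂Hom_C]
    have : algebraMap k A c = Ideal.Quotient.mk _ (algebraMap k R c) := rfl
    rw [this, sliceJet_mk, AlgHom.commutes]
    rw [MvPowerSeries.algebraMap_apply, killVars_C, ← MvPowerSeries.algebraMap_apply]
    rfl
  let ψ' : R →ₐ[k] MvPowerSeries (Fin n) F ⧸ varIdeal (Fin n) F ^ N := { ψ with commutes' := hψk }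
  -- Expanding transversally and then expanding the coefficients along the slice at x has the same
  -- coordinates and constant terms as the jet at x, so rigidity identifies them modulo the N-th
  -- power.
  have key : (Ideal.Quotient.mkₐ k _).comp (jet ht x) = ψ' := by
    refine algHom_ext ht (I := (varIdeal (Fin n) F).map (Ideal.Quotient.mk _)) ?_ ?_ ?_
    · rw [eq_bot_iff]
      refine (iInf_le _ N).trans ?_
      rw [← Ideal.map_pow, Ideal.map_quotient_self]
    · intro i
      change Ideal.Quotient.mk _ (jet ht x (t i)) = Ψ (truncTotalAlgHom (Fin n) A N (φ (t i)))
      have h1 : φ (t i) = algebraMap (MvPolynomial (Fin n) A) _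
          (if i ∈ s then MvPolynomial.X i else MvPolynomial.C (Ideal.Quotient.mk _ (t i))) := by
        rw [hφt, MvPowerSeries.algebraMap_apply']
        split_ifs <;> simp
      rw [h1, AlgHom.commutes]
      change _ = Ideal.Quotient.mk _ (e _)
      rw [jet_coord, Algebra.algebraMap_self_apply]
      congr 1
      split_ifs with hi
      · simp only [e, MvPolynomial.eval₂Hom_X', if_pos hi, hx i hi, map_zero, zero_add]
      · simp only [e, MvPolynomial.eval₂Hom_C, sliceJet_coord ht hx hi]
    · intro r
      change Ideal.Quotient.mk _ (jet ht x r) - Ideal.Quotient.mk _ (e (truncTotal N (φ r))) ∈ _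
      rw [← map_sub]
      refine Ideal.mem_map_of_mem _ ?_
      rw [mem_varIdeal_iff, map_sub, constantCoeff_jet, ← coeff_zero_eq_constantCoeff_apply,
        coeff_eval₂_sliceJet]
      have h0 : ∀ (P : Fin n → Prop) [DecidablePred P], (0 : Fin n →₀ ℕ).filter P = 0 := fun P _ => by
        ext; simp [Finsupp.filter_apply]
      rw [h0, h0, coeff_truncTotal _ (by simp [N]), coeff_zero_eq_constantCoeff_apply,
        coeff_zero_eq_constantCoeff_apply, hφc, constantCoeff_sliceJet, sub_self]
  have h := DFunLike.congr_fun key G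
  change Ideal.Quotient.mk _ (jet ht x G) = Ideal.Quotient.mk _ (e (truncTotal N (φ G))) at h
  rw [Ideal.Quotient.eq, mem_varIdeal_pow_iff] at h
  have h1 := h b (Nat.lt_succ_self _)
  rw [map_sub, sub_eq_zero, coeff_eval₂_sliceJet, coeff_truncTotal] at h1
  · exact h1
  · refine lt_of_le_of_lt ?_ (Nat.lt_succ_self b.degree)
    have := Finsupp.filter_add_filter_not b (· ∈ s)
    conv_rhs => rw [← this]
    rw [map_add]
    exact Nat.le_add_right _ _

end Split

end EtaleCoord

end

/-! ### Jet invariant ideals are generated by monomials -/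

noncomputable section

namespace EtaleCoord

open MvPowerSeries

open scoped TensorProduct

theorem nonempty_algHom_of_isAlgClosed (F T : Type*) [Field F] [IsAlgClosed F] [CommRing T]
    [Nontrivial T] [Algebra F T] [Algebra.FiniteType F T] : Nonempty (T →ₐ[F] F) := by
  obtain ⟨m, hm⟩ := Ideal.exists_maximal T
  let : Field (T ⧸ m) := Ideal.Quotient.field m
  have : Module.Finite F (T ⧸ m) := finite_of_finite_type_of_isJacobsonRing F (T ⧸ m)
  exact ⟨(IsAlgClosed.lift (R := F) (S := T ⧸ m) (M := F)).comp (Ideal.Quotient.mkₐ F m)⟩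

section

variable {k F R : Type*} [Field k] [CommRing R] [Field F] [Algebra k R] [Algebra k F]
  {n : ℕ} {t : Fin n → R}

theorem exists_algHom_ker_eq [IsAlgClosed F] [Algebra.FiniteType k R] (p : Ideal R)
    [hp : p.IsMaximal] : ∃ x : R →ₐ[k] F, RingHom.ker x = p := by
  let : Field (R ⧸ p) := Ideal.Quotient.field p
  have : Module.Finite k (R ⧸ p) := finite_of_finite_type_of_isJacobsonRing k (R ⧸ p)
  let x : R →ₐ[k] F :=
    (IsAlgClosed.lift (R := k) (S := R ⧸ p) (M := F)).comp (Ideal.Quotient.mkₐ k p)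
  refine ⟨x, (hp.eq_of_le (RingHom.ker_ne_top _) fun r hr => ?_).symm⟩
  rw [RingHom.mem_ker]
  change IsAlgClosed.lift (R := k) (S := R ⧸ p) (M := F) (Ideal.Quotient.mk p r) = 0
  rw [Ideal.Quotient.eq_zero_iff_mem.2 hr, map_zero]

/-- A point of an étale neighbourhood over a point of affine space in its image. -/
theorem exists_algHom_of_mem_range [IsAlgClosed F]
    (ht : (MvPolynomial.eval₂Hom (algebraMap k R) t).Etale) (a : R) (z : Fin n → F)
    {P : PrimeSpectrum R} (ha : a ∉ P.asIdeal)
    (hP : P.asIdeal.comap (MvPolynomial.eval₂Hom (algebraMap k R) t) =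
      RingHom.ker (MvPolynomial.aeval (R := k) z)) :
    ∃ y : R →ₐ[k] F, (∀ i, y (t i) = z i) ∧ y a ≠ 0 := by
  let E := MvPolynomial (Fin n) k
  let : Algebra E R := (MvPolynomial.eval₂Hom (algebraMap k R) t).toAlgebra
  have : Algebra.Etale E R := ht
  let S := Localization.Away a
  let 𝔮 : PrimeSpectrum E := PrimeSpectrum.comap (algebraMap E R) P
  have hz : 𝔮.asIdeal = RingHom.ker (MvPolynomial.aeval (R := k) z) := hP
  have hrange : 𝔮 ∈ Set.range (PrimeSpectrum.comap (algebraMap E S)) := by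
    have : P ∈ Set.range (PrimeSpectrum.comap (algebraMap R S)) := by
      rw [PrimeSpectrum.localization_away_comap_range S a]
      exact ha
    obtain ⟨P', hP'⟩ := this
    refine ⟨P', ?_⟩
    rw [IsScalarTower.algebraMap_eq E R S, PrimeSpectrum.comap_comp_apply, hP']
  have hnt := (PrimeSpectrum.nontrivial_iff_mem_rangeComap (S := S) 𝔮).2 hrange
  let κ := 𝔮.asIdeal.ResidueField
  let ζ : κ →+* F := Ideal.ResidueField.lift 𝔮.asIdeal
    (MvPolynomial.aeval (R := k) z : E →ₐ[k] F).toRingHom (fun e he => by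
      rw [hz] at he; exact he) (fun e he => by
      rw [Submonoid.mem_comap]
      refine isUnit_iff_ne_zero.2 fun h0 => he ?_
      rw [hz]; exact h0)
  let : Algebra κ F := ζ.toAlgebra
  -- The fibre over the point of affine space is nonzero because that point lies in the image of the
  -- locus a ≠ 0; the Nullstellensatz over F gives an F-valued point of this fibre.
  have hT : Nontrivial (F ⊗[κ] (κ ⊗[E] S)) := inferInstance
  obtain ⟨f⟩ := nonempty_algHom_of_isAlgClosed F (F ⊗[κ] (κ ⊗[E] S))
  let g : R →+* F := (f.toRingHom.comp (Algebra.TensorProduct.includeRight :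
    (κ ⊗[E] S) →ₐ[κ] F ⊗[κ] (κ ⊗[E] S)).toRingHom).comp
    ((Algebra.TensorProduct.includeRight : S →ₐ[E] κ ⊗[E] S).toRingHom.comp (algebraMap R S))
  have hg : ∀ e : E, g (algebraMap E R e) = MvPolynomial.aeval (R := k) z e := by
    intro e
    change f (1 ⊗ₜ (1 ⊗ₜ (algebraMap R S (algebraMap E R e)))) = _
    have h1 : (1 : κ) ⊗ₜ[E] algebraMap R S (algebraMap E R e) =
        algebraMap κ (κ ⊗[E] S) (algebraMap E κ e) := by
      rw [← IsScalarTower.algebraMap_apply, ← IsScalarTower.algebraMap_apply]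
      exact (Algebra.TensorProduct.includeRight : S →ₐ[E] κ ⊗[E] S).commutes e
    rw [h1]
    refine (((f.restrictScalars κ).comp (Algebra.TensorProduct.includeRight :
      (κ ⊗[E] S) →ₐ[κ] F ⊗[κ] (κ ⊗[E] S))).commutes (algebraMap E κ e)).trans ?_
    change ζ (algebraMap E κ e) = _
    exact Ideal.ResidueField.lift_algebraMap ..
  let y : R →ₐ[k] F :=
    { g with
      commutes' := fun c => by
        have := hg (MvPolynomial.C c)
        rw [MvPolynomial.aeval_C] at this
        rw [← this]
        change g (algebraMap k R c) = g (MvPolynomial.eval₂Hom (algebraMap k R) t _)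
        rw [MvPolynomial.eval₂Hom_C] }
  refine ⟨y, fun i => ?_, ?_⟩
  · have := hg (MvPolynomial.X i)
    rw [MvPolynomial.aeval_X] at this
    rw [← this]
    change g (t i) = g (MvPolynomial.eval₂Hom (algebraMap k R) t _)
    rw [MvPolynomial.eval₂Hom_X']
  · have : IsUnit (algebraMap R S a) := IsLocalization.Away.algebraMap_isUnit a
    exact ((this.map (Algebra.TensorProduct.includeRight : S →ₐ[E] κ ⊗[E] S)).map
      (f.toRingHom.comp (Algebra.TensorProduct.includeRight :
        (κ ⊗[E] S) →ₐ[κ] F ⊗[κ] (κ ⊗[E] S)).toRingHom)).ne_zero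

/-- A function which is not nilpotent on `t i = 0`, `i ∈ s`, is nonzero at some point there whose
coordinates differ from given ones by elements of the infinite set `L`. -/
theorem exists_point_ne_zero [IsAlgClosed F]
    (ht : (MvPolynomial.eval₂Hom (algebraMap k R) t).Etale) (s : Finset (Fin n)) {a : R}
    (ha : ∀ N, a ^ N ∉ Ideal.span (t '' s)) {L : Set F} (hL : L.Infinite) (x : Fin n → F) :
    ∃ y : R →ₐ[k] F, (∀ i ∈ s, y (t i) = 0) ∧ (∀ i ∉ s, y (t i) - x i ∈ L) ∧ y a ≠ 0 := by
  let E := MvPolynomial (Fin n) k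
  let : Algebra E R := (MvPolynomial.eval₂Hom (algebraMap k R) t).toAlgebra
  have : Algebra.Etale E R := ht
  have halg : ∀ e : E, algebraMap E R e = MvPolynomial.eval₂Hom (algebraMap k R) t e := fun _ => rfl
  have hopen : IsOpenMap (PrimeSpectrum.comap (algebraMap E R)) :=
    PrimeSpectrum.isOpenMap_comap_of_hasGoingDown_of_finitePresentation
  obtain ⟨q, hq, hsq, haq⟩ : ∃ q : Ideal R, q.IsPrime ∧ Ideal.span (t '' s) ≤ q ∧ a ∉ q := by
    have : a ∉ (Ideal.span (t '' s)).radical := fun ⟨N, hN⟩ => ha N hN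
    rw [Ideal.radical_eq_sInf, Submodule.mem_sInf] at this
    push Not at this
    obtain ⟨q, ⟨h1, h2⟩, h3⟩ := this
    exact ⟨q, h2, h1, h3⟩
  -- The image of a ≠ 0 under the étale map is open, so it contains a principal open set h ≠ 0
  -- around the image of q. It then suffices to find a point of the coordinate slice in affine space
  -- where h does not vanish.
  have hU := hopen _ (PrimeSpectrum.basicOpen a).isOpen
  obtain ⟨_, ⟨_, ⟨h, rfl⟩, rfl⟩, hqh, hh⟩ := PrimeSpectrum.isBasis_basic_opens.exists_subset_of_mem_open
    (Set.mem_image_of_mem (PrimeSpectrum.comap (algebraMap E R))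
      (show (⟨q, hq⟩ : PrimeSpectrum R) ∈ (PrimeSpectrum.basicOpen a : Set _) from haq)) hU
  let kill : E →ₐ[k] E := MvPolynomial.aeval fun i => if i ∈ s then 0 else MvPolynomial.X i
  -- Modulo q the coordinates in s vanish, so h and its restriction to the slice agree there, and h
  -- is nonzero modulo q.
  have hkill : kill h ≠ 0 := by
    intro h0
    refine hqh ?_
    have hmk : ((Ideal.Quotient.mk q).comp (algebraMap E R)).comp kill.toRingHom =
        (Ideal.Quotient.mk q).comp (algebraMap E R) := by
      refine MvPolynomial.ringHom_ext (fun c => ?_) fun i => ?_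
      · exact congrArg (fun e : E => Ideal.Quotient.mk q (algebraMap E R e)) (kill.commutes c)
      · have hX : kill (MvPolynomial.X i) = if i ∈ s then 0 else MvPolynomial.X i :=
          MvPolynomial.aeval_X _ _
        change Ideal.Quotient.mk q (algebraMap E R (kill (MvPolynomial.X i))) =
          Ideal.Quotient.mk q (algebraMap E R (MvPolynomial.X i))
        rw [hX]
        split_ifs with hi
        · rw [map_zero, map_zero, eq_comm, Ideal.Quotient.eq_zero_iff_mem, halg,
            MvPolynomial.eval₂Hom_X']
          exact hsq (Ideal.subset_span ⟨i, hi, rfl⟩)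
        · rfl
    have := DFunLike.congr_fun hmk h
    change Ideal.Quotient.mk q (algebraMap E R (kill h)) = Ideal.Quotient.mk q (algebraMap E R h)
      at this
    rw [h0, map_zero, map_zero, eq_comm, Ideal.Quotient.eq_zero_iff_mem] at this
    exact this
  have hkF : MvPolynomial.map (algebraMap k F) (kill h) ≠ 0 := by
    rwa [Ne, ← map_zero (MvPolynomial.map (algebraMap k F)),
      (MvPolynomial.map_injective _ (algebraMap k F).injective).eq_iff]
  -- A nonzero polynomial cannot vanish on the product of the infinite sets x_i + L.
  obtain ⟨c, hc, hch⟩ : ∃ c : Fin n → F, (∀ i, c i ∈ (fun l => x i + l) '' L) ∧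
      MvPolynomial.aeval c (kill h) ≠ 0 := by
    by_contra! hcon
    refine hkF (MvPolynomial.funext_set (fun i => (fun l => x i + l) '' L)
      (fun i => hL.image (add_right_injective (x i)).injOn) fun c hc => ?_)
    rw [map_zero, MvPolynomial.eval_map, ← MvPolynomial.aeval_def]
    exact hcon c fun i => hc i trivial
  let z : Fin n → F := fun i => if i ∈ s then 0 else c i
  have hz : MvPolynomial.aeval z h = MvPolynomial.aeval c (kill h) := by
    have : (MvPolynomial.aeval (R := k) c).comp kill = MvPolynomial.aeval z := by
      refine MvPolynomial.algHom_ext fun i => ?_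
      simp only [kill, AlgHom.comp_apply, MvPolynomial.aeval_X, z]
      split_ifs <;> simp
    rw [← this, AlgHom.comp_apply]
  have hprime : (RingHom.ker (MvPolynomial.aeval (R := k) z)).IsPrime := RingHom.ker_isPrime _
  obtain ⟨P, haP, hP⟩ := hh (show (⟨RingHom.ker (MvPolynomial.aeval (R := k) z), hprime⟩ :
    PrimeSpectrum E) ∈ (PrimeSpectrum.basicOpen h : Set _) from fun h0 => hch (by
      rw [← hz]; exact h0))
  obtain ⟨y, hy, hya⟩ := exists_algHom_of_mem_range ht a z haP
    (congrArg PrimeSpectrum.asIdeal hP)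
  refine ⟨y, fun i hi => by simp [hy, z, hi], fun i hi => ?_, hya⟩
  obtain ⟨l, hl, hlc⟩ := hc i
  simp only [hy, z, if_neg hi, ← hlc]
  simpa using hl

/-- Invariance of an ideal, on the level of jets at `F`-valued points of `t i = 0`, `i ∈ s`, under
rescaling of the `t i`, `i ∈ s`, and translations in the other coordinates, by elements of `L`. -/
def JetInvariant (ht : (MvPolynomial.eval₂Hom (algebraMap k R) t).Etale) (s : Finset (Fin n))
    (L : Set F) (I : Ideal R) : Prop :=
  ∀ (x₁ x₂ : R →ₐ[k] F), (∀ i ∈ s, x₁ (t i) = 0) → (∀ i ∈ s, x₂ (t i) = 0) →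
    (∀ i, x₂ (t i) - x₁ (t i) ∈ L) →
    ∀ c : Fin n → F, (∀ i, c i ∈ L) → (∀ i, c i ≠ 0) → (∀ i ∉ s, c i = 1) →
    ∀ N, ∀ G ∈ I, rescale c (jet ht x₂ G) ∈ I.map (jet ht x₁) ⊔ varIdeal (Fin n) F ^ N

/-- A jet invariant ideal is locally generated by monomials. -/
theorem JetInvariant.map_eq_span [IsAlgClosed F]
    {ht : (MvPolynomial.eval₂Hom (algebraMap k R) t).Etale} {s : Finset (Fin n)}
    {L : Subfield F} (hL : (L : Set F).Infinite) {I : Ideal R} (hI : JetInvariant ht s (L : Set F) I)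
    (x : R →ₐ[k] F) (hx : ∀ i ∈ s, x (t i) = 0) :
    ∃ M : Set (Fin n → ℕ), (∀ m ∈ M, ∀ i ∉ s, m i = 0) ∧
      I.map (algebraMap R (Localization.AtPrime (RingHom.ker x))) =
        (Ideal.span ((fun m => ∏ i, t i ^ m i) '' M)).map (algebraMap R _) := by
  classical
  let J : (R →ₐ[k] F) → ℕ → Ideal (MvPowerSeries (Fin n) F) := fun y N =>
    I.map (jet ht y) ⊔ varIdeal (Fin n) F ^ N
  have hresc : ∀ (c : Fin n → F) N (p : MvPowerSeries (Fin n) F), p ∈ varIdeal (Fin n) F ^ N →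
      rescale c p ∈ varIdeal (Fin n) F ^ N := by
    intro c N p hp
    rw [mem_varIdeal_pow_iff] at hp ⊢
    intro b hb
    rw [coeff_rescale, hp b hb, mul_zero]
  have hJJ : ∀ y₁ y₂ : R →ₐ[k] F, (∀ i ∈ s, y₁ (t i) = 0) → (∀ i ∈ s, y₂ (t i) = 0) →
      (∀ i, y₂ (t i) - y₁ (t i) ∈ L) →
      ∀ c : Fin n → F, (∀ i, c i ∈ L) → (∀ i, c i ≠ 0) → (∀ i ∉ s, c i = 1) →
      ∀ N, ∀ p ∈ J y₂ N, rescale c p ∈ J y₁ N := by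
    intro y₁ y₂ h1 h2 h3 c hc hc0 hc1 N
    have : J y₂ N ≤ (J y₁ N).comap (rescale c) := by
      refine sup_le ?_ fun p hp => ?_
      · rw [← Ideal.map_coe, Ideal.map_le_iff_le_comap]
        intro G hG
        exact hI y₁ y₂ h1 h2 h3 c hc hc0 hc1 N G hG
      · exact Ideal.mem_sup_right (hresc c N p hp)
    exact fun p hp => this hp
  have hgr : ∀ (y : R →ₐ[k] F), (∀ i ∈ s, y (t i) = 0) → ∀ N p, p ∈ J y N → ∀ m : Fin n → ℕ,
      part {b | ∀ i ∈ s, b i = m i} p ∈ J y N := by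
    intro y hy N p hp m
    refine part_mem_of_forall_rescale_mem le_sup_right s (Λ := L \ {0})
      (hL.sdiff (Set.finite_singleton 0)) (fun i hi a ha p hp => ?_) hp m
    refine hJJ y y hy hy (fun i => by rw [sub_self]; exact zero_mem _) _ (fun i' => ?_)
      (fun i' => ?_) (fun i' hi' => ?_) N p hp
    · by_cases h : i' = i
      · subst h; simpa using ha.1
      · rw [Function.update_of_ne h]; exact one_mem _
    · by_cases h : i' = i
      · subst h; simpa using ha.2
      · rw [Function.update_of_ne h]; exact one_ne_zero
    · rw [Function.update_of_ne, Pi.one_apply]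
      rintro rfl
      exact hi' hi
  let mon : (Fin n →₀ ℕ) → R := fun m => ∏ i, t i ^ m i
  have hmon : ∀ m : Fin n →₀ ℕ, (∀ i ∉ s, m i = 0) → ∀ y : R →ₐ[k] F, (∀ i ∈ s, y (t i) = 0) →
      jet ht y (mon m) = monomial m 1 := by
    intro m hm y hy
    simp only [mon, map_prod, map_pow, jet_coord]
    rw [monomial_one_eq, Finsupp.prod_fintype _ _ (fun i => pow_zero _)]
    refine Finset.prod_congr rfl fun i _ => ?_
    by_cases hi : i ∈ s
    · rw [hy i hi, map_zero, zero_add]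
    · rw [hm i hi, pow_zero, pow_zero]
  -- All monomials in the variables of s that belong to the ideal of jets at x to every order.
  let M : Set (Fin n →₀ ℕ) := {m | (∀ i ∉ s, m i = 0) ∧ ∀ N, monomial m 1 ∈ J x N}
  have hfil : ∀ (b : Fin n →₀ ℕ) (i : Fin n), i ∉ s → b.filter (· ∈ s) i = 0 := fun b i hi => by
    rw [Finsupp.filter_apply, if_neg hi]
  have hkey : ∀ G ∈ I, ∀ b, coeff b (jet ht x G) ≠ 0 → b.filter (· ∈ s) ∈ M := by
    intro G hG b hb
    refine ⟨hfil b, fun N => ?_⟩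
    obtain ⟨g, hg⟩ := exists_transversal_expansion (F := F) ht s G
    set m := b.filter (· ∈ s)
    obtain ⟨a, ha⟩ := Ideal.Quotient.mk_surjective (coeff m g)
    -- The coefficient function of t^m on the slice has a nonzero jet at x, and power series over a
    -- field have no nilpotents; so it is not nilpotent, although it may vanish at x.
    have hnil : ∀ N, a ^ N ∉ Ideal.span (t '' s) := by
      intro N hN
      rw [← Ideal.Quotient.eq_zero_iff_mem, map_pow, ha] at hN
      rw [hg x hx b] at hb
      have h0 := congrArg (sliceJet ht s x hx) hN
      rw [map_pow, map_zero] at h0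
      rw [eq_zero_of_pow_eq_zero h0, map_zero] at hb
      exact hb rfl
    obtain ⟨y, hy, hyL, hya⟩ := exists_point_ne_zero ht s hnil hL (fun i => x (t i))
    have hGy : jet ht y G ∈ J y N := Ideal.mem_sup_left (Ideal.mem_map_of_mem _ hG)
    have hpart := hgr y hy N _ hGy m
    -- At y the graded piece of degree m is the expansion of the coefficient function times the
    -- monomial. The first factor is a unit since the function is nonzero at y.
    have hfac : part {b | ∀ i ∈ s, b i = m i} (jet ht y G) =
        sliceJet ht s y hy (coeff m g) * monomial m 1 := by
      ext b'
      rw [coeff_part, coeff_mul_monomial, mul_one]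
      have hmm : ∀ i, i ∉ s → m i = 0 := hfil b
      split_ifs with h1 h2 h2
      · rw [hg y hy b']
        have e1 : b'.filter (· ∈ s) = m := by
          refine Finsupp.ext fun i => ?_
          rw [Finsupp.filter_apply]
          split_ifs with hi
          · exact h1 i hi
          · exact (hmm i hi).symm
        have e2 : b'.filter (· ∉ s) = b' - m := by
          refine Finsupp.ext fun i => ?_
          rw [Finsupp.filter_apply, Finsupp.tsub_apply]
          split_ifs with hi
          · rw [h1 i hi, Nat.sub_self]
          · rw [hmm i hi, Nat.sub_zero]
        rw [e1, e2]
      · refine absurd (fun i => ?_) h2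
        by_cases hi : i ∈ s
        · exact (h1 i hi).ge
        · rw [hmm i hi]; exact Nat.zero_le _
      · obtain ⟨i, hi, hbi⟩ : ∃ i ∈ s, b' i ≠ m i := by
          by_contra! h
          exact h1 h
        refine (coeff_sliceJet_eq_zero ht hy _ hi ?_).symm
        rw [Finsupp.tsub_apply]
        have := h2 i
        omega
      · rfl
    rw [hfac, ← ha] at hpart
    have hunit : IsUnit (sliceJet ht s y hy (Ideal.Quotient.mk _ a)) := by
      rw [MvPowerSeries.isUnit_iff_constantCoeff, constantCoeff_sliceJet]
      exact isUnit_iff_ne_zero.2 hya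
    have hmy : monomial m 1 ∈ J y N := (Ideal.unit_mul_mem_iff_mem _ hunit).1 hpart
    -- Pure translation, with all scalars equal to 1, carries the monomial from y back to x.
    have := hJJ x y hx hy (fun i => ?_) 1 (fun _ => one_mem _) (fun _ => one_ne_zero)
      (fun _ _ => rfl) N _ hmy
    · rwa [rescale_one] at this
    · by_cases hi : i ∈ s
      · rw [hx i hi, hy i hi, sub_zero]; exact zero_mem _
      · exact hyL i hi
  refine ⟨(fun m : Fin n →₀ ℕ => (m : Fin n → ℕ)) '' M, ?_, ?_⟩
  · rintro _ ⟨m, hm, rfl⟩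
    exact hm.1
  · rw [Set.image_image]
    apply le_antisymm
    · rw [Ideal.map_le_iff_le_comap]
      intro G hG
      refine mem_map_of_forall_jet_mem ht x fun N => ?_
      have himg : (Ideal.span ((fun m : Fin n →₀ ℕ => ∏ i, t i ^ m i) '' M)).map (jet ht x) =
          Ideal.span ((fun m => monomial m (1 : F)) '' M) := by
        rw [Ideal.map_span, Set.image_image]
        congr 1
        exact Set.image_congr fun m hm => hmon m hm.1 x hx
      rw [himg]
      refine mem_span_monomial_sup_pow fun b _ hb => ⟨_, hkey G hG b hb, fun i => ?_⟩
      rw [Finsupp.filter_apply]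
      split_ifs
      · exact le_rfl
      · exact Nat.zero_le _
    · rw [Ideal.map_le_iff_le_comap, Ideal.span_le]
      rintro _ ⟨m, hm, rfl⟩
      refine mem_map_of_forall_jet_mem ht x fun N => ?_
      change jet ht x (mon m) ∈ _
      rw [hmon m hm.1 x hx]
      exact hm.2 N

end

end EtaleCoord

end

/-! ### From local rings to neighbourhoods, and adapted charts of an snc pair -/

noncomputable section

/-- Finitely many generators need finitely many denominators, and g is their product. Inverting g
spreads an inclusion from the local ring to a neighbourhood. -/
theorem Ideal.exists_mul_mem_of_map_le {R : Type*} [CommRing R] (p : Ideal R) [p.IsPrime]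
    {I J : Ideal R} (hI : I.FG)
    (h : I.map (algebraMap R (Localization.AtPrime p)) ≤ J.map (algebraMap R _)) :
    ∃ g ∉ p, ∀ a ∈ I, g * a ∈ J := by
  classical
  obtain ⟨G, rfl⟩ := hI
  have : ∀ a ∈ G, ∃ g ∉ p, g * a ∈ J := by
    intro a ha
    have := h (Ideal.mem_map_of_mem _ (Ideal.subset_span ha))
    rw [IsLocalization.mem_map_algebraMap_iff p.primeCompl] at this
    obtain ⟨⟨⟨b, hb⟩, s⟩, hs⟩ := this
    rw [← map_mul, IsLocalization.eq_iff_exists p.primeCompl] at hs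
    obtain ⟨c, hc⟩ := hs
    refine ⟨c * s, (c * s).2, ?_⟩
    rw [mul_assoc, mul_comm (s : R), hc]
    exact J.mul_mem_left _ hb
  choose! g hg hgJ using this
  refine ⟨∏ a ∈ G, g a, fun hmem => ?_, fun a ha => ?_⟩
  · obtain ⟨a, ha, h⟩ := (Ideal.IsPrime.prod_mem_iff).1 hmem
    exact hg a ha h
  · induction ha using Submodule.span_induction with
    | mem a ha =>
      rw [← Finset.prod_erase_mul _ _ ha, mul_assoc]
      exact J.mul_mem_left _ (hgJ a ha)
    | zero => rw [mul_zero]; exact J.zero_mem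
    | add a b _ _ ha hb => rw [mul_add]; exact J.add_mem ha hb
    | smul c a _ ha =>
      rw [smul_eq_mul, mul_left_comm]
      exact J.mul_mem_left _ ha

theorem Ideal.map_le_map_of_mul_mem {R S : Type*} [CommRing R] [CommRing S] (φ : R →+* S)
    {I J : Ideal R} {g : R} (hg : IsUnit (φ g)) (h : ∀ a ∈ I, g * a ∈ J) : I.map φ ≤ J.map φ := by
  rw [Ideal.map_le_iff_le_comap]
  intro a ha
  have := Ideal.mem_map_of_mem φ (h a ha)
  rw [map_mul] at this
  exact (Ideal.unit_mul_mem_iff_mem _ hg).1 this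

namespace StratifiedPair

variable {k : Type u} [Field k] {X : Scheme.{u}} {f : X ⟶ Spec (.of k)}

theorem map_constants {U V : X.Opens} (h : U ≤ V) (c : k) :
    X.presheaf.map (homOfLE h).op (constants f V c) = constants f U c := by
  simp only [constants, RingHom.comp_apply]
  rw [← CommRingCat.comp_apply, ← X.presheaf.map_comp]
  rfl

theorem map_comp_eval₂Hom {U V : X.Opens} (h : U ≤ V) {n : ℕ} (t : Fin n → Γ(X, V)) :
    MvPolynomial.eval₂Hom (constants f U) (fun i => X.presheaf.map (homOfLE h).op (t i)) =
      (X.presheaf.map (homOfLE h).op).hom.comp (MvPolynomial.eval₂Hom (constants f V) t) := by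
  refine MvPolynomial.ringHom_ext (fun c => ?_) fun i => ?_
  · rw [MvPolynomial.eval₂Hom_C, RingHom.comp_apply, MvPolynomial.eval₂Hom_C]
    exact (map_constants h c).symm
  · rw [MvPolynomial.eval₂Hom_X', RingHom.comp_apply, MvPolynomial.eval₂Hom_X']

/-- Étale coordinates `t` on an affine open set such that each stratum is empty there or given by
the vanishing of some of the coordinates `t i`, `i ∈ s`. -/
structure IsAdaptedChart (f : X ⟶ Spec (.of k)) {ι : Type w} (D : ι → X.IdealSheafData)
    (U : X.affineOpens) {n : ℕ} (t : Fin n → Γ(X, U.1)) (s : Finset (Fin n)) : Prop where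
  etale : (MvPolynomial.eval₂Hom (constants f U.1) t).Etale
  ideal_stratum : ∀ Z, IsStratum D Z → (Scheme.IdealSheafData.vanishingIdeal Z).ideal U = ⊤ ∨
    ∃ S ⊆ (s : Set (Fin n)), (Scheme.IdealSheafData.vanishingIdeal Z).ideal U = Ideal.span (t '' S)

theorem IsAffineOpen.mem_basicOpen_iff {U : X.Opens} (hU : IsAffineOpen U)
    (p : PrimeSpectrum Γ(X, U)) (g : Γ(X, U)) : hU.fromSpec p ∈ X.basicOpen g ↔ g ∉ p.asIdeal := by
  change p ∈ hU.fromSpec ⁻¹ᵁ X.basicOpen g ↔ _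
  rw [hU.fromSpec_preimage_basicOpen]
  rfl

theorem mem_support_iff {I : X.IdealSheafData} {U : X.affineOpens} (p : PrimeSpectrum Γ(X, U.1)) :
    U.2.fromSpec p ∈ I.support ↔ I.ideal U ≤ p.asIdeal := by
  have hp : U.2.fromSpec p ∈ U.1 := by
    have := Set.mem_range_self (f := U.2.fromSpec) p
    rwa [U.2.range_fromSpec] at this
  rw [Scheme.IdealSheafData.mem_support_iff_of_mem hp]
  have := U.2.fromSpec_preimage_zeroLocus (I.ideal U : Set Γ(X, U.1))
  exact (Set.ext_iff.1 this p)

theorem exists_fromSpec_eq {U : X.Opens} (hU : IsAffineOpen U) {x : X} (hx : x ∈ U) :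
    ∃ p : PrimeSpectrum Γ(X, U), hU.fromSpec p = x := by
  have : x ∈ Set.range hU.fromSpec := by rwa [hU.range_fromSpec]
  exact this

section Chart

variable {ι : Type w} {D : ι → X.IdealSheafData}

theorem etale_restrict {U : X.Opens} (hU : IsAffineOpen U) {n : ℕ} {t : Fin n → Γ(X, U)}
    (ht : (MvPolynomial.eval₂Hom (constants f U) t).Etale) (g : Γ(X, U)) :
    (MvPolynomial.eval₂Hom (constants f (X.basicOpen g)) fun i =>
      X.presheaf.map (homOfLE (X.basicOpen_le g)).op (t i)).Etale := by
  rw [map_comp_eval₂Hom]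
  refine RingHom.Etale.stableUnderComposition _ _ ht ?_
  have := hU.isLocalization_basicOpen g
  have : Algebra.Etale Γ(X, U) Γ(X, X.basicOpen g) := .of_isLocalizationAway g
  exact RingHom.etale_algebraMap.2 this

theorem isUnit_map_basicOpen {U : X.Opens} (g : Γ(X, U)) :
    IsUnit ((X.presheaf.map (homOfLE (X.basicOpen_le g)).op).hom g) :=
  RingedSpace.isUnit_res_basicOpen _ g

theorem isPrime_map_basicOpen {U : X.Opens} (hU : IsAffineOpen U) (g : Γ(X, U))
    {P : Ideal Γ(X, U)} (hP : P.IsPrime) (hg : g ∉ P) :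
    (P.map (X.presheaf.map (homOfLE (X.basicOpen_le g)).op).hom).IsPrime := by
  have := hU.isLocalization_basicOpen g
  refine IsLocalization.isPrime_of_isPrime_disjoint (.powers g) Γ(X, X.basicOpen g) P hP ?_
  rw [Ideal.disjoint_powers_iff_notMem _ hP.isRadical]
  exact hg

end Chart

end StratifiedPair

end

noncomputable section

/-- Near a point, the ideals generated by coordinates vanishing at that point are prime. -/
theorem EtaleCoord.exists_isPrime_of_subset {k F R : Type*} [Field k] [CommRing R] [Field F]
    [Algebra k R] [Algebra k F] {n : ℕ} {t : Fin n → R}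
    (ht : (MvPolynomial.eval₂Hom (algebraMap k R) t).Etale) (x : R →ₐ[k] F) {T : Set (Fin n)}
    (hT : ∀ i ∈ T, x (t i) = 0) :
    ∃ γ ∉ RingHom.ker x, ∀ S ⊆ T, ∃ P : Ideal R, P.IsPrime ∧ P ≤ RingHom.ker x ∧
      Ideal.span (t '' S) ≤ P ∧ ∀ a ∈ P, γ * a ∈ Ideal.span (t '' S) := by
  classical
  have hft : Algebra.FiniteType k R := finiteType ht
  have : IsNoetherianRing R := Algebra.FiniteType.isNoetherianRing k R
  let P : Set (Fin n) → Ideal R := fun S =>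
    ((Ideal.span (t '' S)).map (algebraMap _ (Localization.AtPrime (RingHom.ker x)))).comap
      (algebraMap _ _)
  have hg : ∀ S, ∃ g ∉ RingHom.ker x, ∀ a ∈ P S, g * a ∈ Ideal.span (t '' S) := fun S =>
    Ideal.exists_mul_mem_of_map_le _ (IsNoetherian.noetherian _) Ideal.map_comap_le
  choose g hgx hgP using hg
  -- One denominator for all S at once: there are finitely many sets of coordinates.
  refine ⟨∏ S, g S, fun hmem => ?_, fun S hS => ⟨P S, ?_, fun a ha => ?_, Ideal.le_comap_map,
    fun a ha => ?_⟩⟩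
  · obtain ⟨S, _, hS⟩ := (Ideal.IsPrime.prod_mem_iff).1 hmem
    exact hgx S hS
  · have := isPrime_map_span ht x fun i hi => hT i (hS hi)
    exact Ideal.IsPrime.comap _
  · have := isPrime_map_span ht x fun i hi => hT i (hS hi)
    by_contra hax
    exact this.ne_top (Ideal.eq_top_of_isUnit_mem _ ha
      (IsLocalization.map_units (M := (RingHom.ker x).primeCompl) _ ⟨a, hax⟩))
  · rw [← Finset.prod_erase_mul _ _ (Finset.mem_univ S), mul_assoc]
    exact Ideal.mul_mem_left _ _ (hgP S a ha)

namespace StratifiedPair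

variable {k : Type u} [Field k] {X : Scheme.{u}} {f : X ⟶ Spec (.of k)}
  {ι : Type w} {D : ι → X.IdealSheafData}

theorem isMaximal_of_isClosed {U : X.Opens} (hU : IsAffineOpen U) (p : PrimeSpectrum Γ(X, U))
    (h : IsClosed {hU.fromSpec p}) : p.asIdeal.IsMaximal := by
  rw [← PrimeSpectrum.isClosed_singleton_iff_isMaximal]
  have h1 : {p} = hU.fromSpec ⁻¹' {hU.fromSpec p} := by
    ext q
    exact hU.fromSpec.isOpenEmbedding.injective.eq_iff.symm
  exact h1 ▸ h.preimage hU.fromSpec.continuous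

theorem vanishingIdeal_ideal_eq (Z : Closeds X) (U : X.affineOpens) (hU : IsAffineOpen U.1) :
    (Scheme.IdealSheafData.vanishingIdeal Z).ideal U =
      PrimeSpectrum.vanishingIdeal {q : PrimeSpectrum Γ(X, U.1) | hU.fromSpec q ∈ Z} :=
  rfl

/-- Coordinates at a closed point for which the intersections of coordinate divisors are
irreducible. -/
theorem IsSNCPair.exists_isPrime_coordinates (h : IsSNCPair f D) {x₀ : X}
    (hx₀ : IsClosed {x₀}) :
    ∃ (U : X.affineOpens) (n : ℕ) (t : Fin n → Γ(X, U.1)) (c : ι → Fin n), x₀ ∈ U.1 ∧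
      (MvPolynomial.eval₂Hom (constants f U.1) t).Etale ∧
      Set.InjOn c {i | x₀ ∈ (D i).support} ∧
      (∀ i, x₀ ∈ (D i).support → (D i).ideal U = Ideal.span {t (c i)}) ∧
      (∀ i, x₀ ∉ (D i).support → (D i).ideal U = ⊤) ∧
      ∀ S ⊆ c '' {i | x₀ ∈ (D i).support}, (Ideal.span (t '' S)).IsPrime := by
  obtain ⟨U, n, t, c, hxU, ht, hc, hD, hD'⟩ := h.exists_coordinates x₀
  obtain ⟨p, hp⟩ := exists_fromSpec_eq U.2 hxU
  have hmax : p.asIdeal.IsMaximal := isMaximal_of_isClosed U.2 p (hp ▸ hx₀)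
  let : Algebra k Γ(X, U.1) := (constants f U.1).toAlgebra
  replace ht : (MvPolynomial.eval₂Hom (algebraMap k Γ(X, U.1)) t).Etale := ht
  have hft : Algebra.FiniteType k Γ(X, U.1) := EtaleCoord.finiteType ht
  obtain ⟨x, hx⟩ := EtaleCoord.exists_algHom_ker_eq (k := k) (F := AlgebraicClosure k) p.asIdeal
  have htp : ∀ i ∈ c '' {i | x₀ ∈ (D i).support}, x (t i) = 0 := by
    rintro _ ⟨i, hi, rfl⟩
    change x₀ ∈ (D i).support at hi
    rw [← RingHom.mem_ker, hx]
    have h1 := hD i hi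
    rw [← hp, mem_support_iff] at hi
    exact hi (by rw [h1]; exact Ideal.subset_span rfl)
  -- Each coordinate ideal agrees with a prime P contained in the ideal of the point once γ is
  -- inverted. As γ ∉ P, the extension of P remains prime on the smaller chart.
  obtain ⟨γ, hγx, hprime⟩ := EtaleCoord.exists_isPrime_of_subset ht x htp
  have hγ : γ ∉ p.asIdeal := hx ▸ hγx
  have hVU : X.affineBasicOpen γ ≤ U := X.affineBasicOpen_le γ
  have h1 : x₀ ∈ (X.affineBasicOpen γ).1 := by
    rw [← hp]
    exact (IsAffineOpen.mem_basicOpen_iff U.2 p γ).2 hγ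
  have h2 := etale_restrict U.2 ht γ
  have h3 : ∀ i, x₀ ∈ (D i).support → (D i).ideal (X.affineBasicOpen γ) =
      Ideal.span {X.presheaf.map (homOfLE (X.basicOpen_le γ)).op (t (c i))} := by
    intro i hi
    rw [← (D i).map_ideal hVU, hD i hi, Ideal.map_span, Set.image_singleton]
    rfl
  have h4 : ∀ i, x₀ ∉ (D i).support → (D i).ideal (X.affineBasicOpen γ) = ⊤ := by
    intro i hi
    rw [← (D i).map_ideal hVU, hD' i hi, Ideal.map_top]
  have h5 : ∀ S ⊆ c '' {i | x₀ ∈ (D i).support}, (Ideal.span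
      ((fun i => X.presheaf.map (homOfLE (X.basicOpen_le γ)).op (t i)) '' S)).IsPrime := by
    intro S hS
    obtain ⟨P, hP, hPx, hSP, hPS⟩ := hprime S hS
    have h1 := isPrime_map_basicOpen U.2 γ hP fun hmem => hγx (hPx hmem)
    have h2 := Ideal.map_le_map_of_mul_mem _ (isUnit_map_basicOpen γ) hPS
    rw [le_antisymm h2 (Ideal.map_mono hSP), Ideal.map_span, Set.image_image] at h1
    exact h1
  exact ⟨X.affineBasicOpen γ, n, fun i => X.presheaf.map (homOfLE (X.basicOpen_le γ)).op (t i),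
    c, h1, h2, hc, h3, h4, h5⟩

/-- If a component Z of the intersection of the D_i, i ∈ J, meets U, then J ⊆ T, and in U the
intersection is the zero locus of the t_{c(i)}, i ∈ J, which is irreducible by primality. Since Z ∩
U is dense in Z, Z lies in the closure of the generic point of that locus; maximality gives
equality. A prime is radical, so the ideals agree too. -/
theorem isAdaptedChart_of_isPrime {U : X.affineOpens} {n : ℕ} {t : Fin n → Γ(X, U.1)}
    {c : ι → Fin n} {T : Set ι} {s : Finset (Fin n)}
    (ht : (MvPolynomial.eval₂Hom (constants f U.1) t).Etale)
    (hD : ∀ i ∈ T, (D i).ideal U = Ideal.span {t (c i)}) (hD' : ∀ i ∉ T, (D i).ideal U = ⊤)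
    (hs : (s : Set (Fin n)) = c '' T)
    (hprime : ∀ S ⊆ c '' T, (Ideal.span (t '' S)).IsPrime) : IsAdaptedChart f D U t s := by
  refine ⟨ht, fun Z ⟨J, hZ⟩ => ?_⟩
  have hU : IsAffineOpen U.1 := U.2
  rw [vanishingIdeal_ideal_eq Z U hU]
  by_cases hne : {q : PrimeSpectrum Γ(X, U.1) | hU.fromSpec q ∈ Z} = ∅
  · left
    rw [hne]
    exact PrimeSpectrum.vanishingIdeal_empty
  right
  obtain ⟨q, hq⟩ := Set.nonempty_iff_ne_empty.2 hne
  have hJT : ∀ i ∈ J, i ∈ T := by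
    intro i hi
    by_contra hiT
    have := hZ.1.2 hq
    rw [Set.mem_iInter₂] at this
    have := (mem_support_iff q).1 (this i hi)
    rw [hD' i hiT, top_le_iff] at this
    exact q.2.ne_top this
  have hS : c '' J ⊆ c '' T := Set.image_mono fun i hi => hJT i hi
  refine ⟨c '' J, hs ▸ hS, ?_⟩
  have hP := hprime _ hS
  set P : PrimeSpectrum Γ(X, U.1) := ⟨_, hP⟩
  have hmem : ∀ q : PrimeSpectrum Γ(X, U.1),
      (∀ i ∈ J, hU.fromSpec q ∈ (D i).support) ↔ P.asIdeal ≤ q.asIdeal := by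
    intro q
    simp only [mem_support_iff, P, Ideal.span_le]
    constructor
    · rintro H _ ⟨_, ⟨i, hi, rfl⟩, rfl⟩
      exact H i hi (by rw [hD i (hJT i hi)]; exact Ideal.subset_span rfl)
    · intro H i hi
      rw [hD i (hJT i hi), Ideal.span_le, Set.singleton_subset_iff]
      exact H ⟨_, ⟨i, hi, rfl⟩, rfl⟩
  have hW : IsIrreducible (closure {hU.fromSpec P}) ∧
      closure {hU.fromSpec P} ⊆ ⋂ i ∈ J, ((D i).support : Set X) := by
    refine ⟨isIrreducible_singleton.closure, ?_⟩
    refine closure_minimal ?_ (isClosed_biInter fun i _ => (D i).support.isClosed)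
    rw [Set.singleton_subset_iff, Set.mem_iInter₂]
    exact (hmem P).2 le_rfl
  have hemb := hU.fromSpec.isOpenEmbedding
  have hpre : {q : PrimeSpectrum Γ(X, U.1) | hU.fromSpec q ∈ closure {hU.fromSpec P}} =
      PrimeSpectrum.zeroLocus P.asIdeal := by
    change hU.fromSpec ⁻¹' closure {hU.fromSpec P} = _
    rw [hemb.isOpenMap.preimage_closure_eq_closure_preimage hemb.continuous,
      ← PrimeSpectrum.closure_singleton]
    congr 1
    ext q
    exact hemb.injective.eq_iff
  have hle : (Z : Set X) ⊆ closure {hU.fromSpec P} := by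
    have h1 : (Z : Set X) ⊆ closure ((Z : Set X) ∩ Set.range hU.fromSpec) :=
      subset_closure_inter_of_isPreirreducible_of_isOpen hZ.1.1.isPreirreducible
        hemb.isOpen_range ⟨_, hq, Set.mem_range_self _⟩
    refine h1.trans (closure_minimal ?_ isClosed_closure)
    rintro _ ⟨hz, q, rfl⟩
    have : q ∈ {q : PrimeSpectrum Γ(X, U.1) | hU.fromSpec q ∈ closure {hU.fromSpec P}} := by
      rw [hpre]
      exact (hmem q).1 fun i hi => Set.mem_iInter₂.1 (hZ.1.2 hz) i hi
    exact this
  have hZeq : (Z : Set X) = closure {hU.fromSpec P} := hZ.eq_of_le hW hle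
  have hset : {q : PrimeSpectrum Γ(X, U.1) | hU.fromSpec q ∈ Z} =
      PrimeSpectrum.zeroLocus P.asIdeal :=
    (Set.ext fun q => Set.ext_iff.1 hZeq (hU.fromSpec q)).trans hpre
  rw [hset, PrimeSpectrum.vanishingIdeal_zeroLocus_eq_radical, P.2.radical]

end StratifiedPair

end

/-! ### From jet invariance to toroidal ideals -/

noncomputable section

/-- Translates monomials in the coordinates into products of powers of the divisor ideals.
Injectivity of c on T prevents a coordinate from being counted twice. -/
theorem Ideal.prod_pow_eq_span_prod {R ι : Type*} [CommRing R] [Fintype ι] {n : ℕ} (t : Fin n → R)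
    (D : ι → Ideal R) (c : ι → Fin n) (T : Finset ι) (hc : Set.InjOn c T)
    (hD : ∀ i ∈ T, D i = Ideal.span {t (c i)}) (m : Fin n → ℕ) (hm : ∀ j, j ∉ c '' T → m j = 0)
    [DecidablePred (· ∈ T)] :
    ∏ i, D i ^ (if i ∈ T then m (c i) else 0) = Ideal.span {∏ j, t j ^ m j} := by
  classical
  have h1 : ∏ j, t j ^ m j = ∏ i ∈ T, t (c i) ^ m (c i) := by
    rw [← Finset.prod_image (f := fun j => t j ^ m j) hc]
    refine (Finset.prod_subset (Finset.subset_univ _) fun j _ hj => ?_).symm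
    rw [hm j (by simpa using hj), pow_zero]
  rw [h1, ← Ideal.prod_span_singleton]
  refine ((Finset.prod_subset (Finset.subset_univ T) fun i _ hi => ?_).symm).trans
    (Finset.prod_congr rfl fun i hi => ?_)
  · rw [if_neg hi, pow_zero]
  · rw [if_pos hi, hD i hi, Ideal.span_singleton_pow]

/-- A jet invariant ideal is generated by finitely many monomials near a given point. -/
theorem EtaleCoord.JetInvariant.exists_finset {k F R : Type*} [Field k] [CommRing R] [Field F]
    [Algebra k R] [Algebra k F] {n : ℕ} {t : Fin n → R} [IsAlgClosed F]
    {ht : (MvPolynomial.eval₂Hom (algebraMap k R) t).Etale} {s : Finset (Fin n)}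
    {L : Subfield F} (hL : (L : Set F).Infinite) {I : Ideal R} (hI : JetInvariant ht s (L : Set F) I)
    (x : R →ₐ[k] F) (hx : ∀ i ∈ s, x (t i) = 0) :
    ∃ M : Finset (Fin n → ℕ), (∀ m ∈ M, ∀ i ∉ s, m i = 0) ∧ ∃ g ∉ RingHom.ker x,
      (∀ a ∈ I, g * a ∈ Ideal.span ((fun m : Fin n → ℕ => ∏ i, t i ^ m i) '' M)) ∧
      ∀ a ∈ Ideal.span ((fun m : Fin n → ℕ => ∏ i, t i ^ m i) '' M), g * a ∈ I := by
  classical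
  have hft : Algebra.FiniteType k R := finiteType ht
  have : IsNoetherianRing R := Algebra.FiniteType.isNoetherianRing k R
  obtain ⟨M, hM, hMI⟩ := hI.map_eq_span hL x hx
  -- Noetherianity lets finitely many generators be chosen among the given monomials, so the finite
  -- generating set is still monomial.
  obtain ⟨B, hBM, hB⟩ := (Submodule.fg_span_iff_fg_span_finset_subset _).1
    (IsNoetherian.noetherian (Ideal.span ((fun m => ∏ i, t i ^ m i) '' M)))
  obtain ⟨M', hM', rfl⟩ := Finset.subset_set_image_iff.1 hBM
  have hspan : Ideal.span ((fun m => ∏ i, t i ^ m i) '' M) =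
      Ideal.span ((fun m : Fin n → ℕ => ∏ i, t i ^ m i) '' M') := by
    rw [← Finset.coe_image]
    exact hB
  rw [hspan] at hMI
  obtain ⟨g₁, hg₁, h₁⟩ := Ideal.exists_mul_mem_of_map_le _ (IsNoetherian.noetherian _) hMI.le
  obtain ⟨g₂, hg₂, h₂⟩ := Ideal.exists_mul_mem_of_map_le _ (IsNoetherian.noetherian _) hMI.ge
  refine ⟨M', fun m hm => hM m (hM' hm), g₁ * g₂, fun hmem => ?_, fun a ha => ?_, fun a ha => ?_⟩
  · exact ((ker_algHom_isPrime x).mem_or_mem hmem).elim hg₁ hg₂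
  · rw [mul_right_comm]
    exact Ideal.mul_mem_right _ _ (h₁ a ha)
  · rw [mul_assoc]
    exact Ideal.mul_mem_left _ _ (h₂ a ha)

namespace StratifiedPair

variable {k : Type u} [Field k] {X : Scheme.{u}} {f : X ⟶ Spec (.of k)}
  {ι : Type w} {D : ι → X.IdealSheafData}

/-- The common conclusion of the three settings. By quasi-compactness every point x has a closed
point x₀ in its closure, and each neighbourhood of x₀ contains x; so only closed points need
attention, and these carry F-valued points of an adapted chart. -/
theorem IsSNCPair.isToroidal_of_jetInvariant [Fintype ι] (h : IsSNCPair f D) {F : Type*} [Field F]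
    [IsAlgClosed F] [Algebra k F] {L : Subfield F} (hL : (L : Set F).Infinite)
    (I : X.IdealSheafData)
    (H : ∀ (U : X.affineOpens) (n : ℕ) (t : Fin n → Γ(X, U.1)) (s : Finset (Fin n))
      (hc : IsAdaptedChart f D U t s),
      let _ : Algebra k Γ(X, U.1) := (constants f U.1).toAlgebra
      EtaleCoord.JetInvariant (k := k) (F := F) hc.etale s L (I.ideal U)) :
    IsToroidal D I := by
  classical
  intro x
  have := h.quasiCompact
  have : CompactSpace X := (quasiCompact_iff_compactSpace (f := f)).1 h.quasiCompact
  obtain ⟨x₀, hxx₀, hx₀⟩ := (isClosed_closure (s := {x})).exists_closed_singleton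
    ⟨x, subset_closure rfl⟩
  obtain ⟨U, n, t, c, hxU, ht, hinj, hD, hD', hprime⟩ := h.exists_isPrime_coordinates hx₀
  let T : Finset ι := Finset.univ.filter fun i => x₀ ∈ (D i).support
  have hT : (T : Set ι) = {i | x₀ ∈ (D i).support} := by ext i; simp [T]
  have hc : IsAdaptedChart f D U t (T.image c) :=
    isAdaptedChart_of_isPrime ht hD hD' (by rw [Finset.coe_image, hT]; rfl) hprime
  obtain ⟨p, hp⟩ := exists_fromSpec_eq U.2 hxU
  have hmax : p.asIdeal.IsMaximal := isMaximal_of_isClosed U.2 p (hp ▸ hx₀)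
  let : Algebra k Γ(X, U.1) := (constants f U.1).toAlgebra
  replace ht : (MvPolynomial.eval₂Hom (algebraMap k Γ(X, U.1)) t).Etale := ht
  have hft : Algebra.FiniteType k Γ(X, U.1) := EtaleCoord.finiteType ht
  obtain ⟨y, hy⟩ := EtaleCoord.exists_algHom_ker_eq (k := k) (F := F) p.asIdeal
  have hyt : ∀ j ∈ T.image c, y (t j) = 0 := by
    intro j hj
    obtain ⟨i, hi, rfl⟩ := Finset.mem_image.1 hj
    have hi : x₀ ∈ (D i).support := (Set.ext_iff.1 hT i).1 hi
    rw [← RingHom.mem_ker, hy]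
    have h1 := hD i hi
    rw [← hp, mem_support_iff] at hi
    exact hi (by rw [h1]; exact Ideal.subset_span rfl)
  obtain ⟨M, hM, g, hg, hIM, hMI⟩ := EtaleCoord.JetInvariant.exists_finset hL (H U n t _ hc) y hyt
  rw [hy] at hg
  have hVU : X.affineBasicOpen g ≤ U := X.affineBasicOpen_le g
  -- Divisors not through x₀ receive exponent 0; their ideals are trivial on the chart.
  refine ⟨X.affineBasicOpen g, ?_, M.image fun m i => if i ∈ T then m (c i) else 0, ?_⟩
  · have hx₀V : x₀ ∈ X.basicOpen g := by
      rw [← hp]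
      exact (IsAffineOpen.mem_basicOpen_iff U.2 p g).2 hg
    exact (specializes_iff_mem_closure.2 hxx₀).mem_open (X.basicOpen g).isOpen hx₀V
  · have hunit := isUnit_map_basicOpen g
    have h1 := le_antisymm (Ideal.map_le_map_of_mul_mem _ hunit hIM)
      (Ideal.map_le_map_of_mul_mem _ hunit hMI)
    have h2 : ∀ m ∈ M, ∏ i, (D i).ideal (X.affineBasicOpen g) ^ (if i ∈ T then m (c i) else 0) =
        (Ideal.span {∏ j, t j ^ m j}).map (X.presheaf.map (homOfLE (X.basicOpen_le g)).op).hom := by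
      intro m hm
      rw [← Ideal.prod_pow_eq_span_prod t (fun i => (D i).ideal U) c T (hT ▸ hinj)
        (fun i hi => hD i ((Set.ext_iff.1 hT i).1 hi)) m (fun j hj => hM m hm j (by simpa using hj)),
        ← Ideal.mapHom_apply, map_prod]
      refine Finset.prod_congr rfl fun i _ => ?_
      rw [Ideal.mapHom_apply, Ideal.map_pow]
      exact congrArg (· ^ _) ((D i).map_ideal hVU).symm
    rw [← I.map_ideal hVU, Finset.iSup_finset_image]
    refine h1.trans ?_
    rw [Ideal.map_span, Set.image_image, Ideal.span, ← Set.biUnion_of_singleton (Set.image _ _),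
      Submodule.span_iUnion₂]
    rw [iSup_image]
    refine iSup_congr fun m => iSup_congr fun hm => ?_
    rw [h2 m hm, Ideal.map_span, Set.image_singleton]

end StratifiedPair

end

/-! ### The étale local setting -/

noncomputable section

open scoped TensorProduct

/-- Pushouts of étale ring homomorphisms. -/
theorem RingHom.Etale.exists_pushout {A B B' : Type u} [CommRing A] [CommRing B] [CommRing B']
    {φ : A →+* B} {ψ : A →+* B'} (hφ : φ.Etale) (hψ : ψ.Etale) :
    ∃ (C : Type u) (_ : CommRing C) (i : B →+* C) (j : B' →+* C), i.Etale ∧ j.Etale ∧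
      i.comp φ = j.comp ψ ∧ ∀ (P : Type u) [CommRing P] (u : B →+* P) (v : B' →+* P),
        u.comp φ = v.comp ψ → ∃ g : C →+* P, g.comp i = u ∧ g.comp j = v := by
  let : Algebra A B := φ.toAlgebra
  let : Algebra A B' := ψ.toAlgebra
  have : Algebra.Etale A B := hφ
  have : Algebra.Etale A B' := hψ
  have hi : (algebraMap B (B ⊗[A] B')).Etale := RingHom.etale_algebraMap.2 inferInstance
  have hj' : (algebraMap B' (B' ⊗[A] B)).Etale := RingHom.etale_algebraMap.2 inferInstance
  have hj : (Algebra.TensorProduct.includeRight : B' →ₐ[A] B ⊗[A] B').toRingHom.Etale :=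
    RingHom.Etale.stableUnderComposition _ _ hj'
      (RingHom.Etale.of_bijective (f := (Algebra.TensorProduct.comm A B' B).toRingEquiv.toRingHom)
        (Algebra.TensorProduct.comm A B' B).bijective)
  refine ⟨B ⊗[A] B', inferInstance, algebraMap B _, _, hi, hj, ?_, fun P _ u v huv => ?_⟩
  · ext a
    exact Algebra.TensorProduct.tmul_one_eq_one_tmul a
  · let : Algebra A P := (u.comp φ).toAlgebra
    let u' : B →ₐ[A] P := { u with commutes' := fun a => rfl }
    let v' : B' →ₐ[A] P := { v with commutes' := fun a => (RingHom.congr_fun huv a).symm }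
    refine ⟨(Algebra.TensorProduct.lift u' v' fun _ _ => .all _ _).toRingHom, ?_, ?_⟩
    · ext b
      change Algebra.TensorProduct.lift u' v' (fun _ _ => .all _ _) (b ⊗ₜ 1) = u b
      rw [Algebra.TensorProduct.lift_tmul, map_one, mul_one]
      rfl
    · ext b
      change Algebra.TensorProduct.lift u' v' (fun _ _ => .all _ _) (1 ⊗ₜ b) = v b
      rw [Algebra.TensorProduct.lift_tmul, map_one, one_mul]
      rfl

theorem MvPolynomial.etale_map {k K : Type u} [Field k] [Field K] [Algebra k K]
    [Algebra.Etale k K] (σ : Type) : (MvPolynomial.map (σ := σ) (algebraMap k K)).Etale := by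
  have h : (algebraMap (MvPolynomial σ k) (MvPolynomial σ k ⊗[k] K)).Etale :=
    RingHom.etale_algebraMap.2 inferInstance
  let e := (Algebra.TensorProduct.comm k (MvPolynomial σ k) K).trans
    ((MvPolynomial.algebraTensorAlgEquiv (σ := σ) k K).restrictScalars k)
  have := RingHom.Etale.stableUnderComposition _ _ h
    (RingHom.Etale.of_bijective (f := e.toRingEquiv.toRingHom) e.bijective)
  convert this
  refine MvPolynomial.ringHom_ext (fun c => ?_) fun i => ?_
  · simp [e]
  · simp [e]

theorem MvPowerSeries.rescale_C {σ A : Type*} [CommRing A] (c : σ → A) (a : A) :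
    rescale c (C a : MvPowerSeries σ A) = C a := by
  classical
  ext b
  rw [coeff_rescale, coeff_C]
  split_ifs with hb
  · simp [hb]
  · simp

theorem MvPowerSeries.rescale_X {σ A : Type*} [CommRing A] (c : σ → A) (i : σ) :
    rescale c (X i : MvPowerSeries σ A) = C (c i) * X i := by
  classical
  ext b
  rw [coeff_rescale, coeff_C_mul, coeff_X]
  split_ifs with hb
  · simp [hb]
  · simp

namespace EtaleCoord

variable {k F R : Type u} [Field k] [CommRing R] [Field F] [Algebra k R] [Algebra k F]
  {n : ℕ} {t : Fin n → R}

/-- Two étale maps `a₁`, `a₂` with `a₂ t = c t + d`. -/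
theorem exists_etale_pair (ht : (MvPolynomial.eval₂Hom (algebraMap k R) t).Etale)
    {K : Type u} [Field K] [Algebra k K] [Algebra.Etale k K] [Algebra K F] [IsScalarTower k K F]
    (x₁ x₂ : R →ₐ[k] F) (c d : Fin n → K) (hc : ∀ i, c i ≠ 0)
    (hcd : ∀ i, x₂ (t i) = algebraMap K F (c i) * x₁ (t i) + algebraMap K F (d i)) :
    ∃ (C : Type u) (_ : CommRing C) (a₁ a₂ : R →+* C) (b : K →+* C)
      (g : C →+* MvPowerSeries (Fin n) F),
      a₁.Etale ∧ a₂.Etale ∧ a₁.comp (algebraMap k R) = a₂.comp (algebraMap k R) ∧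
      (∀ i, a₂ (t i) = b (c i) * a₁ (t i) + b (d i)) ∧
      (∀ r, g (a₁ r) = jet ht x₁ r) ∧
      ∀ r, g (a₂ r) = MvPowerSeries.rescale (fun i => algebraMap K F (c i)) (jet ht x₂ r) := by
  let E := MvPolynomial (Fin n) k
  -- Q is the base change of R to K, on which affine substitutions with coefficients in K make
  -- sense.
  obtain ⟨Q, _, q₁, a₁, hq₁, ha₁, hqa, hQ⟩ :=
    (MvPolynomial.etale_map (k := k) (K := K) (Fin n)).exists_pushout ht
  let σ : MvPolynomial (Fin n) K →ₐ[K] MvPolynomial (Fin n) K :=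
    MvPolynomial.aeval fun i => MvPolynomial.C (c i) * MvPolynomial.X i + MvPolynomial.C (d i)
  let σ' : MvPolynomial (Fin n) K →ₐ[K] MvPolynomial (Fin n) K :=
    MvPolynomial.aeval fun i =>
      MvPolynomial.C (c i)⁻¹ * (MvPolynomial.X i - MvPolynomial.C (d i))
  have hC : ∀ a : K, (MvPolynomial.C a : MvPolynomial (Fin n) K) = algebraMap K _ a :=
    fun _ => rfl
  have h1 : ∀ i, (MvPolynomial.C (c i) : MvPolynomial (Fin n) K) * MvPolynomial.C (c i)⁻¹ = 1 := by
    intro i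
    rw [← map_mul, mul_inv_cancel₀ (hc i), map_one]
  have hσσ' : σ.comp σ' = AlgHom.id K _ := by
    refine MvPolynomial.algHom_ext fun i => ?_
    simp only [σ, σ', AlgHom.comp_apply, MvPolynomial.aeval_X, map_mul, map_sub, hC,
      AlgHom.commutes, AlgHom.id_apply]
    rw [add_sub_cancel_right, ← hC, ← hC, ← mul_assoc, mul_comm (MvPolynomial.C (c i)⁻¹), h1,
      one_mul]
  have hσ'σ : σ'.comp σ = AlgHom.id K _ := by
    refine MvPolynomial.algHom_ext fun i => ?_
    simp only [σ, σ', AlgHom.comp_apply, MvPolynomial.aeval_X, map_mul, map_add, hC,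
      AlgHom.commutes, AlgHom.id_apply]
    rw [← hC, ← hC, ← mul_assoc, h1, one_mul, sub_add_cancel]
  have hσ : Function.Bijective σ.toRingHom :=
    Function.bijective_iff_has_inverse.2 ⟨σ', fun p => AlgHom.congr_fun hσ'σ p,
      fun p => AlgHom.congr_fun hσσ' p⟩
  -- θ sends X_i to c_i t_i + d_i. Its pushout with the original coordinates is the universal ring
  -- with a second map from R whose coordinates are these; both maps are étale because the
  -- substitution σ is an automorphism and K/k is étale.
  obtain ⟨θ, hθdef⟩ : ∃ θ : E →+* Q,
    θ = q₁.comp (σ.toRingHom.comp (MvPolynomial.map (algebraMap k K))) := ⟨_, rfl⟩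
  have hθ : θ.Etale := hθdef ▸ RingHom.Etale.stableUnderComposition _ _
    (RingHom.Etale.stableUnderComposition _ _ (MvPolynomial.etale_map (Fin n))
      (.of_bijective hσ)) hq₁
  obtain ⟨C, _, i, a₂, hi, ha₂, hia, hCP⟩ := RingHom.Etale.exists_pushout hθ ht
  let b : K →+* C := i.comp (q₁.comp MvPolynomial.C)
  have hqX : ∀ l, q₁ (MvPolynomial.X l) = a₁ (t l) := by
    intro l
    have := RingHom.congr_fun hqa (MvPolynomial.X l)
    rwa [RingHom.comp_apply, RingHom.comp_apply, MvPolynomial.map_X, MvPolynomial.eval₂Hom_X']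
      at this
  have hqC : ∀ l, q₁ (MvPolynomial.C (algebraMap k K l)) = a₁ (algebraMap k R l) := by
    intro l
    have := RingHom.congr_fun hqa (MvPolynomial.C l)
    rwa [RingHom.comp_apply, RingHom.comp_apply, MvPolynomial.map_C, MvPolynomial.eval₂Hom_C]
      at this
  have hθX : ∀ l, θ (MvPolynomial.X l) = q₁ (MvPolynomial.C (c l)) * a₁ (t l) +
      q₁ (MvPolynomial.C (d l)) := by
    intro l
    have : σ (MvPolynomial.X l) = MvPolynomial.C (c l) * MvPolynomial.X l + MvPolynomial.C (d l) :=
      MvPolynomial.aeval_X _ _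
    rw [hθdef]
    change q₁ (σ (MvPolynomial.map (algebraMap k K) (MvPolynomial.X l))) = _
    rw [MvPolynomial.map_X, this, map_add, map_mul, hqX]
  have hθC : ∀ l, θ (MvPolynomial.C l) = a₁ (algebraMap k R l) := by
    intro l
    rw [hθdef]
    change q₁ (σ (MvPolynomial.map (algebraMap k K) (MvPolynomial.C l))) = _
    rw [MvPolynomial.map_C, hC, σ.commutes, ← hC, hqC]
  let u₀ : MvPolynomial (Fin n) K →+* MvPowerSeries (Fin n) F :=
    MvPolynomial.eval₂Hom (MvPowerSeries.C.comp (algebraMap K F))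
      fun l => MvPowerSeries.C (x₁ (t l)) + MvPowerSeries.X l
  obtain ⟨g₀, hg₀, hg₀'⟩ := hQ _ u₀ (jet ht x₁).toRingHom (by
    refine MvPolynomial.ringHom_ext (fun l => ?_) fun l => ?_
    · rw [RingHom.comp_apply, RingHom.comp_apply, MvPolynomial.map_C, MvPolynomial.eval₂Hom_C]
      simp only [MvPolynomial.eval₂Hom_C]
      change _ = jet ht x₁ _
      rw [AlgHom.commutes, MvPowerSeries.algebraMap_apply, IsScalarTower.algebraMap_apply k K F]
      rfl
    · rw [RingHom.comp_apply, RingHom.comp_apply, MvPolynomial.map_X, MvPolynomial.eval₂Hom_X']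
      simp only [MvPolynomial.eval₂Hom_X']
      exact (jet_coord ht x₁ l).symm)
  have hgC : ∀ l, g₀ (q₁ (MvPolynomial.C l)) = MvPowerSeries.C (algebraMap K F l) := by
    intro l
    rw [← RingHom.comp_apply, hg₀]
    exact MvPolynomial.eval₂Hom_C _ _ _
  have hga : ∀ r, g₀ (a₁ r) = jet ht x₁ r := fun r => RingHom.congr_fun hg₀' r
  let c' : Fin n → F := fun i => algebraMap K F (c i)
  -- The jet at x₁ and the rescaled jet at x₂ glue because c(x₁(t) + X) + d = x₂(t) + cX.
  obtain ⟨g, hg, hg'⟩ := hCP _ g₀ ((MvPowerSeries.rescale c').comp (jet ht x₂).toRingHom) (by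
    refine MvPolynomial.ringHom_ext (fun l => ?_) fun l => ?_
    · rw [RingHom.comp_apply, RingHom.comp_apply, hθC, hga, MvPolynomial.eval₂Hom_C]
      change _ = MvPowerSeries.rescale c' (jet ht x₂ _)
      rw [AlgHom.commutes, AlgHom.commutes, MvPowerSeries.algebraMap_apply,
        MvPowerSeries.rescale_C]
    · rw [RingHom.comp_apply, RingHom.comp_apply, hθX, map_add, map_mul, hga, hgC, hgC,
        MvPolynomial.eval₂Hom_X', jet_coord]
      change _ = MvPowerSeries.rescale c' (jet ht x₂ _)
      rw [jet_coord, hcd, map_add, MvPowerSeries.rescale_X, MvPowerSeries.rescale_C, map_add,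
        map_mul]
      ring)
  refine ⟨C, inferInstance, i.comp a₁, a₂, b, g,
    RingHom.Etale.stableUnderComposition _ _ ha₁ hi, ha₂, ?_, ?_, ?_, ?_⟩
  · ext l
    have := RingHom.congr_fun hia (MvPolynomial.C l)
    rw [RingHom.comp_apply, RingHom.comp_apply, MvPolynomial.eval₂Hom_C, hθC] at this
    exact this
  · intro l
    have := RingHom.congr_fun hia (MvPolynomial.X l)
    rw [RingHom.comp_apply, RingHom.comp_apply, MvPolynomial.eval₂Hom_X', hθX, map_add, map_mul]
      at this
    exact this.symm
  · intro r
    rw [RingHom.comp_apply, ← hga, ← hg]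
    rfl
  · intro r
    exact RingHom.congr_fun hg' r

end EtaleCoord

end

noncomputable section

namespace StratifiedPair

variable {X : Scheme.{u}}

theorem ideal_comap_fromSpec (I : X.IdealSheafData) (U : X.affineOpens) :
    (I.comap U.2.fromSpec).ideal ⟨⊤, isAffineOpen_top _⟩ =
      (I.ideal U).map (Scheme.ΓSpecIso Γ(X, U.1)).inv.hom := by
  have hU : IsAffineOpen U.1 := U.2
  change (I.comap hU.fromSpec).ideal ⟨⊤, isAffineOpen_top _⟩ = _
  rw [Scheme.IdealSheafData.ideal_comap_of_isOpenImmersion]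
  have hW : hU.fromSpec ''ᵁ ⊤ ≤ U.1 := by
    rw [Scheme.Hom.image_top_eq_opensRange, hU.opensRange_fromSpec]
  rw [← I.map_ideal (V := U) hW]
  have h1 : ∀ J : Ideal Γ(X, hU.fromSpec ''ᵁ ⊤), J.comap (hU.fromSpec.appIso ⊤).inv.hom =
      J.map (hU.fromSpec.appIso ⊤).hom.hom := fun J =>
    Ideal.comap_symm (f := (hU.fromSpec.appIso ⊤).commRingCatIsoToRingEquiv) ..
  rw [h1, Ideal.map_map, ← CommRingCat.hom_comp]
  congr 2
  rw [Scheme.Hom.appIso_hom', Scheme.Hom.map_appLE, Scheme.Hom.appLE, hU.fromSpec_app_self]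
  rw [Category.assoc, ← Functor.map_comp]
  exact (congrArg _ ((Spec Γ(X, U.1)).presheaf.map_id _)).trans (Category.comp_id _)

/-- Both sides have the same upper bounds, by the adjunctions between pullback and pushforward of
ideal sheaves and of ideals. -/
theorem ideal_comap_specMap {A B : CommRingCat.{u}} (φ : A ⟶ B) (J : (Spec A).IdealSheafData) :
    (J.comap (Spec.map φ)).ideal ⟨⊤, isAffineOpen_top _⟩ =
      (J.ideal ⟨⊤, isAffineOpen_top _⟩).map (Spec.map φ).appTop.hom := by
  refine eq_of_forall_ge_iff fun N => ?_
  have h1 : N = (Scheme.IdealSheafData.ofIdealTop N).ideal ⟨⊤, isAffineOpen_top _⟩ := by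
    simp
  rw [h1, Ideal.map_le_iff_le_comap]
  have h2 := Scheme.IdealSheafData.ideal_map_of_isAffineHom (.ofIdealTop N) (Spec.map φ)
    ⟨⊤, isAffineOpen_top _⟩
  have h3 := Scheme.IdealSheafData.le_map_iff_comap_le (I := .ofIdealTop N) (J := J)
    (f := Spec.map φ)
  constructor
  · intro h
    have := h3.2 (Scheme.IdealSheafData.le_of_isAffine h) ⟨⊤, isAffineOpen_top _⟩
    rw [h2] at this
    exact this
  · intro h
    refine h3.1 (Scheme.IdealSheafData.le_of_isAffine ?_) _
    rw [h2]
    exact h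

theorem ideal_comap_specMap_comp_fromSpec (I : X.IdealSheafData) (U : X.affineOpens)
    {B : CommRingCat.{u}} (φ : Γ(X, U.1) ⟶ B) :
    (I.comap (Spec.map φ ≫ U.2.fromSpec)).ideal ⟨⊤, isAffineOpen_top _⟩ =
      ((I.ideal U).map φ.hom).map (Scheme.ΓSpecIso B).inv.hom := by
  rw [Scheme.IdealSheafData.comap_comp, ideal_comap_specMap, ideal_comap_fromSpec,
    Ideal.map_map, Ideal.map_map, ← CommRingCat.hom_comp, ← CommRingCat.hom_comp,
    Scheme.ΓSpecIso_inv_naturality]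

theorem map_eq_map_of_comap_eq {I : X.IdealSheafData} {U : X.affineOpens}
    {B : CommRingCat.{u}} {φ ψ : Γ(X, U.1) ⟶ B}
    (h : I.comap (Spec.map φ ≫ U.2.fromSpec) = I.comap (Spec.map ψ ≫ U.2.fromSpec)) :
    (I.ideal U).map φ.hom = (I.ideal U).map ψ.hom := by
  have := ideal_comap_specMap_comp_fromSpec I U φ
  rw [h, ideal_comap_specMap_comp_fromSpec] at this
  have hb : Function.Bijective (Scheme.ΓSpecIso B).inv.hom :=
    (Scheme.ΓSpecIso B).symm.commRingCatIsoToRingEquiv.bijective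
  rw [← Ideal.comap_map_of_bijective _ hb (I := (I.ideal U).map φ.hom), ← this,
    Ideal.comap_map_of_bijective _ hb]

variable {k : Type u} [Field k] {f : X ⟶ Spec (.of k)}

theorem fromSpec_comp {U : X.Opens} (hU : IsAffineOpen U) :
    hU.fromSpec ≫ f = Spec.map (CommRingCat.ofHom (constants f U)) := by
  refine ext_of_isAffine ?_
  have h1 : CommRingCat.ofHom (constants f U) = (Scheme.ΓSpecIso (.of k)).inv ≫ f.appTop ≫
      X.presheaf.map (homOfLE (le_top : U ≤ ⊤)).op := rfl
  rw [Scheme.Hom.comp_appTop, ← cancel_epi (Scheme.ΓSpecIso (.of k)).inv,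
    ← Scheme.ΓSpecIso_inv_naturality, h1, Scheme.Hom.appTop, Scheme.Hom.appTop,
    hU.fromSpec_app_of_le _ le_top]
  have h2 : (Scheme.ΓSpecIso Γ(X, U)).inv ≫ (Spec Γ(X, U)).presheaf.map
      (homOfLE (le_top : (⊤ : (Spec Γ(X, U)).Opens) ≤ ⊤)).op = (Scheme.ΓSpecIso Γ(X, U)).inv :=
    (congrArg _ ((Spec Γ(X, U)).presheaf.map_id _)).trans (Category.comp_id _)
  simp only [Category.assoc]
  exact congrArg (fun g => (Scheme.ΓSpecIso (.of k)).inv ≫ f.app ⊤ ≫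
    X.presheaf.map (homOfLE (le_top : U ≤ ⊤)).op ≫ g) h2

theorem specMap_fromSpec_mem_iff {U : X.affineOpens} {B : CommRingCat.{u}} (φ : Γ(X, U.1) ⟶ B)
    (Z : Closeds X) (q : PrimeSpectrum B) :
    (Spec.map φ ≫ U.2.fromSpec) q ∈ Z ↔
      ((Scheme.IdealSheafData.vanishingIdeal Z).ideal U).map φ.hom ≤ q.asIdeal := by
  rw [Ideal.map_le_iff_le_comap]
  have h := mem_support_iff (I := Scheme.IdealSheafData.vanishingIdeal Z) (U := U)
    (PrimeSpectrum.comap φ.hom q)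
  have hZ : (Scheme.IdealSheafData.vanishingIdeal Z).support = Z :=
    SetLike.coe_injective (Scheme.IdealSheafData.coe_support_vanishingIdeal Z)
  rw [hZ] at h
  exact h

theorem etale_specMap_comp_fromSpec {U : X.affineOpens} {B : CommRingCat.{u}}
    {φ : Γ(X, U.1) ⟶ B} (h : φ.hom.Etale) : Etale (Spec.map φ ≫ U.2.fromSpec) := by
  have : Etale (Spec.map φ) := (HasRingHomProperty.Spec_iff (P := @Etale)).2 h
  have hU : IsAffineOpen U.1 := U.2
  have : Etale hU.fromSpec := inferInstance
  exact Etale.etale_comp _ _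

variable {ι : Type w} {D : ι → X.IdealSheafData}

/-- With d = x₂(t) - c x₁(t), the two étale maps of `exists_etale_pair` satisfy t_i ∘ τ₂ = c_i (t_i
∘ τ₁) with c_i a unit for i ∈ s, as d_i = 0 there. They pull all strata back equally, and comparing
the pullbacks of I inside the power series ring gives the claim. The field K generated by c and d
must be étale over k, which is why L is the separable closure and not all of F. -/
theorem EtaleInvariant.jetInvariant {I : X.IdealSheafData} (h : EtaleInvariant f D I)
    {F : Type u} [Field F] [Algebra k F] {U : X.affineOpens} {n : ℕ} {t : Fin n → Γ(X, U.1)}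
    {s : Finset (Fin n)} (hc : IsAdaptedChart f D U t s) :
    let _ : Algebra k Γ(X, U.1) := (constants f U.1).toAlgebra
    EtaleCoord.JetInvariant (k := k) (F := F) hc.etale s (separableClosure k F).toSubfield
      (I.ideal U) := by
  intro _ x₁ x₂ h₁ h₂ h₁₂ c hcL hc₀ hc₁ N G hG
  let d : Fin n → F := fun i => x₂ (t i) - c i * x₁ (t i)
  have hds : ∀ i ∈ s, d i = 0 := fun i hi => by simp only [d, h₁ i hi, h₂ i hi]; ring
  have hd : ∀ i, d i ∈ separableClosure k F := by
    intro i
    by_cases hi : i ∈ s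
    · rw [hds i hi]; exact zero_mem _
    · simp only [d, hc₁ i hi, one_mul]; exact h₁₂ i
  let S : Set F := Set.range c ∪ Set.range d
  have hS : ∀ z ∈ S, IsSeparable k z := by
    rintro z (⟨i, rfl⟩ | ⟨i, rfl⟩)
    · exact mem_separableClosure_iff.1 (hcL i)
    · exact mem_separableClosure_iff.1 (hd i)
  let K := IntermediateField.adjoin k S
  have : Algebra.IsSeparable k K := (IntermediateField.isSeparable_adjoin_iff_isSeparable k F).2 hS
  have : FiniteDimensional k K := by
    have : Finite S := ((Set.finite_range c).union (Set.finite_range d)).to_subtype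
    exact IntermediateField.finiteDimensional_adjoin fun z hz => (hS z hz).isIntegral
  have : Algebra.FormallyEtale k K := (Algebra.FormallyEtale.iff_isSeparable k K).2 inferInstance
  have : Algebra.FinitePresentation k K :=
    Algebra.FinitePresentation.of_finiteType.1 inferInstance
  have : Algebra.Etale k K := ⟨inferInstance, inferInstance⟩
  have hcK : ∀ i, c i ∈ K := fun i => IntermediateField.subset_adjoin _ _ (.inl ⟨i, rfl⟩)
  have hdK : ∀ i, d i ∈ K := fun i => IntermediateField.subset_adjoin _ _ (.inr ⟨i, rfl⟩)
  obtain ⟨C, _, a₁, a₂, b, g, ha₁, ha₂, hak, hat, hg₁, hg₂⟩ :=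
    EtaleCoord.exists_etale_pair hc.etale (K := K) x₁ x₂ (fun i => ⟨c i, hcK i⟩)
      (fun i => ⟨d i, hdK i⟩) (fun i h => hc₀ i (congrArg Subtype.val h)) fun i => by
        change x₂ (t i) = c i * x₁ (t i) + d i
        simp only [d]; ring
  have hJ : ∀ S ⊆ (s : Set (Fin n)), (Ideal.span (t '' S)).map a₁ = (Ideal.span (t '' S)).map a₂ := by
    intro S hSs
    have key : ∀ i ∈ S, ∃ v : C, IsUnit v ∧ a₂ (t i) = v * a₁ (t i) := by
      intro i hi
      refine ⟨b ⟨c i, hcK i⟩, (IsUnit.mk0 (⟨c i, hcK i⟩ : K) fun h =>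
        hc₀ i (congrArg Subtype.val h)).map b, ?_⟩
      have h0 : (⟨d i, hdK i⟩ : K) = 0 := Subtype.ext (hds i (hSs hi))
      rw [hat, h0, map_zero, add_zero]
    rw [Ideal.map_span, Ideal.map_span, Set.image_image, Set.image_image]
    refine le_antisymm (Ideal.span_le.2 ?_) (Ideal.span_le.2 ?_)
    · rintro _ ⟨i, hi, rfl⟩
      obtain ⟨v, hv, h⟩ := key i hi
      refine (Ideal.unit_mul_mem_iff_mem _ hv).1 ?_
      rw [← h]
      exact Ideal.subset_span ⟨i, hi, rfl⟩
    · rintro _ ⟨i, hi, rfl⟩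
      obtain ⟨v, hv, h⟩ := key i hi
      change a₂ (t i) ∈ _
      rw [h]
      exact Ideal.mul_mem_left _ _ (Ideal.subset_span ⟨i, hi, rfl⟩)
  have hU : IsAffineOpen U.1 := U.2
  have hcomap := h (Spec (.of C)) (Spec.map (CommRingCat.ofHom a₁) ≫ U.2.fromSpec)
    (Spec.map (CommRingCat.ofHom a₂) ≫ U.2.fromSpec) (etale_specMap_comp_fromSpec ha₁)
    (etale_specMap_comp_fromSpec ha₂) (by
      change (_ ≫ hU.fromSpec) ≫ f = (_ ≫ hU.fromSpec) ≫ f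
      rw [Category.assoc, Category.assoc, fromSpec_comp, ← Spec.map_comp, ← Spec.map_comp,
        ← CommRingCat.ofHom_comp, ← CommRingCat.ofHom_comp]
      exact congrArg (fun a => Spec.map (CommRingCat.ofHom a)) hak) (by
      intro Z hZ
      ext q
      refine (specMap_fromSpec_mem_iff _ Z q).trans
        (Iff.trans ?_ (specMap_fromSpec_mem_iff _ Z q).symm)
      rcases hc.ideal_stratum Z hZ with h | ⟨S, hSs, h⟩
      · rw [h, Ideal.map_top, Ideal.map_top]
      · rw [h]
        exact iff_of_eq (congrArg (· ≤ q.asIdeal) (hJ S hSs)))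
  have hmap : (I.ideal U).map a₁ = (I.ideal U).map a₂ := map_eq_map_of_comap_eq hcomap
  have hmem : a₂ G ∈ (I.ideal U).map a₁ := hmap ▸ Ideal.mem_map_of_mem _ hG
  refine Ideal.mem_sup_left ?_
  have := Ideal.mem_map_of_mem g hmem
  have hga : g.comp a₁ = (EtaleCoord.jet hc.etale x₁ : _ →+* _) := RingHom.ext hg₁
  rw [hg₂, Ideal.map_map, hga] at this
  exact this

end StratifiedPair

end

noncomputable section

/-- A finite field is perfect, so if separably closed it would be algebraically closed, hence
infinite. This supplies enough scalars even over a finite k. -/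
theorem IsSepClosed.infinite (L : Type*) [Field L] [IsSepClosed L] : Infinite L := by
  by_contra h
  have : Finite L := not_infinite_iff_finite.1 h
  have : IsAlgClosed L := inferInstance
  exact h inferInstance

namespace StratifiedPair

variable {k : Type u} [Field k] {X : Scheme.{u}} {f : X ⟶ Spec (.of k)}
  {ι : Type w} {D : ι → X.IdealSheafData}

theorem IsSNCPair.isToroidal_of_etaleInvariant [Fintype ι] (h : IsSNCPair f D)
    {I : X.IdealSheafData} (hI : EtaleInvariant f D I) : IsToroidal D I := by
  refine h.isToroidal_of_jetInvariant (F := AlgebraicClosure k)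
    (L := (separableClosure k (AlgebraicClosure k)).toSubfield) ?_ I
    fun U n t s hc => hI.jetInvariant hc
  have : Infinite (separableClosure k (AlgebraicClosure k)) := IsSepClosed.infinite _
  exact Set.infinite_coe_iff.1 this

end StratifiedPair

end

/-! ### The formal local setting -/

noncomputable section

namespace MvPowerSeries

/-- A ring with the same jets as a power series ring has the power series ring as completion. -/
theorem exists_adicCompletion_equiv {A O : Type*} [CommRing A] [CommRing O] {n : ℕ} (m : Ideal O)
    (j : O →+* MvPowerSeries (Fin n) A)
    (h₁ : ∀ N o, j o ∈ varIdeal (Fin n) A ^ N ↔ o ∈ m ^ N)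
    (h₂ : ∀ p N, ∃ o, p - j o ∈ varIdeal (Fin n) A ^ N) :
    ∃ Φ : AdicCompletion m O ≃+* MvPowerSeries (Fin n) A, ∀ o, Φ (algebraMap O _ o) = j o := by
  have hle : ∀ N, m ^ N ≤ (varIdeal (Fin n) A ^ N).comap j := fun N o ho => (h₁ N o).2 ho
  -- The first hypothesis gives injectivity of each quotient map and the second surjectivity; the
  -- completion is the limit of these isomorphic quotients.
  have hbij : ∀ N, Function.Bijective (Ideal.quotientMap (varIdeal (Fin n) A ^ N) j (hle N)) := by
    intro N
    refine ⟨(injective_iff_map_eq_zero _).2 fun a => ?_, fun a => ?_⟩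
    · obtain ⟨a, rfl⟩ := Ideal.Quotient.mk_surjective a
      rw [Ideal.quotientMap_mk, Ideal.Quotient.eq_zero_iff_mem, Ideal.Quotient.eq_zero_iff_mem]
      exact (h₁ N a).1
    · obtain ⟨p, rfl⟩ := Ideal.Quotient.mk_surjective a
      obtain ⟨o, ho⟩ := h₂ p N
      refine ⟨Ideal.Quotient.mk _ o, ?_⟩
      rw [Ideal.quotientMap_mk, eq_comm, Ideal.Quotient.eq]
      exact ho
  let g : ∀ N, MvPowerSeries (Fin n) A →+* O ⧸ m ^ N := fun N =>
    ((RingEquiv.ofBijective _ (hbij N)).symm : _ →+* O ⧸ m ^ N).comp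
      (Ideal.Quotient.mk (varIdeal (Fin n) A ^ N))
  have hg : ∀ N p o, p - j o ∈ varIdeal (Fin n) A ^ N → g N p = Ideal.Quotient.mk _ o := by
    intro N p o h
    change (RingEquiv.ofBijective _ (hbij N)).symm _ = _
    rw [RingEquiv.symm_apply_eq, RingEquiv.ofBijective_apply, Ideal.quotientMap_mk,
      Ideal.Quotient.eq]
    exact h
  have hcomp : ∀ {M N : ℕ} (hle : M ≤ N), (Ideal.Quotient.factorPow m hle).comp (g N) = g M := by
    intro M N hle
    ext p
    obtain ⟨o, ho⟩ := h₂ p N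
    rw [RingHom.comp_apply, hg N p o ho, hg M p o (varIdeal_pow_antitone hle ho)]
    rfl
  let Ψ := AdicCompletion.liftRingHom m g hcomp
  have hΨ : ∀ N p, AdicCompletion.evalₐ m N (Ψ p) = g N p := fun N p =>
    AdicCompletion.evalₐ_liftRingHom m g hcomp N p
  have hΨj : ∀ o, Ψ (j o) = algebraMap O _ o := by
    intro o
    refine AdicCompletion.ext_evalₐ fun N => ?_
    rw [hΨ, hg N (j o) o (by rw [sub_self]; exact zero_mem _), AlgHom.commutes]
    rfl
  have hinj : Function.Injective Ψ := by
    refine (injective_iff_map_eq_zero _).2 fun p hp => ?_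
    have : p ∈ ⨅ N, varIdeal (Fin n) A ^ N := by
      refine (Submodule.mem_iInf _).2 fun N => ?_
      obtain ⟨o, ho⟩ := h₂ p N
      have h0 := hΨ N p
      rw [hp, map_zero, hg N p o ho, eq_comm, Ideal.Quotient.eq_zero_iff_mem, ← h₁] at h0
      exact (sub_add_cancel p (j o)) ▸ add_mem ho h0
    rwa [iInf_varIdeal_pow, Ideal.mem_bot] at this
  have hsurj : Function.Surjective Ψ := by
    intro x
    induction x using AdicCompletion.induction_on with | _ o
    have hcauchy : ∀ M N, M ≤ N → o N - o M ∈ m ^ M := fun M N hMN =>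
      Ideal.Quotient.eq.1 (AdicCompletion.Ideal.mk_eq_mk m hMN o)
    -- The coefficient at b is read off the first approximation that is correct modulo a power
    -- exceeding the degree of b; later approximations do not change it.
    let p : MvPowerSeries (Fin n) A := fun b => coeff b (j (o (b.degree + 1)))
    refine ⟨p, AdicCompletion.ext_evalₐ fun N => ?_⟩
    rw [hΨ, AdicCompletion.evalₐ_mk]
    refine hg N p (o N) (mem_varIdeal_pow_iff.2 fun b hb => ?_)
    have h := (h₁ _ _).2 (hcauchy (b.degree + 1) N hb)
    rw [map_sub, mem_varIdeal_pow_iff] at h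
    have := h b (Nat.lt_succ_self _)
    rw [map_sub, sub_eq_zero] at this ⊢
    rw [this]
    rfl
  refine ⟨(RingEquiv.ofBijective Ψ ⟨hinj, hsurj⟩).symm, fun o => ?_⟩
  rw [RingEquiv.symm_apply_eq]
  exact (hΨj o).symm

end MvPowerSeries

namespace StratifiedPair

variable {X : Scheme.{u}}

theorem stalkIdeal_eq (I : X.IdealSheafData) {x : X} {U : X.affineOpens} (hx : x ∈ U.1) :
    stalkIdeal I x = (I.ideal U).map (X.presheaf.germ U.1 x hx).hom := by
  have key : ∀ (V W : X.affineOpens) (hW : x ∈ W.1) (h : W ≤ V),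
      (I.ideal V).map (X.presheaf.germ V.1 x (h hW)).hom =
        (I.ideal W).map (X.presheaf.germ W.1 x hW).hom := by
    intro V W hW h
    rw [← I.map_ideal h, Ideal.map_map, ← CommRingCat.hom_comp]
    exact congrArg (fun g => (I.ideal V).map (CommRingCat.Hom.hom g))
      (X.presheaf.germ_res (homOfLE h) x hW).symm
  refine le_antisymm (iSup₂_le fun V hV => ?_) (le_iSup₂ (f := fun (U : X.affineOpens)
    (hx : x ∈ U.1) => (I.ideal U).map (X.presheaf.germ U.1 x hx).hom) U hx)
  obtain ⟨W, hW, hxW, hWle⟩ :=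
    Opens.isBasis_iff_nbhd.mp X.isBasis_affineOpens (show x ∈ U.1 ⊓ V.1 from ⟨hx, hV⟩)
  have h1 := key V ⟨W, hW⟩ hxW (hWle.trans inf_le_right)
  have h2 := key U ⟨W, hW⟩ hxW (hWle.trans inf_le_left)
  exact (h1.trans h2.symm).le

theorem specMap_germ_comp_fromSpec {U : X.Opens} (hU : IsAffineOpen U) {x : X} (hx : x ∈ U) :
    Spec.map (X.presheaf.germ U x hx) ≫ hU.fromSpec = X.fromSpecStalk x :=
  hU.fromSpecStalk_eq_fromSpecStalk hx

theorem fromSpecStalk_comp {K : Type u} [Field K] (f : X ⟶ Spec (.of K)) (x : X) :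
    X.fromSpecStalk x ≫ f = Spec.map (CommRingCat.ofHom
      ((X.presheaf.germ ⊤ x trivial).hom.comp (constants f ⊤))) := by
  obtain ⟨U, hU, hx, -⟩ :=
    Opens.isBasis_iff_nbhd.mp X.isBasis_affineOpens (show x ∈ (⊤ : X.Opens) from trivial)
  replace hU : IsAffineOpen U := hU
  rw [← specMap_germ_comp_fromSpec hU hx, Category.assoc, fromSpec_comp, ← Spec.map_comp]
  congr 1
  ext c
  change X.presheaf.germ U x hx (constants f U c) = X.presheaf.germ ⊤ x trivial (constants f ⊤ c)
  rw [← map_constants (le_top : U ≤ ⊤), TopCat.Presheaf.germ_res_apply]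

theorem germ_stalkMap_comp_fromSpec {Y : Scheme.{u}} (p : Y ⟶ X) {y : Y} {U : X.Opens}
    (hU : IsAffineOpen U) (hy : p y ∈ U) :
    Spec.map (X.presheaf.germ U (p y) hy ≫ p.stalkMap y) ≫ hU.fromSpec = Y.fromSpecStalk y ≫ p := by
  rw [Spec.map_comp, Category.assoc, specMap_germ_comp_fromSpec,
    Scheme.SpecMap_stalkMap_fromSpecStalk]

theorem exists_isLocalHom_stalk {P : CommRingCat.{u}} [IsLocalRing P] (J : Spec P ⟶ X) {x : X}
    (hx : J (IsLocalRing.closedPoint P) = x) :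
    ∃ j : X.presheaf.stalk x ⟶ P, IsLocalHom j.hom ∧ Spec.map j ≫ X.fromSpecStalk x = J := by
  subst hx
  exact ⟨Scheme.stalkClosedPointTo J, inferInstance,
    Scheme.Spec_stalkClosedPointTo_fromSpecStalk J⟩

end StratifiedPair

end

noncomputable section

namespace EtaleCoord

open MvPowerSeries

/-- Locality of j identifies the maximal ideal with the elements whose jet has zero constant term.
Thus powers of the maximal ideal match powers of the variable ideal in both directions. -/
theorem exists_completion_equiv {k F R : Type*} {O : Type u} [CommRing k] [CommRing R] [Field F]
    [Algebra k R] [Algebra k F] {n : ℕ} {t : Fin n → R} [CommRing O] [IsLocalRing O] [Algebra F O]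
    [Algebra k O] [IsScalarTower k F O]
    (ht : (MvPolynomial.eval₂Hom (algebraMap k R) t).Etale) (x : R →ₐ[k] F) (ι : R →ₐ[k] O)
    (hepi : ∀ (B : Type u) [CommRing B] [Algebra F B] (g₁ g₂ : O →ₐ[F] B),
      (∀ r, g₁ (ι r) = g₂ (ι r)) → g₁ = g₂)
    (j : O →ₐ[F] MvPowerSeries (Fin n) F) (hj : ∀ r, j (ι r) = jet ht x r)
    (hloc : IsLocalHom j.toRingHom) :
    ∃ Φ : AdicCompletion (IsLocalRing.maximalIdeal O) O ≃+* MvPowerSeries (Fin n) F,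
      ∀ o, Φ (algebraMap O _ o) = j o := by
  have hmax : ∀ o, constantCoeff (j o) = 0 ↔ o ∈ IsLocalRing.maximalIdeal O := by
    intro o
    rw [IsLocalRing.mem_maximalIdeal, mem_nonunits_iff, ← isUnit_map_iff j.toRingHom]
    change _ ↔ ¬ IsUnit (j o)
    rw [MvPowerSeries.isUnit_iff_constantCoeff, isUnit_iff_ne_zero, not_not]
  have hpow := fun N o => mem_pow_of_jet_mem ht x ι hepi j hj (IsLocalRing.maximalIdeal O)
    (fun o => (hmax o).1) (N := N) (o := o)
  have hjet : IsLocalJet (fun i => ι (t i)) (fun i => x (t i)) j :=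
    ⟨fun i => by rw [hj, jet_coord], hpow⟩
  refine exists_adicCompletion_equiv _ j.toRingHom (fun N o => ⟨hpow N o, fun ho => ?_⟩)
    hjet.exists_sub_mem
  have h1 : IsLocalRing.maximalIdeal O ≤ (varIdeal (Fin n) F).comap j.toRingHom := fun o ho =>
    mem_varIdeal_iff.2 ((hmax o).2 ho)
  exact Ideal.le_comap_pow _ N (Ideal.pow_right_mono h1 N ho)

end EtaleCoord

namespace StratifiedPair

variable {k : Type u} [Field k] {X : Scheme.{u}} {f : X ⟶ Spec (.of k)}

/-- The `K`-rational point of `X_K` defined by a `K`-valued point of an affine chart, and the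
Taylor expansion there. -/
theorem exists_ratPoint_completedStalk_equiv {U : X.affineOpens} {n : ℕ} {t : Fin n → Γ(X, U.1)}
    (ht : (MvPolynomial.eval₂Hom (constants f U.1) t).Etale) {K : Type u} [Field K] [Algebra k K] :
    let _ : Algebra k Γ(X, U.1) := (constants f U.1).toAlgebra
    let q := Spec.map (CommRingCat.ofHom (algebraMap k K))
    let fK : pullback f q ⟶ Spec (.of K) := pullback.snd f q
    ∀ y : Γ(X, U.1) →ₐ[k] K, ∃ (z : RatPoint fK)
      (Φ : CompletedStalk (pullback f q) z.pt ≃+* MvPowerSeries (Fin n) K),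
      (∀ a : K, Φ (completedConstants fK z.pt a) = MvPowerSeries.C a) ∧
      ∀ I : X.IdealSheafData, (completedIdeal (pullback.fst f q) I z.pt).map Φ =
        (I.ideal U).map (EtaleCoord.jet (k := k) ht y) := by
  intro _ q fK y
  have hU : IsAffineOpen U.1 := U.2
  let P := MvPowerSeries (Fin n) K
  let jet : Γ(X, U.1) →+* P := (EtaleCoord.jet (k := k) ht y).toRingHom
  let p : pullback f q ⟶ X := pullback.fst f q
  have hcond : ∀ (B : Type u) [CommRing B] (a : Γ(X, U.1) →+* B) (b : K →+* B),
      a.comp (constants f U.1) = b.comp (algebraMap k K) →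
      (Spec.map (CommRingCat.ofHom a) ≫ hU.fromSpec) ≫ f = Spec.map (CommRingCat.ofHom b) ≫ q := by
    intro B _ a b hab
    rw [Category.assoc, fromSpec_comp, ← Spec.map_comp, ← Spec.map_comp, ← CommRingCat.ofHom_comp,
      ← CommRingCat.ofHom_comp, hab]
  have hJ := hcond P jet MvPowerSeries.C (RingHom.ext fun c =>
    ((EtaleCoord.jet (k := k) ht y).commutes c).trans (MvPowerSeries.algebraMap_apply ..))
  have hy := hcond K y.toRingHom (RingHom.id K) (RingHom.ext y.commutes)
  -- The jet and the constants together give a morphism from the formal disc to X_K. Its closed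
  -- point is z, so it factors through the local ring at z.
  let J : Spec (.of P) ⟶ pullback f q := pullback.lift _ _ hJ
  let z : RatPoint fK := ⟨pullback.lift _ _ hy, (pullback.lift_snd _ _ hy).trans (Spec.map_id _)⟩
  have hJz : Spec.map (CommRingCat.ofHom MvPowerSeries.constantCoeff) ≫ J = z.1 := by
    refine pullback.hom_ext ?_ ?_
    · rw [Category.assoc, pullback.lift_fst, pullback.lift_fst, ← Category.assoc, ← Spec.map_comp,
        ← CommRingCat.ofHom_comp]
      congr 3
      exact RingHom.ext (EtaleCoord.constantCoeff_jet ht y)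
    · rw [Category.assoc, pullback.lift_snd, pullback.lift_snd, ← Spec.map_comp,
        ← CommRingCat.ofHom_comp]
      congr 2
  have hcl : IsLocalRing.closedPoint P =
      PrimeSpectrum.comap (MvPowerSeries.constantCoeff (σ := Fin n) (R := K))
        (IsLocalRing.closedPoint K) := by
    have : IsLocalHom (MvPowerSeries.constantCoeff (σ := Fin n) (R := K)) :=
      ⟨fun _ => MvPowerSeries.isUnit_iff_constantCoeff.2⟩
    exact (IsLocalRing.comap_closedPoint _).symm
  have hJpt : J (IsLocalRing.closedPoint P) = z.pt := by
    rw [hcl, RatPoint.pt, ← hJz]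
    rfl
  obtain ⟨j, hloc, hj⟩ := exists_isLocalHom_stalk J hJpt
  have hzU : p z.pt ∈ U.1 := by
    have h1 : p z.pt = hU.fromSpec (PrimeSpectrum.comap y.toRingHom (IsLocalRing.closedPoint K)) := by
      change (z.1 ≫ p) (IsLocalRing.closedPoint K) = _
      rw [pullback.lift_fst]
      rfl
    have h2 := Set.mem_range_self (f := hU.fromSpec)
      (PrimeSpectrum.comap y.toRingHom (IsLocalRing.closedPoint K))
    rw [← h1, hU.range_fromSpec] at h2
    exact h2
  let O := (pullback f q).presheaf.stalk z.pt
  let ι : Γ(X, U.1) ⟶ O := X.presheaf.germ U.1 (p z.pt) hzU ≫ p.stalkMap z.pt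
  have hι : Spec.map ι ≫ hU.fromSpec = (pullback f q).fromSpecStalk z.pt ≫ p :=
    germ_stalkMap_comp_fromSpec p hU hzU
  let κ : K →+* O := ((pullback f q).presheaf.germ ⊤ z.pt trivial).hom.comp (constants fK ⊤)
  have hκ : (pullback f q).fromSpecStalk z.pt ≫ fK = Spec.map (CommRingCat.ofHom κ) :=
    fromSpecStalk_comp fK z.pt
  have hjι : ∀ r, j.hom (ι.hom r) = jet r := by
    have h1 : Spec.map (ι ≫ j) ≫ hU.fromSpec = Spec.map (CommRingCat.ofHom jet) ≫ hU.fromSpec := by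
      rw [Spec.map_comp, Category.assoc, hι, ← Category.assoc, hj, pullback.lift_fst]
    exact RingHom.congr_fun (congrArg CommRingCat.Hom.hom
      (Spec.map_injective ((cancel_mono _).1 h1)))
  have hjκ : ∀ a, j.hom (κ a) = MvPowerSeries.C a := by
    have h1 : Spec.map (CommRingCat.ofHom κ ≫ j) = Spec.map (CommRingCat.ofHom MvPowerSeries.C) := by
      rw [Spec.map_comp, ← hκ, ← Category.assoc, hj, pullback.lift_snd]
    exact RingHom.congr_fun (congrArg CommRingCat.Hom.hom (Spec.map_injective h1))
  have hικ : ∀ c, ι.hom (constants f U.1 c) = κ (algebraMap k K c) := by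
    have h1 : Spec.map (CommRingCat.ofHom (constants f U.1) ≫ ι) =
        Spec.map (CommRingCat.ofHom (algebraMap k K) ≫ CommRingCat.ofHom κ) := by
      rw [Spec.map_comp _ ι, Spec.map_comp _ (CommRingCat.ofHom κ), ← hκ, ← fromSpec_comp hU,
        ← Category.assoc, hι, Category.assoc, Category.assoc]
      exact congrArg _ pullback.condition
    exact RingHom.congr_fun (congrArg CommRingCat.Hom.hom (Spec.map_injective h1))
  let : Algebra K O := κ.toAlgebra
  let : Algebra k O := (κ.comp (algebraMap k K)).toAlgebra
  have : IsScalarTower k K O := .of_algebraMap_eq fun _ => rfl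
  -- The local ring at z is generated by R and K in the sense of epimorphisms: its spectrum maps
  -- monomorphically to the fibre product X_K, and a map to that product is determined by its two
  -- components.
  obtain ⟨Φ, hΦ⟩ := EtaleCoord.exists_completion_equiv (k := k) (O := O) ht y
    ({ ι.hom with commutes' := hικ } : Γ(X, U.1) →ₐ[k] O) (fun B _ _ g₁ g₂ hg => by
      have h1 : Spec.map (CommRingCat.ofHom g₁.toRingHom) ≫ (pullback f q).fromSpecStalk z.pt =
          Spec.map (CommRingCat.ofHom g₂.toRingHom) ≫ (pullback f q).fromSpecStalk z.pt := by
        refine pullback.hom_ext ?_ ?_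
        · rw [Category.assoc, Category.assoc]
          change _ ≫ (pullback f q).fromSpecStalk z.pt ≫ p =
            _ ≫ (pullback f q).fromSpecStalk z.pt ≫ p
          rw [← hι, ← Category.assoc, ← Category.assoc, ← Spec.map_comp, ← Spec.map_comp]
          congr 2
          ext r
          exact hg r
        · rw [Category.assoc, Category.assoc]
          change _ ≫ (pullback f q).fromSpecStalk z.pt ≫ fK =
            _ ≫ (pullback f q).fromSpecStalk z.pt ≫ fK
          rw [hκ, ← Spec.map_comp, ← Spec.map_comp]
          congr 1
          ext a
          exact (g₁.commutes a).trans (g₂.commutes a).symm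
      have h2 := Spec.map_injective ((cancel_mono _).1 h1)
      ext o
      exact RingHom.congr_fun (congrArg CommRingCat.Hom.hom h2) o)
    { j.hom with commutes' := hjκ } hjι hloc
  refine ⟨z, Φ, fun a => (hΦ _).trans (hjκ a), fun I => ?_⟩
  change ((Ideal.map (p.stalkMap z.pt).hom (stalkIdeal I (p z.pt))).map (algebraMap O _)).map Φ = _
  rw [stalkIdeal_eq I hzU, Ideal.map_map, Ideal.map_map, ← Ideal.map_coe Φ, Ideal.map_map,
    ← Ideal.map_coe (EtaleCoord.jet ht y)]
  congr 1
  ext1 r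
  exact (hΦ _).trans (hjι r)

end StratifiedPair

end

noncomputable section

namespace MvPowerSeries

variable {σ A : Type*} [Field A]

/-- Rescaling the variables by units. -/
def rescaleEquiv (c : σ → A) (hc : ∀ i, c i ≠ 0) : MvPowerSeries σ A ≃+* MvPowerSeries σ A :=
  RingEquiv.ofRingHom (rescale c) (rescale c⁻¹)
    (by
      rw [← rescale_mul, show c⁻¹ * c = 1 from funext fun i => inv_mul_cancel₀ (hc i), rescale_one])
    (by
      rw [← rescale_mul, show c * c⁻¹ = 1 from funext fun i => mul_inv_cancel₀ (hc i), rescale_one])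

theorem rescaleEquiv_apply (c : σ → A) (hc : ∀ i, c i ≠ 0) (p : MvPowerSeries σ A) :
    rescaleEquiv c hc p = rescale c p := rfl

theorem map_rescaleEquiv_span_X (c : σ → A) (hc : ∀ i, c i ≠ 0) (S : Set σ) :
    (Ideal.span (X '' S)).map (rescaleEquiv c hc) =
      Ideal.span ((X : σ → MvPowerSeries σ A) '' S) := by
  rw [Ideal.map_span, Set.image_image]
  refine le_antisymm (Ideal.span_le.2 ?_) (Ideal.span_le.2 ?_)
  · rintro _ ⟨i, hi, rfl⟩
    change rescale c (X i) ∈ _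
    rw [rescale_X]
    exact Ideal.mul_mem_left _ _ (Ideal.subset_span ⟨i, hi, rfl⟩)
  · rintro _ ⟨i, hi, rfl⟩
    have h1 : X i = C (c i)⁻¹ * rescaleEquiv c hc (X i) := by
      rw [rescaleEquiv_apply, rescale_X, ← mul_assoc, ← map_mul, inv_mul_cancel₀ (hc i), map_one,
        one_mul]
    change X i ∈ _
    rw [h1]
    exact Ideal.mul_mem_left _ _ (Ideal.subset_span ⟨i, hi, rfl⟩)

theorem map_rescale {B : Type*} [CommRing B] (φ : A →+* B) (c : σ → A) (p : MvPowerSeries σ A) :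
    map φ (rescale c p) = rescale (fun i => φ (c i)) (map φ p) := by
  ext b
  simp [coeff_rescale, Finsupp.prod, map_mul, map_prod]

end MvPowerSeries

namespace EtaleCoord

open MvPowerSeries

theorem map_span_coord {k F R : Type*} [CommRing k] [CommRing R] [CommRing F] [Algebra k R]
    [Algebra k F] {n : ℕ} {t : Fin n → R}
    (ht : (MvPolynomial.eval₂Hom (algebraMap k R) t).Etale) (x : R →ₐ[k] F) {S : Set (Fin n)}
    (hS : ∀ i ∈ S, x (t i) = 0) : (Ideal.span (t '' S)).map (jet ht x) = Ideal.span (X '' S) := by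
  rw [Ideal.map_span, Set.image_image]
  congr 1
  refine Set.image_congr fun i hi => ?_
  rw [jet_coord, hS i hi, map_zero, zero_add]

/-- Extending the coefficients of a jet keeps the prescribed coordinates and constant terms, so
uniqueness applies. -/
theorem map_jet {k K F R : Type*} [CommRing k] [CommRing R] [CommRing K] [CommRing F] [Algebra k R]
    [Algebra k K] [Algebra k F] {n : ℕ} {t : Fin n → R}
    (ht : (MvPolynomial.eval₂Hom (algebraMap k R) t).Etale) (x : R →ₐ[k] K) (φ : K →ₐ[k] F) (r : R) :
    map (φ : K →+* F) (jet ht x r) = jet ht (φ.comp x) r := by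
  let j : R →ₐ[k] MvPowerSeries (Fin n) F :=
    { (map (φ : K →+* F)).comp (jet ht x).toRingHom with
      commutes' := fun c => by
        change map (φ : K →+* F) (jet ht x (algebraMap k R c)) = _
        rw [AlgHom.commutes, MvPowerSeries.algebraMap_apply, map_C, MvPowerSeries.algebraMap_apply]
        congr 1
        exact φ.commutes c }
  have : j = jet ht (φ.comp x) := eq_jet (fun i => by
    change map (φ : K →+* F) (jet ht x (t i)) = _
    rw [jet_coord, map_add, map_C, map_X]
    rfl) fun r => by
    change constantCoeff (map (φ : K →+* F) (jet ht x r)) = _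
    rw [← coeff_zero_eq_constantCoeff_apply, coeff_map, coeff_zero_eq_constantCoeff_apply,
      constantCoeff_jet]
    rfl
  exact AlgHom.congr_fun this r

end EtaleCoord

namespace StratifiedPair

variable {k : Type u} [Field k] {X : Scheme.{u}} {f : X ⟶ Spec (.of k)}
  {ι : Type w} {D : ι → X.IdealSheafData}

/-- Taylor expansion identifies both completions with K[[X]]. There a stratum is the unit ideal or
generated by variables in s, and each such ideal is preserved by rescaling, so rescaling is an
admissible isomorphism between the completions at the two points. -/
theorem FormalInvariant.map_jet_eq {I : X.IdealSheafData} (h : FormalInvariant f D I)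
    {U : X.affineOpens} {n : ℕ} {t : Fin n → Γ(X, U.1)}
    {s : Finset (Fin n)} (hc : IsAdaptedChart f D U t s)
    {K : Type u} [Field K] [Algebra k K] [FiniteDimensional k K] :
    let _ : Algebra k Γ(X, U.1) := (constants f U.1).toAlgebra
    ∀ (y₁ y₂ : Γ(X, U.1) →ₐ[k] K), (∀ i ∈ s, y₁ (t i) = 0) → (∀ i ∈ s, y₂ (t i) = 0) →
      ∀ (c : Fin n → K) (hc₀ : ∀ i, c i ≠ 0),
        ((I.ideal U).map (EtaleCoord.jet (k := k) hc.etale y₂)).map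
          (MvPowerSeries.rescaleEquiv c hc₀) =
          (I.ideal U).map (EtaleCoord.jet (k := k) hc.etale y₁) := by
  intro _ y₁ y₂ hy₁ hy₂ c hc₀
  obtain ⟨z₁, Φ₁, hC₁, hI₁⟩ := exists_ratPoint_completedStalk_equiv (f := f) hc.etale y₁
  obtain ⟨z₂, Φ₂, hC₂, hI₂⟩ := exists_ratPoint_completedStalk_equiv (f := f) hc.etale y₂
  let φ := (Φ₂.trans (MvPowerSeries.rescaleEquiv c hc₀)).trans Φ₁.symm
  have hφ : ∀ J : X.IdealSheafData, (completedIdeal (pullback.fst f _) J z₂.pt).map φ =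
      (((J.ideal U).map (EtaleCoord.jet (k := k) hc.etale y₂)).map
        (MvPowerSeries.rescaleEquiv c hc₀)).map Φ₁.symm := by
    intro J
    rw [← hI₂ J, ← Ideal.map_coe φ, ← Ideal.map_coe Φ₂, ← Ideal.map_coe Φ₁.symm,
      ← Ideal.map_coe (MvPowerSeries.rescaleEquiv c hc₀), Ideal.map_map, Ideal.map_map]
    rfl
  have hφ' : ∀ J : X.IdealSheafData, (completedIdeal (pullback.fst f _) J z₂.pt).map φ =
      completedIdeal (pullback.fst f _) J z₁.pt ↔
      ((J.ideal U).map (EtaleCoord.jet (k := k) hc.etale y₂)).map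
        (MvPowerSeries.rescaleEquiv c hc₀) =
          (J.ideal U).map (EtaleCoord.jet (k := k) hc.etale y₁) := by
    intro J
    rw [hφ, ← hI₁ J]
    constructor
    · intro h
      rw [← h, ← Ideal.map_coe Φ₁, ← Ideal.map_coe Φ₁.symm, Ideal.map_map]
      simp
    · intro h
      rw [h, ← Ideal.map_coe Φ₁, ← Ideal.map_coe Φ₁.symm, Ideal.map_map]
      simp
  refine (hφ' I).1 (h K z₁ z₂ φ (fun a => ?_) fun Z hZ => (hφ' _).2 ?_)
  · change Φ₁.symm (MvPowerSeries.rescale c (Φ₂ _)) = _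
    rw [hC₂, MvPowerSeries.rescale_C, RingEquiv.symm_apply_eq, hC₁]
  · rcases hc.ideal_stratum Z hZ with h | ⟨S, hS, h⟩
    · rw [h, Ideal.map_top, Ideal.map_top, Ideal.map_top]
    · rw [h]
      refine (congrArg _ (EtaleCoord.map_span_coord hc.etale y₂ fun i hi => hy₂ i (hS hi))).trans ?_
      exact (MvPowerSeries.map_rescaleEquiv_span_X c hc₀ S).trans
        (EtaleCoord.map_span_coord hc.etale y₁ fun i hi => hy₁ i (hS hi)).symm

/-- R is finitely generated and F algebraic, so both points and the scalars are defined over one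
finite extension K. The invariance over K is then pushed to F coefficientwise. No separability is
needed, so L is the whole of F. -/
theorem FormalInvariant.jetInvariant {I : X.IdealSheafData} (h : FormalInvariant f D I)
    {F : Type u} [Field F] [Algebra k F] [Algebra.IsAlgebraic k F] {U : X.affineOpens} {n : ℕ}
    {t : Fin n → Γ(X, U.1)} {s : Finset (Fin n)} (hc : IsAdaptedChart f D U t s) :
    let _ : Algebra k Γ(X, U.1) := (constants f U.1).toAlgebra
    EtaleCoord.JetInvariant (k := k) (F := F) hc.etale s (⊤ : Subfield F) (I.ideal U) := by
  intro _ x₁ x₂ hx₁ hx₂ _ c _ hc₀ _ N G hG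
  have hft : Algebra.FiniteType k Γ(X, U.1) := EtaleCoord.finiteType hc.etale
  obtain ⟨B, hB⟩ := hft.out
  let S : Set F := Set.range c ∪ (x₁ '' B ∪ x₂ '' B)
  let K := IntermediateField.adjoin k S
  have hfin : FiniteDimensional k K := by
    have : Finite S := ((Set.finite_range c).union
      ((B.finite_toSet.image _).union (B.finite_toSet.image _))).to_subtype
    exact IntermediateField.finiteDimensional_adjoin fun z _ => Algebra.IsIntegral.isIntegral z
  have hSK : S ⊆ K := IntermediateField.subset_adjoin k S
  have hxK : ∀ x : Γ(X, U.1) →ₐ[k] F, x '' B ⊆ K → ∀ r, x r ∈ K.toSubalgebra := by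
    intro x hx r
    have h1 : Algebra.adjoin k (B : Set Γ(X, U.1)) ≤ K.toSubalgebra.comap x :=
      Algebra.adjoin_le fun b hb => hx ⟨b, hb, rfl⟩
    exact h1 (hB ▸ Algebra.mem_top)
  have hx₁K := hxK x₁ fun z hz => hSK (.inr (.inl hz))
  have hx₂K := hxK x₂ fun z hz => hSK (.inr (.inr hz))
  let y₁ : Γ(X, U.1) →ₐ[k] K := x₁.codRestrict K.toSubalgebra hx₁K
  let y₂ : Γ(X, U.1) →ₐ[k] K := x₂.codRestrict K.toSubalgebra hx₂K
  let c' : Fin n → K := fun i => ⟨c i, hSK (.inl ⟨i, rfl⟩)⟩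
  have hc₀' : ∀ i, c' i ≠ 0 := fun i h => hc₀ i (congrArg Subtype.val h)
  have key := h.map_jet_eq hc y₁ y₂ (fun i hi => Subtype.ext (hx₁ i hi))
    (fun i hi => Subtype.ext (hx₂ i hi)) c' hc₀'
  have hmem := Ideal.mem_map_of_mem (MvPowerSeries.rescaleEquiv c' hc₀')
    (Ideal.mem_map_of_mem (EtaleCoord.jet (k := k) hc.etale y₂) hG)
  rw [key] at hmem
  have hmem' := Ideal.mem_map_of_mem (MvPowerSeries.map (σ := Fin n) (K.val : K →+* F)) hmem
  refine Ideal.mem_sup_left ?_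
  rw [MvPowerSeries.rescaleEquiv_apply, MvPowerSeries.map_rescale, EtaleCoord.map_jet,
    ← Ideal.map_coe (EtaleCoord.jet hc.etale y₁), Ideal.map_map] at hmem'
  rw [← Ideal.map_coe (EtaleCoord.jet hc.etale x₁)]
  have h1 : ((MvPowerSeries.map (σ := Fin n) (K.val : K →+* F)).comp
      (EtaleCoord.jet (k := k) hc.etale y₁ : _ →+* _)) = (EtaleCoord.jet (k := k) hc.etale x₁ : _ →+* _) :=
    RingHom.ext fun r => EtaleCoord.map_jet hc.etale y₁ K.val r
  rw [h1] at hmem'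
  exact hmem'

theorem IsSNCPair.isToroidal_of_formalInvariant [Fintype ι] (h : IsSNCPair f D)
    {I : X.IdealSheafData} (hI : FormalInvariant f D I) : IsToroidal D I := by
  refine h.isToroidal_of_jetInvariant (F := AlgebraicClosure k) (L := ⊤) ?_ I
    fun U n t s hc => hI.jetInvariant hc
  have : Infinite (AlgebraicClosure k) := inferInstance
  exact Set.infinite_univ

end StratifiedPair

end

/-! ### Taylor expansions of analytic functions -/

noncomputable section

open Asymptotics MvPowerSeries

section Taylor

variable {𝕜 : Type*} [NontriviallyNormedField 𝕜] {n : ℕ}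

theorem Polynomial.X_pow_dvd_of_isBigO {q : Polynomial 𝕜} {N : ℕ}
    (h : (fun z => q.eval z) =O[𝓝 0] fun z => z ^ N) : Polynomial.X ^ N ∣ q := by
  induction N with
  | zero => simp
  | succ N ih =>
    obtain ⟨r, rfl⟩ := ih (h.trans (IsBigO.of_bound 1 (by
      filter_upwards [Metric.ball_mem_nhds (0 : 𝕜) one_pos] with z hz
      rw [pow_succ, norm_mul, one_mul]
      exact mul_le_of_le_one_right (norm_nonneg _) (by simpa using (mem_ball_zero_iff.1 hz).le))))
    rw [pow_succ]
    refine mul_dvd_mul_left _ (Polynomial.X_dvd_iff.2 ?_)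
    rw [Polynomial.coeff_zero_eq_eval_zero]
    have h1 : (fun z => r.eval z) =O[𝓝[≠] 0] fun z : 𝕜 => z := by
      have := h.mono (nhdsWithin_le_nhds (s := {0}ᶜ))
      obtain ⟨C, hC⟩ := this.bound
      refine IsBigO.of_bound C ?_
      filter_upwards [hC, self_mem_nhdsWithin] with z hz hz0
      rw [Polynomial.eval_mul, Polynomial.eval_pow, Polynomial.eval_X, pow_succ, norm_mul, norm_mul,
        mul_left_comm] at hz
      exact le_of_mul_le_mul_left hz (norm_pos_iff.2 (pow_ne_zero _ hz0))
    have h2 : Filter.Tendsto (fun z => r.eval z) (𝓝[≠] 0) (𝓝 0) :=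
      h1.trans_tendsto (Filter.tendsto_id.mono_left nhdsWithin_le_nhds)
    exact tendsto_nhds_unique (r.continuous.tendsto 0 |>.mono_left nhdsWithin_le_nhds) h2

theorem MvPolynomial.IsHomogeneous.eval_smul {σ A : Type*} [Fintype σ] [CommRing A] {d : ℕ}
    {q : MvPolynomial σ A} (hq : q.IsHomogeneous d) (z : A) (v : σ → A) :
    MvPolynomial.eval (z • v) q = z ^ d * MvPolynomial.eval v q := by
  rw [MvPolynomial.eval_eq', MvPolynomial.eval_eq', Finset.mul_sum]
  refine Finset.sum_congr rfl fun b hb => ?_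
  have hd : ∑ i, b i = d := by
    rw [← Finsupp.degree_eq_sum, Finsupp.degree_eq_weight_one]
    exact hq (MvPolynomial.mem_support_iff.1 hb)
  simp only [Pi.smul_apply, smul_eq_mul, mul_pow, Finset.prod_mul_distrib, Finset.prod_pow_eq_pow_sum,
    hd]
  ring

/-- On each line z ↦ zv the polynomial is O(z^N), and its coefficient at z^d is the degree d
homogeneous component at v. So the components of degree below N vanish at every v, hence as
polynomials. -/
theorem MvPolynomial.coe_mem_varIdeal_pow_of_isBigO {q : MvPolynomial (Fin n) 𝕜} {N : ℕ}
    (h : (fun v => MvPolynomial.eval v q) =O[𝓝 0] fun v => ‖v‖ ^ N) :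
    (q : MvPowerSeries (Fin n) 𝕜) ∈ varIdeal (Fin n) 𝕜 ^ N := by
  rw [mem_varIdeal_pow_iff]
  intro b hb
  rw [MvPolynomial.coeff_coe]
  suffices hq : MvPolynomial.homogeneousComponent b.degree q = 0 by
    have := congrArg (MvPolynomial.coeff b) hq
    simpa [MvPolynomial.coeff_homogeneousComponent] using this
  refine MvPolynomial.funext fun v => ?_
  rw [map_zero]
  let r : Polynomial 𝕜 := ∑ d ∈ Finset.range (q.totalDegree + 1),
    Polynomial.C (MvPolynomial.eval v (MvPolynomial.homogeneousComponent d q)) * Polynomial.X ^ d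
  have hr : ∀ z, r.eval z = MvPolynomial.eval (z • v) q := fun z => by
    conv_rhs => rw [← MvPolynomial.sum_homogeneousComponent q]
    rw [map_sum, Polynomial.eval_finsetSum]
    refine Finset.sum_congr rfl fun d _ => ?_
    rw [(MvPolynomial.homogeneousComponent_isHomogeneous d q).eval_smul, Polynomial.eval_mul,
      Polynomial.eval_C, Polynomial.eval_pow, Polynomial.eval_X, mul_comm]
  have hdvd : Polynomial.X ^ N ∣ r := Polynomial.X_pow_dvd_of_isBigO (by
    simp_rw [hr]
    have hv : Filter.Tendsto (fun z : 𝕜 => z • v) (𝓝 0) (𝓝 0) := by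
      have : Continuous fun z : 𝕜 => z • v := by fun_prop
      simpa using this.tendsto 0
    refine (h.comp_tendsto hv).trans (IsBigO.of_bound (‖v‖ ^ N) (.of_forall fun z => ?_))
    simp [norm_smul, mul_pow, mul_comm])
  have := Polynomial.X_pow_dvd_iff.1 hdvd b.degree hb
  simp only [r, Polynomial.finsetSum_coeff, Polynomial.coeff_C_mul, Polynomial.coeff_X_pow,
    mul_ite, mul_one, mul_zero, Finset.sum_ite_eq, Finset.mem_range] at this
  split_ifs at this with hlt
  · exact this
  · rw [MvPolynomial.homogeneousComponent_eq_zero _ _ (by omega), map_zero]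

/-- The power series `p` is the Taylor expansion of `h` at the origin. -/
def IsTaylor (h : (Fin n → 𝕜) → 𝕜) (p : MvPowerSeries (Fin n) 𝕜) : Prop :=
  ∀ N, ∃ q : MvPolynomial (Fin n) 𝕜, (q : MvPowerSeries (Fin n) 𝕜) - p ∈ varIdeal (Fin n) 𝕜 ^ N ∧
    (fun v => h v - MvPolynomial.eval v q) =O[𝓝 0] fun v => ‖v‖ ^ N

namespace IsTaylor

variable {h h' : (Fin n → 𝕜) → 𝕜} {p p' : MvPowerSeries (Fin n) 𝕜}

/-- Two polynomials approximating the same germ to order N differ by O(‖v‖^N), hence by an element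
of the N-th power of the variable ideal. -/
theorem eq (H : IsTaylor h p) (H' : IsTaylor h' p') (hh : h =ᶠ[𝓝 0] h') : p = p' := by
  rw [← sub_eq_zero, ← Ideal.mem_bot, ← iInf_varIdeal_pow, Ideal.mem_iInf]
  intro N
  obtain ⟨q, hq1, hq2⟩ := H N
  obtain ⟨q', hq1', hq2'⟩ := H' N
  have : ((q - q' : MvPolynomial (Fin n) 𝕜) : MvPowerSeries (Fin n) 𝕜) ∈
      varIdeal (Fin n) 𝕜 ^ N := by
    refine MvPolynomial.coe_mem_varIdeal_pow_of_isBigO ((hq2'.sub hq2).congr' ?_ .rfl)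
    filter_upwards [hh] with v hv
    rw [map_sub, hv]
    ring
  rw [show ((q - q' : MvPolynomial (Fin n) 𝕜) : MvPowerSeries (Fin n) 𝕜) = q - q' from
    map_sub MvPolynomial.coeToMvPowerSeries.ringHom q q'] at this
  convert! sub_mem (add_mem hq1' this) hq1 using 1
  ring

theorem eval (q : MvPolynomial (Fin n) 𝕜) : IsTaylor (fun v => MvPolynomial.eval v q) q :=
  fun N => ⟨q, by simp, by simpa using isBigO_zero _ _⟩

theorem add (H : IsTaylor h p) (H' : IsTaylor h' p') :
    IsTaylor (fun v => h v + h' v) (p + p') := fun N => by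
  obtain ⟨q, hq1, hq2⟩ := H N
  obtain ⟨q', hq1', hq2'⟩ := H' N
  refine ⟨q + q', ?_, (hq2.add hq2').congr_left fun v => by rw [map_add]; ring⟩
  convert! add_mem hq1 hq1' using 1
  rw [MvPolynomial.coe_add]
  ring

theorem isBigO_eval (q : MvPolynomial (Fin n) 𝕜) :
    (fun v => MvPolynomial.eval v q) =O[𝓝 0] fun _ => (1 : ℝ) :=
  (MvPolynomial.continuous_eval q).continuousAt.tendsto.isBigO_one ℝ

theorem isBigO_one (H : IsTaylor h p) : h =O[𝓝 0] fun _ => (1 : ℝ) := by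
  obtain ⟨q, -, hq⟩ := H 0
  simpa using hq.add ((isBigO_eval q).congr_right fun v => (pow_zero ‖v‖).symm)

theorem mul (H : IsTaylor h p) (H' : IsTaylor h' p') :
    IsTaylor (fun v => h v * h' v) (p * p') := fun N => by
  obtain ⟨q, hq1, hq2⟩ := H N
  obtain ⟨q', hq1', hq2'⟩ := H' N
  refine ⟨q * q', ?_, ?_⟩
  · convert! add_mem (Ideal.mul_mem_right (q' : MvPowerSeries (Fin n) 𝕜) _ hq1)
      (Ideal.mul_mem_left _ p hq1') using 1
    rw [MvPolynomial.coe_mul]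
    ring
  · refine (((hq2.mul H'.isBigO_one).congr_right fun v => mul_one _).add
      (((isBigO_eval q).mul hq2').congr_right fun v => one_mul _)).congr_left fun v => ?_
    rw [map_mul]
    ring

theorem zero : IsTaylor (fun _ => (0 : 𝕜)) (0 : MvPowerSeries (Fin n) 𝕜) := by
  simpa using eval (0 : MvPolynomial (Fin n) 𝕜)

theorem sum {ι : Type*} (s : Finset ι) {h : ι → (Fin n → 𝕜) → 𝕜}
    {p : ι → MvPowerSeries (Fin n) 𝕜} (H : ∀ i ∈ s, IsTaylor (h i) (p i)) :
    IsTaylor (fun v => ∑ i ∈ s, h i v) (∑ i ∈ s, p i) := by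
  classical
  induction s using Finset.induction with
  | empty => simpa using zero
  | insert a s ha ih =>
    simp only [Finset.sum_insert ha]
    exact (H a (Finset.mem_insert_self _ _)).add
      (ih fun i hi => H i (Finset.mem_insert_of_mem hi))

theorem constantCoeff_eq (H : IsTaylor h p) : constantCoeff p = h 0 := by
  obtain ⟨q, hq1, hq2⟩ := H 1
  rw [pow_one, mem_varIdeal_iff, map_sub, sub_eq_zero] at hq1
  have h0 : h 0 - MvPolynomial.eval 0 q = 0 := by
    have := hq2.eq_zero_imp.self_of_nhds
    simpa using this
  rw [← hq1, sub_eq_zero.1 h0, ← coeff_zero_eq_constantCoeff_apply, MvPolynomial.coeff_coe,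
    ← MvPolynomial.constantCoeff_eq, ← MvPolynomial.eval_zero]

theorem rescale (H : IsTaylor h p) (c : Fin n → 𝕜) :
    IsTaylor (fun v => h (c * v)) (MvPowerSeries.rescale c p) := fun N => by
  obtain ⟨q, hq1, hq2⟩ := H N
  let r : MvPolynomial (Fin n) 𝕜 := MvPolynomial.aeval (fun i => MvPolynomial.C (c i) * MvPolynomial.X i) q
  have hr : (r : MvPowerSeries (Fin n) 𝕜) = MvPowerSeries.rescale c q := by
    have : (MvPolynomial.coeToMvPowerSeries.ringHom (R := 𝕜)).comp
        (MvPolynomial.aeval (R := 𝕜)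
          fun i => MvPolynomial.C (c i) * MvPolynomial.X i : _ →ₐ[𝕜] _).toRingHom =
        (MvPowerSeries.rescale c).comp MvPolynomial.coeToMvPowerSeries.ringHom := by
      refine MvPolynomial.ringHom_ext (fun a => ?_) fun i => ?_
      · simp [rescale_C]
      · simp [rescale_X]
    exact DFunLike.congr_fun this q
  refine ⟨r, ?_, ?_⟩
  · rw [mem_varIdeal_pow_iff] at hq1 ⊢
    intro b hb
    rw [hr, ← map_sub, coeff_rescale, hq1 b hb, mul_zero]
  · have hc : Filter.Tendsto (fun v : Fin n → 𝕜 => c * v) (𝓝 0) (𝓝 0) := by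
      have : Continuous fun v : Fin n → 𝕜 => c * v := by fun_prop
      simpa using this.tendsto 0
    refine ((hq2.comp_tendsto hc).congr_left fun v => ?_).trans
      (IsBigO.of_bound (‖c‖ ^ N) (.of_forall fun v => ?_))
    · simp only [Function.comp, r, MvPolynomial.aeval_def]
      congr 1
      have : (MvPolynomial.eval v).comp (MvPolynomial.aeval (R := 𝕜)
          fun i => MvPolynomial.C (c i) * MvPolynomial.X i : _ →ₐ[𝕜] _).toRingHom =
          MvPolynomial.eval (c * v) :=
        MvPolynomial.ringHom_ext (fun a => by simp) fun i => by simp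
      exact (DFunLike.congr_fun this q).symm
    · simp only [Function.comp, norm_pow, norm_norm, ← mul_pow]
      gcongr
      exact norm_mul_le _ _

end IsTaylor

/-- Expand the diagonal argument in the standard basis. This turns the terms of an analytic
expansion into homogeneous polynomials. -/
theorem ContinuousMultilinearMap.exists_isHomogeneous {k : ℕ}
    (f : ContinuousMultilinearMap 𝕜 (fun _ : Fin k => Fin n → 𝕜) 𝕜) :
    ∃ q : MvPolynomial (Fin n) 𝕜, q.IsHomogeneous k ∧
      ∀ v, MvPolynomial.eval v q = f fun _ => v := by
  refine ⟨∑ r : Fin k → Fin n,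
    MvPolynomial.C (f fun j => Pi.single (r j) 1) * ∏ j, MvPolynomial.X (r j), ?_, fun v => ?_⟩
  · refine MvPolynomial.IsHomogeneous.sum _ _ _ fun r _ => ?_
    have := (MvPolynomial.isHomogeneous_C (Fin n) (f fun j => Pi.single (r j) 1)).mul
      (MvPolynomial.IsHomogeneous.prod Finset.univ (fun j => MvPolynomial.X (r j)) (fun _ => 1)
        fun j _ => MvPolynomial.isHomogeneous_X 𝕜 (r j))
    simpa using this
  · have hv : v = ∑ i, v i • (Pi.single i 1 : Fin n → 𝕜) := by
      ext i
      simp [Finset.sum_apply, Pi.single_apply]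
    have := f.toMultilinearMap.map_sum (fun (_ : Fin k) i => v i • (Pi.single i 1 : Fin n → 𝕜))
    rw [← hv] at this
    refine Eq.trans ?_ this.symm
    rw [_root_.map_sum]
    refine Finset.sum_congr rfl fun r _ => ?_
    rw [f.toMultilinearMap.map_smul_univ (fun j => v (r j)) fun j => Pi.single (r j) 1]
    simp [mul_comm]

theorem AnalyticAt.exists_isTaylor {h : (Fin n → 𝕜) → 𝕜} (hh : AnalyticAt 𝕜 h 0) :
    ∃ p, IsTaylor h p := by
  obtain ⟨P, hP⟩ := hh
  choose Q hQ1 hQ2 using fun k => (P k).exists_isHomogeneous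
  let p : MvPowerSeries (Fin n) 𝕜 := fun b => MvPolynomial.coeff b (Q b.degree)
  have hp : ∀ b, MvPowerSeries.coeff b p = MvPolynomial.coeff b (Q b.degree) := fun _ => rfl
  refine ⟨p, fun N => ⟨∑ k ∈ Finset.range N, Q k, ?_, ?_⟩⟩
  · rw [mem_varIdeal_pow_iff]
    intro b hb
    rw [map_sub, MvPolynomial.coeff_coe, MvPolynomial.coeff_sum,
      Finset.sum_eq_single_of_mem b.degree (Finset.mem_range.2 hb) fun k _ hk =>
        (hQ1 k).coeff_eq_zero hk.symm, hp, sub_self]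
  · refine (hP.isBigO_sub_partialSum_pow N).congr_left fun v => ?_
    rw [zero_add, map_sum, FormalMultilinearSeries.partialSum]
    simp_rw [hQ2]

end Taylor

end

/-! ### Analytic local sections of étale coordinates -/

noncomputable section

section Implicit

variable {n : ℕ}

/-- The value at `(T, y)` of a polynomial in `y` with coefficients polynomials in `T`. -/
def bieval (p : Polynomial (MvPolynomial (Fin n) ℂ)) (v : (Fin n → ℂ) × ℂ) : ℂ :=
  p.eval₂ (MvPolynomial.eval v.1) v.2

theorem analyticAt_bieval (p : Polynomial (MvPolynomial (Fin n) ℂ)) (v : (Fin n → ℂ) × ℂ) :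
    AnalyticAt ℂ (bieval p) v := by
  induction p using Polynomial.induction_on' with
  | add p q hp hq =>
    refine (hp.add hq).congr (.of_forall fun v => ?_)
    simp [bieval, Polynomial.eval₂_add]
  | monomial m a =>
    have h1 : AnalyticAt ℂ (fun v : (Fin n → ℂ) × ℂ => MvPolynomial.eval v.1 a) v := by
      refine AnalyticAt.aeval_mvPolynomial (𝕜 := ℂ) (fun i => ?_) a
      exact ((ContinuousLinearMap.proj (R := ℂ) (φ := fun _ : Fin n => ℂ) i).comp
        (ContinuousLinearMap.fst ℂ (Fin n → ℂ) ℂ)).analyticAt v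
    refine (h1.mul (analyticAt_snd.pow m)).congr (.of_forall fun v => ?_)
    simp [bieval, Polynomial.eval₂_monomial]

/-- The implicit function theorem: the partial derivative in the last variable is invertible at u.
-/
theorem exists_analytic_root (p : Polynomial (MvPolynomial (Fin n) ℂ)) {u : (Fin n → ℂ) × ℂ}
    (h0 : bieval p u = 0) (h1 : bieval p.derivative u ≠ 0) :
    ∃ ψ : (Fin n → ℂ) → ℂ, AnalyticAt ℂ ψ u.1 ∧ ψ u.1 = u.2 ∧
      ∀ᶠ v in 𝓝 u, bieval p v = 0 ↔ ψ v.1 = v.2 := by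
  have hc : ContDiffAt ℂ ⊤ (bieval p) u := (analyticAt_bieval p u).contDiffAt
  have hd : (fderiv ℂ (bieval p) u ∘L .inr ℂ (Fin n → ℂ) ℂ) =
      bieval p.derivative u • ContinuousLinearMap.id ℂ ℂ := by
    have hf := (analyticAt_bieval p u).differentiableAt.hasFDerivAt
    have hg : HasFDerivAt (fun y : ℂ => (u.1, y)) (.inr ℂ (Fin n → ℂ) ℂ) u.2 :=
      hasFDerivAt_prodMk_right u.1 u.2
    have hfg := (HasFDerivAt.comp u.2 (g := bieval p) hf hg).hasDerivAt
    have hp := ((p.map (MvPolynomial.eval u.1)).hasDerivAt u.2)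
    have : (bieval p ∘ fun y : ℂ => (u.1, y)) = fun y => (p.map (MvPolynomial.eval u.1)).eval y := by
      ext y
      simp [bieval, Polynomial.eval_map]
    rw [this] at hfg
    have := hfg.unique hp
    ext
    rw [this]
    simp [bieval, Polynomial.eval_map, Polynomial.derivative_map]
  have hi : (fderiv ℂ (bieval p) u ∘L .inr ℂ (Fin n → ℂ) ℂ).IsInvertible := by
    rw [hd]
    exact ⟨ContinuousLinearEquiv.unitsEquivAut ℂ (Units.mk0 _ h1), by ext; simp⟩
  refine ⟨hc.implicitFunction (by simp) hi, ?_, hc.implicitFunction_apply_self _ hi, ?_⟩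
  · exact (hc.contDiffAt_implicitFunction (by simp) hi).analyticAt
  · simpa only [h0] using hc.eventually_apply_eq_iff_implicitFunction (by simp) hi

end Implicit

namespace EtaleCoord

variable {n : ℕ} {R : Type*} [CommRing R] [Algebra ℂ R] {t : Fin n → R}

/-- Local analytic sections of the étale map `t`, standard étale case. -/
theorem exists_analytic_section_standard [Algebra (MvPolynomial (Fin n) ℂ) R]
    [IsScalarTower ℂ (MvPolynomial (Fin n) ℂ) R] (P : StandardEtalePresentation (MvPolynomial (Fin n) ℂ) R)
    (ht : ∀ i, algebraMap (MvPolynomial (Fin n) ℂ) R (.X i) = t i) (x₀ : R →ₐ[ℂ] ℂ) :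
    ∃ (S : (Fin n → ℂ) → R →ₐ[ℂ] ℂ) (Ω : Set (Fin n → ℂ)) (A : Set ((Fin n → ℂ) × ℂ)) (y : R),
      IsOpen Ω ∧ IsOpen A ∧ (fun i => x₀ (t i)) ∈ Ω ∧ (fun i => x₀ (t i), x₀ y) ∈ A ∧
      (∀ x : R →ₐ[ℂ] ℂ, (fun i => x (t i)) ∈ Ω → (fun i => x (t i), x y) ∈ A →
        S (fun i => x (t i)) = x) ∧
      (∀ T ∈ Ω, (T, S T y) ∈ A ∧ ∀ i, S T (t i) = T i) ∧
      ∀ a, ∀ T ∈ Ω, AnalyticAt ℂ (fun T => S T a) T := by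
  have hx : ∀ (x : R →ₐ[ℂ] ℂ) (p : Polynomial (MvPolynomial (Fin n) ℂ)),
      bieval p (fun i => x (t i), x P.x) = x (Polynomial.aeval P.x p) := by
    intro x p
    rw [Polynomial.aeval_def, bieval]
    change _ = x.toRingHom _
    rw [Polynomial.hom_eval₂]
    congr 1
    refine MvPolynomial.ringHom_ext (fun a => ?_) fun i => ?_
    · have : algebraMap (MvPolynomial (Fin n) ℂ) R (.C a) = algebraMap ℂ R a :=
        (IsScalarTower.algebraMap_apply ℂ (MvPolynomial (Fin n) ℂ) R a).symm
      simp [this]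
    · simp [ht]
  let u₀ : (Fin n → ℂ) × ℂ := (fun i => x₀ (t i), x₀ P.x)
  have hf0 : bieval P.f u₀ = 0 := by rw [hx, P.hasMap.1, map_zero]
  have hf1 : bieval P.f.derivative u₀ ≠ 0 := by
    rw [hx]
    exact (P.hasMap.isUnit_derivative_f.map x₀).ne_zero
  have hg0 : ∀ x : R →ₐ[ℂ] ℂ, bieval P.g (fun i => x (t i), x P.x) ≠ 0 := fun x => by
    rw [hx]
    exact (P.hasMap.2.map x).ne_zero
  obtain ⟨ψ, hψ, hψ0, hψ1⟩ := exists_analytic_root P.f hf0 hf1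
  obtain ⟨A, hA, hAo, hA0⟩ := eventually_nhds_iff.1 hψ1
  have hcont : ContinuousAt (fun T => (T, ψ T)) u₀.1 := continuousAt_id.prodMk hψ.continuousAt
  have hu₀ : (fun T => (T, ψ T)) u₀.1 = u₀ := Prod.ext rfl hψ0
  have hev : ∀ᶠ T in 𝓝 u₀.1, AnalyticAt ℂ ψ T ∧ (T, ψ T) ∈ A ∧ bieval P.g (T, ψ T) ≠ 0 := by
    refine hψ.eventually_analyticAt.and ((hcont.eventually (p := (· ∈ A)) ?_).and
      (hcont.eventually (p := fun v => bieval P.g v ≠ 0) ?_))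
    · rw [hu₀]
      exact hAo.mem_nhds hA0
    · rw [hu₀]
      exact (analyticAt_bieval P.g u₀).continuousAt.eventually_ne (hg0 x₀)
  obtain ⟨Ω, hΩ, hΩo, hΩ0⟩ := eventually_nhds_iff.1 hev
  have hS : ∀ T, ∃ x : R →ₐ[ℂ] ℂ, T ∈ Ω → (∀ i, x (t i) = T i) ∧ x P.x = ψ T := by
    intro T
    by_cases hT : T ∈ Ω
    · let : Algebra (MvPolynomial (Fin n) ℂ) ℂ := (MvPolynomial.eval T).toAlgebra
      have hev : ∀ p : Polynomial (MvPolynomial (Fin n) ℂ),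
          Polynomial.aeval (ψ T) p = bieval p (T, ψ T) := fun p => rfl
      have hm : P.HasMap (ψ T) := by
        refine ⟨?_, ?_⟩
        · rw [hev, (hA _ (hΩ T hT).2.1).2 rfl]
        · rw [hev]
          exact (hΩ T hT).2.2.isUnit
      -- The root ψ(T) of f, at which g is invertible, determines a ℂ-point of the standard étale
      -- algebra over T.
      let g : R →ₐ[MvPolynomial (Fin n) ℂ] ℂ := (P.lift (ψ T) hm).comp P.equivRing.toAlgHom
      have hgC : ∀ p, g (algebraMap _ R p) = MvPolynomial.eval T p := g.commutes
      let g' : R →ₐ[ℂ] ℂ :=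
        { g with
          commutes' := fun a => by
            change g (algebraMap ℂ R a) = a
            rw [IsScalarTower.algebraMap_apply ℂ (MvPolynomial (Fin n) ℂ) R, hgC]
            simp }
      refine ⟨g', fun _ => ⟨fun i => ?_, ?_⟩⟩
      · change g (t i) = _
        rw [← ht, hgC, MvPolynomial.eval_X]
      · change P.lift (ψ T) hm (P.equivRing P.x) = _
        rw [P.equivRing_x, StandardEtalePair.lift_X]
    -- A default value; nothing is required off Ω.
    · exact ⟨x₀, fun h => absurd h hT⟩
  choose S hS using hS
  have hS' : ∀ T ∈ Ω, (fun i => S T (t i)) = T := fun T hT => funext (hS T hT).1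
  have hval : ∀ (p : Polynomial (MvPolynomial (Fin n) ℂ)), ∀ T ∈ Ω,
      S T (Polynomial.aeval P.x p) = bieval p (T, ψ T) := fun p T hT => by
    rw [← hx, hS' T hT, (hS T hT).2]
  refine ⟨S, Ω, A, P.x, hΩo, hAo, hΩ0, hA0, fun x hxΩ hxA => ?_, fun T hT => ?_, fun a T hT => ?_⟩
  · obtain ⟨h1, h2⟩ := hS _ hxΩ
    have hxy : ψ (fun i => x (t i)) = x P.x := (hA _ hxA).1 (by rw [hx, P.hasMap.1, map_zero])
    rw [hxy] at h2
    ext a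
    -- Every element of R is a fraction p(y)/g(y)^m, so a point is determined by its coordinates and
    -- its value of y.
    obtain ⟨p, m, hp⟩ := P.exists_mul_aeval_x_g_pow_eq_aeval_x a
    have e1 := congrArg (S fun i => x (t i)) hp
    have e2 := congrArg x hp
    rw [map_mul, map_pow, ← hx, ← hx, hS' _ hxΩ, h2] at e1
    rw [map_mul, map_pow, ← hx, ← hx] at e2
    exact mul_right_cancel₀ (pow_ne_zero m (hg0 x)) (e1.trans e2.symm)
  · refine ⟨?_, (hS T hT).1⟩
    rw [(hS T hT).2]
    exact (hΩ T hT).2.1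
  · obtain ⟨p, m, hp⟩ := P.exists_mul_aeval_x_g_pow_eq_aeval_x a
    have hb : ∀ q, AnalyticAt ℂ (fun T => bieval q (T, ψ T)) T := fun q =>
      AnalyticAt.fun_comp (g := bieval q) (f := fun T => (T, ψ T)) (analyticAt_bieval q (T, ψ T))
        (AnalyticAt.prod analyticAt_id (hΩ T hT).1)
    refine ((hb p).div ((hb P.g).pow m) (pow_ne_zero m (hΩ T hT).2.2)).congr ?_
    filter_upwards [hΩo.mem_nhds hT] with T' hT'
    have e1 := congrArg (S T') hp
    rw [map_mul, map_pow, hval _ T' hT', hval _ T' hT'] at e1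
    change bieval p (T', ψ T') / bieval P.g (T', ψ T') ^ m = _
    rw [← e1, mul_div_cancel_right₀ _ (pow_ne_zero m (hΩ T' hT').2.2)]

/-- Local analytic sections of the étale map `t`. -/
theorem exists_analytic_section (ht : (MvPolynomial.eval₂Hom (algebraMap ℂ R) t).Etale)
    (x₀ : R →ₐ[ℂ] ℂ) :
    ∃ (S : (Fin n → ℂ) → R →ₐ[ℂ] ℂ) (Ω : Set (Fin n → ℂ)) (𝒩 : Set (R → ℂ)),
      IsOpen Ω ∧ IsOpen 𝒩 ∧ ⇑x₀ ∈ 𝒩 ∧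
      (∀ x : R →ₐ[ℂ] ℂ, ⇑x ∈ 𝒩 → (fun i => x (t i)) ∈ Ω ∧ S (fun i => x (t i)) = x) ∧
      (∀ T ∈ Ω, ⇑(S T) ∈ 𝒩 ∧ ∀ i, S T (t i) = T i) ∧
      ∀ a, ∀ T ∈ Ω, AnalyticAt ℂ (fun T => S T a) T := by
  let : Algebra (MvPolynomial (Fin n) ℂ) R := (MvPolynomial.eval₂Hom (algebraMap ℂ R) t).toAlgebra
  have : Algebra.Etale (MvPolynomial (Fin n) ℂ) R := ht
  have : IsScalarTower ℂ (MvPolynomial (Fin n) ℂ) R := .of_algebraMap_eq fun x => by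
    simp [RingHom.algebraMap_toAlgebra]
  have htX : ∀ i, algebraMap (MvPolynomial (Fin n) ℂ) R (.X i) = t i := fun i => by
    simp [RingHom.algebraMap_toAlgebra]
  have : (RingHom.ker x₀).IsPrime := RingHom.ker_isPrime _
  -- An étale algebra is standard étale near each point, after inverting some r.
  obtain ⟨r, hr, hst⟩ := Algebra.IsEtaleAt.exists_isStandardEtale (R := MvPolynomial (Fin n) ℂ)
    (RingHom.ker x₀)
  obtain ⟨⟨P⟩⟩ := hst
  let R' := Localization.Away r
  have hlift : ∀ x : R →ₐ[ℂ] ℂ, x r ≠ 0 → ∃ x' : R' →ₐ[ℂ] ℂ, ∀ a, x' (algebraMap R R' a) = x a := by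
    intro x hxr
    have hu : IsUnit (x.toRingHom r) := hxr.isUnit
    refine ⟨{ IsLocalization.Away.lift r hu with commutes' := fun a => ?_ }, fun a => ?_⟩
    · change IsLocalization.Away.lift (S := R') r hu (algebraMap ℂ R' a) = a
      rw [IsScalarTower.algebraMap_apply ℂ R R', IsLocalization.Away.lift_eq]
      exact x.commutes a
    · exact IsLocalization.Away.lift_eq (S := R') r hu a
  have hne : ∀ x' : R' →ₐ[ℂ] ℂ, x' (algebraMap R R' r) ≠ 0 := fun x' =>
    ((IsLocalization.Away.algebraMap_isUnit (S := R') r).map x').ne_zero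
  obtain ⟨x₀', hx₀'⟩ := hlift x₀ hr
  obtain ⟨S, Ω, A, y, hΩ, hA, hΩ0, hA0, h1, h2, h3⟩ :=
    exists_analytic_section_standard (t := fun i => algebraMap R R' (t i)) P (fun i => by
      rw [← htX, ← IsScalarTower.algebraMap_apply]) x₀'
  obtain ⟨m, b, hy⟩ := IsLocalization.Away.surj r y
  have hyv : ∀ x' : R' →ₐ[ℂ] ℂ,
      x' y = x' (algebraMap R R' b) / x' (algebraMap R R' r) ^ m := fun x' => by
    rw [eq_div_iff (pow_ne_zero m (hne x')), ← map_pow, ← map_mul, hy]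
  let ι : R →ₐ[ℂ] R' := IsScalarTower.toAlgHom ℂ R R'
  have hι : ∀ a, ι a = algebraMap R R' a := fun _ => rfl
  -- The generator y lives only in the localization; writing it as b/r^m makes the neighbourhood
  -- open for pointwise convergence of functions on R.
  let 𝒩 : Set (R → ℂ) := {x | x r ≠ 0} ∩
    (fun x : R → ℂ => (fun i => x (t i), x b / x r ^ m)) ⁻¹' (A ∩ Prod.fst ⁻¹' Ω)
  have h𝒩 : IsOpen 𝒩 := by
    refine ContinuousOn.isOpen_inter_preimage ?_ (isOpen_ne_fun (by fun_prop) (by fun_prop))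
      (hA.inter (hΩ.preimage continuous_fst))
    refine (Continuous.continuousOn (by fun_prop)).prodMk (ContinuousOn.div
      (Continuous.continuousOn (by fun_prop)) (Continuous.continuousOn (by fun_prop)) fun x hx => ?_)
    exact pow_ne_zero m hx
  have hmem : ∀ x' : R' →ₐ[ℂ] ℂ, (fun i => x' (algebraMap R R' (t i))) ∈ Ω →
      (fun i => x' (algebraMap R R' (t i)), x' y) ∈ A → ⇑(x'.comp ι) ∈ 𝒩 := fun x' h h' => by
    rw [hyv] at h'
    exact ⟨hne x', h', h⟩
  refine ⟨fun T => (S T).comp ι, Ω, 𝒩, hΩ, h𝒩, ?_, fun x hx => ?_, fun T hT => ?_,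
    fun a T hT => h3 (ι a) T hT⟩
  · have : x₀'.comp ι = x₀ := AlgHom.ext hx₀'
    rw [← this]
    exact hmem x₀' hΩ0 hA0
  · obtain ⟨x', hx'⟩ := hlift x hx.1
    have hxx : x'.comp ι = x := AlgHom.ext hx'
    obtain ⟨-, hxA, hxΩ⟩ := hx
    have hA' : (fun i => x (t i), x' y) ∈ A := by
      rw [hyv, hx', hx']
      exact hxA
    simp only [← hx'] at hxΩ hA' ⊢
    refine ⟨hxΩ, ?_⟩
    rw [h1 x' hxΩ hA', hxx]
  · have hT' : (fun i => S T (algebraMap R R' (t i))) = T := funext (h2 T hT).2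
    exact ⟨hmem (S T) (by rwa [hT']) (by rw [hT']; exact (h2 T hT).1), (h2 T hT).2⟩

end EtaleCoord

end

/-! ### Rational points and analytic charts of X(ℂ) -/

noncomputable section

namespace StratifiedPair

namespace RatPoint

section Field

variable {K : Type u} [Field K] {X : Scheme.{u}} {f : X ⟶ Spec (.of K)}

/-- Evaluation of regular functions at a rational point, as a ring homomorphism. -/
def evalHom (x : RatPoint f) (U : X.Opens) (hx : x.pt ∈ U) : Γ(X, U) →+* K :=
  (Scheme.stalkClosedPointTo x.1).hom.comp (X.presheaf.germ U x.pt hx).hom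

theorem evalHom_apply (x : RatPoint f) (U : X.Opens) (hx : x.pt ∈ U) (φ : Γ(X, U)) :
    x.evalHom U hx φ = x.eval U hx φ := rfl

theorem specMap_germ_stalkClosedPointTo {P : CommRingCat.{u}} [IsLocalRing P] (J : Spec P ⟶ X)
    {U : X.Opens} (hU : IsAffineOpen U) (hJ : J (IsLocalRing.closedPoint P) ∈ U) :
    Spec.map (X.presheaf.germ U _ hJ ≫ Scheme.stalkClosedPointTo J) ≫ hU.fromSpec = J := by
  rw [Spec.map_comp, Category.assoc, specMap_germ_comp_fromSpec]
  exact Scheme.Spec_stalkClosedPointTo_fromSpecStalk J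

theorem specMap_evalHom (x : RatPoint f) {U : X.Opens} (hU : IsAffineOpen U) (hx : x.pt ∈ U) :
    Spec.map (CommRingCat.ofHom (x.evalHom U hx)) ≫ hU.fromSpec = Subtype.val x :=
  specMap_germ_stalkClosedPointTo (P := .of K) (Subtype.val x) hU hx

theorem evalHom_comp_constants (x : RatPoint f) {U : X.Opens} (hU : IsAffineOpen U)
    (hx : x.pt ∈ U) : (x.evalHom U hx).comp (constants f U) = RingHom.id K := by
  have h := x.2
  rw [← x.specMap_evalHom hU hx, Category.assoc, fromSpec_comp, ← Spec.map_comp,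
    ← Spec.map_id] at h
  exact congrArg CommRingCat.Hom.hom (Spec.map_injective h)

theorem ext_evalHom {x y : RatPoint f} {U : X.Opens} (hU : IsAffineOpen U) (hx : x.pt ∈ U)
    (hy : y.pt ∈ U) (h : x.evalHom U hx = y.evalHom U hy) : x = y :=
  Subtype.ext (by rw [← x.specMap_evalHom hU hx, ← y.specMap_evalHom hU hy, h])

/-- The rational point with given values of the regular functions on an affine open set. -/
def ofHom {U : X.Opens} (hU : IsAffineOpen U) (y : Γ(X, U) →+* K)
    (hy : y.comp (constants f U) = RingHom.id K) : RatPoint f :=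
  ⟨Spec.map (CommRingCat.ofHom y) ≫ hU.fromSpec, by
    rw [Category.assoc, fromSpec_comp, ← Spec.map_comp, ← CommRingCat.ofHom_comp, hy]
    exact Spec.map_id _⟩

theorem pt_ofHom_mem {U : X.Opens} (hU : IsAffineOpen U) (y : Γ(X, U) →+* K)
    (hy : y.comp (constants f U) = RingHom.id K) : (ofHom hU y hy).pt ∈ U := by
  have := Set.mem_range_self (f := hU.fromSpec)
    (Spec.map (CommRingCat.ofHom y) (IsLocalRing.closedPoint K))
  rwa [hU.range_fromSpec] at this

theorem evalHom_ofHom {U : X.Opens} (hU : IsAffineOpen U) (y : Γ(X, U) →+* K)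
    (hy : y.comp (constants f U) = RingHom.id K) (h : (ofHom hU y hy).pt ∈ U) :
    (ofHom hU y hy).evalHom U h = y := by
  have h1 := (ofHom hU y hy).specMap_evalHom hU h
  have h2 : (ofHom hU y hy).1 = Spec.map (CommRingCat.ofHom y) ≫ hU.fromSpec := rfl
  rw [h2, cancel_mono] at h1
  exact congrArg CommRingCat.Hom.hom (Spec.map_injective h1)

theorem eval_res (x : RatPoint f) {U V : X.Opens} (h : V ≤ U) (hx : x.pt ∈ V) (φ : Γ(X, U)) :
    x.eval V hx (X.presheaf.map (homOfLE h).op φ) = x.eval U (h hx) φ := by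
  simp only [eval]
  congr 1
  exact TopCat.Presheaf.germ_res_apply _ _ _ _ _

theorem pt_mem_basicOpen_iff (x : RatPoint f) {U : X.Opens} (hx : x.pt ∈ U) (φ : Γ(X, U)) :
    x.pt ∈ X.basicOpen φ ↔ x.eval U hx φ ≠ 0 := by
  rw [Scheme.mem_basicOpen X φ x.pt hx, ← isUnit_iff_ne_zero]
  exact (isUnit_map_iff (Scheme.stalkClosedPointTo x.1).hom _).symm

theorem pt_mem_iff (x : RatPoint f) {U : X.affineOpens} (hx : x.pt ∈ U.1) (Z : Closeds X) :
    x.pt ∈ Z ↔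
      ∀ φ ∈ (Scheme.IdealSheafData.vanishingIdeal Z).ideal U, x.eval U.1 hx φ = 0 := by
  have h := specMap_fromSpec_mem_iff (U := U) (CommRingCat.ofHom (x.evalHom U.1 hx)) Z
    (IsLocalRing.closedPoint K)
  rw [x.specMap_evalHom U.2 hx] at h
  refine h.trans ?_
  rw [Ideal.map_le_iff_le_comap]
  refine forall₂_congr fun φ _ => ?_
  change x.eval U.1 hx φ ∈ IsLocalRing.maximalIdeal K ↔ _
  rw [IsLocalRing.maximalIdeal_eq_bot, Ideal.mem_bot]

theorem exists_basicOpen_le (x : RatPoint f) {U V : X.Opens} (hU : IsAffineOpen U) (hx : x.pt ∈ U)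
    (hxV : x.pt ∈ V) : ∃ s : Γ(X, U), X.basicOpen s ≤ V ∧ x.eval U hx s ≠ 0 := by
  obtain ⟨s, hs, hxs⟩ := hU.exists_basicOpen_le ⟨x.pt, hxV⟩ hx
  exact ⟨s, hs, (x.pt_mem_basicOpen_iff hx s).1 hxs⟩

/-- Regular functions near `x` are fractions of regular functions on an affine neighbourhood. -/
theorem exists_eval_mul_eq (x : RatPoint f) {U V : X.Opens} (hU : IsAffineOpen U)
    (hx : x.pt ∈ U) (hxV : x.pt ∈ V) (φ : Γ(X, V)) :
    ∃ s a : Γ(X, U), ∃ m : ℕ, x.eval U hx s ≠ 0 ∧ ∀ (y : RatPoint f) (hy : y.pt ∈ U),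
      y.eval U hy s ≠ 0 → ∃ hyV : y.pt ∈ V, y.eval V hyV φ * y.eval U hy s ^ m = y.eval U hy a := by
  obtain ⟨s, hs, hxs⟩ := x.exists_basicOpen_le hU hx hxV
  have := hU.isLocalization_basicOpen s
  obtain ⟨m, a, ha⟩ := IsLocalization.Away.surj (S := Γ(X, X.basicOpen s)) s
    (X.presheaf.map (homOfLE hs).op φ)
  refine ⟨s, a, m, hxs, fun y hy hys => ?_⟩
  have hyD := (y.pt_mem_basicOpen_iff hy s).2 hys
  refine ⟨hs hyD, ?_⟩
  have h := congrArg (y.evalHom _ hyD) ha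
  rw [map_mul, map_pow] at h
  change y.eval _ hyD (X.presheaf.map (homOfLE hs).op φ) *
    y.eval _ hyD (X.presheaf.map (homOfLE (X.basicOpen_le s)).op s) ^ m =
    y.eval _ hyD (X.presheaf.map (homOfLE (X.basicOpen_le s)).op a) at h
  rwa [eval_res, eval_res, eval_res] at h

theorem exists_eval_mul_eq_of_mem (x : RatPoint f) (I : X.IdealSheafData) {U V : X.affineOpens}
    (hx : x.pt ∈ U.1) (hxV : x.pt ∈ V.1) {φ : Γ(X, V.1)} (hφ : φ ∈ I.ideal V) :
    ∃ s, ∃ a ∈ I.ideal U, ∃ m : ℕ, x.eval U.1 hx s ≠ 0 ∧ ∀ (y : RatPoint f) (hy : y.pt ∈ U.1),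
      y.eval U.1 hy s ≠ 0 →
        ∃ hyV : y.pt ∈ V.1, y.eval V.1 hyV φ * y.eval U.1 hy s ^ m = y.eval U.1 hy a := by
  have hU : IsAffineOpen U.1 := U.2
  obtain ⟨s, hs, hxs⟩ := x.exists_basicOpen_le hU hx hxV
  have := hU.isLocalization_basicOpen s
  let W : X.affineOpens := ⟨X.basicOpen s, hU.basicOpen s⟩
  have hWV : W ≤ V := hs
  have hWU : W ≤ U := X.basicOpen_le s
  have h1 : X.presheaf.map (homOfLE hs).op φ ∈ I.ideal W := by
    rw [← I.map_ideal hWV]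
    exact Ideal.mem_map_of_mem _ hφ
  rw [← I.map_ideal hWU] at h1
  obtain ⟨⟨⟨a, ha⟩, ⟨_, m, rfl⟩⟩, ham⟩ :=
    (IsLocalization.mem_map_algebraMap_iff (.powers s) Γ(X, X.basicOpen s)).1 h1
  refine ⟨s, a, ha, m, hxs, fun y hy hys => ?_⟩
  have hyD := (y.pt_mem_basicOpen_iff hy s).2 hys
  refine ⟨hs hyD, ?_⟩
  have h := congrArg (y.evalHom _ hyD) ham
  simp only [map_mul, map_pow] at h
  change y.eval _ hyD (X.presheaf.map (homOfLE hs).op φ) *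
    y.eval _ hyD (X.presheaf.map (homOfLE (X.basicOpen_le s)).op s) ^ m =
    y.eval _ hyD (X.presheaf.map (homOfLE (X.basicOpen_le s)).op a) at h
  rwa [eval_res, eval_res, eval_res] at h

open Classical in
/-- The value of a regular function at a rational point, zero outside of its domain. -/
def value (x : RatPoint f) (U : X.Opens) (φ : Γ(X, U)) : K :=
  if hx : x.pt ∈ U then x.eval U hx φ else 0

theorem value_eq (x : RatPoint f) {U : X.Opens} (hx : x.pt ∈ U) (φ : Γ(X, U)) :
    x.value U φ = x.eval U hx φ := dif_pos hx

end Field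

variable {X : Scheme.{0}} {f : X ⟶ Spec (.of ℂ)}

theorem isOpen_pt_mem (U : X.Opens) : IsOpen {x : RatPoint f | x.pt ∈ U} :=
  .basic _ ⟨U, 0, Set.univ, isOpen_univ, by ext; simp⟩

theorem continuousOn_value (U : X.Opens) (φ : Γ(X, U)) :
    ContinuousOn (fun x : RatPoint f => x.value U φ) {x | x.pt ∈ U} := by
  rw [continuousOn_open_iff (isOpen_pt_mem U)]
  intro W hW
  refine .basic _ ⟨U, φ, W, hW, ?_⟩
  ext x
  refine ⟨fun ⟨h1, h2⟩ => ⟨h1, ?_⟩, fun ⟨h1, h2⟩ => ⟨h1, ?_⟩⟩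
  · rwa [← value_eq]
  · rwa [Set.mem_preimage, value_eq x h1]

end RatPoint

variable {X : Scheme.{0}} {f : X ⟶ Spec (.of ℂ)}

/-- An analytic chart of `X(ℂ)` given by étale coordinates. -/
structure IsAnalyticChart {n : ℕ}
    (E : OpenPartialHomeomorph (RatPoint f) (Fin n → ℂ)) {U : X.Opens} (t : Fin n → Γ(X, U)) : Prop where
  mem : ∀ x ∈ E.source, x.pt ∈ U
  apply_eq : ∀ x ∈ E.source, ∀ i, E x i = x.value U (t i)
  analyticAt : ∀ T ∈ E.target, ∀ (V : X.Opens) (φ : Γ(X, V)), (E.symm T).pt ∈ V →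
    AnalyticAt ℂ (fun T => (E.symm T).value V φ) T

/-- Points of U(ℂ) are the ℂ-algebra homomorphisms from functions on U to ℂ, so the analytic section
of the étale coordinates is a local inverse of x ↦ t(x). -/
theorem exists_isAnalyticChart {n : ℕ} {U : X.Opens} (hU : IsAffineOpen U) {t : Fin n → Γ(X, U)}
    (ht : (MvPolynomial.eval₂Hom (constants f U) t).Etale) {x₀ : RatPoint f} (hx₀ : x₀.pt ∈ U) :
    ∃ E : OpenPartialHomeomorph (RatPoint f) (Fin n → ℂ), x₀ ∈ E.source ∧ IsAnalyticChart E t := by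
  let : Algebra ℂ Γ(X, U) := (constants f U).toAlgebra
  let toHom (x : RatPoint f) (hx : x.pt ∈ U) : Γ(X, U) →ₐ[ℂ] ℂ :=
    { x.evalHom U hx with
      commutes' := fun c => DFunLike.congr_fun (x.evalHom_comp_constants hU hx) c }
  have htoHom : ∀ x hx a, toHom x hx a = x.value U a := fun x hx a => (x.value_eq hx a).symm
  obtain ⟨S, Ω, 𝒩, hΩ, h𝒩, h0, h1, h2, h3⟩ := EtaleCoord.exists_analytic_section ht (toHom x₀ hx₀)
  let P (T : Fin n → ℂ) : RatPoint f := .ofHom hU (S T).toRingHom (RingHom.ext (S T).commutes)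
  have hP : ∀ T, (P T).pt ∈ U := fun T => RatPoint.pt_ofHom_mem hU _ _
  have hPv : ∀ T a, (P T).value U a = S T a := fun T a => by
    rw [RatPoint.value_eq _ (hP T)]
    exact DFunLike.congr_fun (RatPoint.evalHom_ofHom hU _ _ (hP T)) a
  have hfun : ∀ x hx, ⇑(toHom x hx) = fun a => x.value U a := fun x hx => funext (htoHom x hx)
  have key : ∀ T ∈ Ω, ∀ (V : X.Opens) (φ : Γ(X, V)), (P T).pt ∈ V →
      (∀ᶠ T' in 𝓝 T, (P T').pt ∈ V) ∧ AnalyticAt ℂ (fun T => (P T).value V φ) T := by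
    intro T hT V φ hV
    obtain ⟨s, a, m, hs, hsa⟩ := (P T).exists_eval_mul_eq hU (hP T) hV φ
    rw [← RatPoint.value_eq, hPv] at hs
    have hev : ∀ᶠ T' in 𝓝 T, S T' s ≠ 0 := (h3 s T hT).continuousAt.eventually_ne hs
    refine ⟨?_, ((h3 a T hT).div ((h3 s T hT).pow m) (pow_ne_zero m hs)).congr ?_⟩
    · filter_upwards [hev] with T' hT'
      exact (hsa (P T') (hP T') (by rwa [← RatPoint.value_eq, hPv])).1
    · filter_upwards [hev] with T' hT'
      obtain ⟨h, h'⟩ := hsa (P T') (hP T') (by rwa [← RatPoint.value_eq, hPv])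
      rw [← RatPoint.value_eq, ← RatPoint.value_eq, ← RatPoint.value_eq, hPv, hPv] at h'
      change S T' a / S T' s ^ m = _
      rw [← h', mul_div_cancel_right₀ _ (pow_ne_zero m hT')]
  have hcont : ContinuousOn (fun (x : RatPoint f) a => x.value U a) {x | x.pt ∈ U} :=
    continuousOn_pi.2 fun a => RatPoint.continuousOn_value U a
  let E : OpenPartialHomeomorph (RatPoint f) (Fin n → ℂ) :=
    { toFun := fun x i => x.value U (t i)
      invFun := P
      source := {x | x.pt ∈ U} ∩ (fun (x : RatPoint f) a => x.value U a) ⁻¹' 𝒩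
      target := Ω
      map_source' := fun x hx => by
        have := (h1 (toHom x hx.1) (by rw [hfun]; exact hx.2)).1
        simpa only [htoHom] using this
      map_target' := fun T hT => by
        refine ⟨hP T, ?_⟩
        rw [Set.mem_preimage, funext (hPv T)]
        exact (h2 T hT).1
      left_inv' := fun x hx => by
        have := (h1 (toHom x hx.1) (by rw [hfun]; exact hx.2)).2
        simp only [htoHom] at this
        refine RatPoint.ext_evalHom hU (hP _) hx.1 (RingHom.ext fun a => ?_)
        rw [RatPoint.evalHom_apply, RatPoint.evalHom_apply, ← RatPoint.value_eq, hPv, this, htoHom,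
          RatPoint.value_eq _ hx.1]
      right_inv' := fun T hT => funext fun i => by rw [hPv, (h2 T hT).2]
      open_source := hcont.isOpen_inter_preimage (RatPoint.isOpen_pt_mem U) h𝒩
      open_target := hΩ
      continuousOn_toFun := continuousOn_pi.2 fun i =>
        (RatPoint.continuousOn_value U (t i)).mono Set.inter_subset_left
      -- It suffices to test generating open sets of the analytic topology, and regular functions
      -- are analytic, hence continuous, along the section, even those defined on another open set.
      continuousOn_invFun := by
        refine continuousOn_to_generateFrom_iff.2 ?_
        rintro T hT _ ⟨V, φ, W, hW, rfl⟩ ⟨hV, hVW⟩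
        obtain ⟨k1, k2⟩ := key T hT V φ hV
        refine mem_nhdsWithin_of_mem_nhds ?_
        rw [← RatPoint.value_eq] at hVW
        filter_upwards [k1, k2.continuousAt.eventually (hW.mem_nhds hVW)] with T' h h'
        exact ⟨h, by rwa [← RatPoint.value_eq]⟩ }
  refine ⟨E, ⟨hx₀, ?_⟩, fun x hx => hx.1, fun x _ i => rfl, fun T hT V φ hV => (key T hT V φ hV).2⟩
  rw [Set.mem_preimage, ← hfun x₀ hx₀]
  exact h0

end StratifiedPair

end

/-! ### The complex analytic setting -/

noncomputable section

namespace StratifiedPair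

variable {X : Scheme.{0}} {f : X ⟶ Spec (.of ℂ)} {n : ℕ} {U : X.Opens} {t : Fin n → Γ(X, U)}
  {E E' : OpenPartialHomeomorph (RatPoint f) (Fin n → ℂ)}

/-- Regular functions are analytic in the chart, so analytic functions of them are too. Conversely g
is itself an analytic function of the regular functions t. -/
theorem IsAnalyticChart.holomorphicAt_iff (hE : IsAnalyticChart E t) {x : RatPoint f}
    (hx : x ∈ E.source) {g : RatPoint f → ℂ} :
    HolomorphicAt g x ↔ AnalyticAt ℂ (fun T => g (E.symm T)) (E x) := by
  constructor
  · rintro ⟨V, hV, N, φ, G, hG, hg⟩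
    have hxE : E.symm (E x) = x := E.left_inv hx
    have ht : Filter.Tendsto E.symm (𝓝 (E x)) (𝓝 x) := by
      simpa only [ContinuousAt, hxE] using E.continuousAt_symm (E.map_source hx)
    have hφ : AnalyticAt ℂ (fun T j => (E.symm T).value V (φ j)) (E x) :=
      AnalyticAt.pi fun j => hE.analyticAt _ (E.map_source hx) V (φ j) (by rwa [hxE])
    have hx' : (fun j => x.eval V hV (φ j)) = fun j => (E.symm (E x)).value V (φ j) := by
      rw [hxE]
      exact funext fun j => (x.value_eq hV _).symm
    rw [hx'] at hG
    refine (hG.fun_comp hφ).congr ?_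
    filter_upwards [ht.eventually hg] with T ⟨hT, hgT⟩
    rw [hgT]
    simp only [RatPoint.value_eq _ hT]
  · intro hg
    have hxt : (fun i => x.eval U (hE.mem x hx) (t i)) = E x :=
      funext fun i => by rw [hE.apply_eq x hx, x.value_eq]
    refine ⟨U, hE.mem x hx, n, t, fun T => g (E.symm T), by rwa [hxt], ?_⟩
    filter_upwards [E.open_source.mem_nhds hx] with y hy
    have hyt : (fun i => y.eval U (hE.mem y hy) (t i)) = E y :=
      funext fun i => by rw [hE.apply_eq y hy, y.value_eq]
    exact ⟨hE.mem y hy, by rw [hyt, E.left_inv hy]⟩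

theorem IsAnalyticChart.holomorphicAt_comp (hE : IsAnalyticChart E t) (hE' : IsAnalyticChart E' t)
    {σ : (Fin n → ℂ) → Fin n → ℂ} {x : RatPoint f} (hx : x ∈ E.source)
    (hσ : AnalyticAt ℂ σ (E x)) (hx' : σ (E x) ∈ E'.target) {g : RatPoint f → ℂ}
    (hg : HolomorphicAt g (E'.symm (σ (E x)))) :
    HolomorphicAt (fun y => g (E'.symm (σ (E y)))) x := by
  rw [hE.holomorphicAt_iff hx]
  rw [hE'.holomorphicAt_iff (E'.map_target hx'), E'.right_inv hx'] at hg
  refine (hg.fun_comp hσ).congr ?_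
  filter_upwards [E.open_target.mem_nhds (E.map_source hx)] with T hT
  rw [E.right_inv hT]

theorem IsAnalyticChart.isBiholomorphic (hE : IsAnalyticChart E t) (hE' : IsAnalyticChart E' t)
    {σ : (Fin n → ℂ) ≃ₜ (Fin n → ℂ)} (hσ : ∀ T, AnalyticAt ℂ σ T)
    (hσ' : ∀ T, AnalyticAt ℂ σ.symm T) :
    IsBiholomorphic (E.trans (σ.toOpenPartialHomeomorph.trans E'.symm)) := by
  refine ⟨fun x hx g hg => ?_, fun x hx g hg => ?_⟩
  · simp only [OpenPartialHomeomorph.trans_source, Homeomorph.toOpenPartialHomeomorph_source,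
      OpenPartialHomeomorph.symm_source, Set.mem_inter_iff, Set.mem_preimage] at hx
    exact hE.holomorphicAt_comp hE' hx.1 (hσ _) hx.2.2 hg
  · simp only [OpenPartialHomeomorph.trans_target, Homeomorph.toOpenPartialHomeomorph_target,
      OpenPartialHomeomorph.symm_target, Set.mem_inter_iff, Set.mem_preimage] at hx
    exact hE'.holomorphicAt_comp hE hx.1.1 (hσ' _) hx.2 hg

theorem holomorphicAt_const (c : ℂ) (x : RatPoint f) : HolomorphicAt (fun _ => c) x :=
  ⟨⊤, trivial, 0, Fin.elim0, fun _ => c, analyticAt_const, .of_forall fun _ => ⟨trivial, rfl⟩⟩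

theorem analyticAt_symm_add {x : RatPoint f} {g : RatPoint f → ℂ}
    (hg : AnalyticAt ℂ (fun T => g (E.symm T)) (E x)) :
    AnalyticAt ℂ (fun v => g (E.symm (E x + v))) 0 := by
  refine AnalyticAt.fun_comp (g := fun T => g (E.symm T)) (f := fun v => E x + v) ?_
    (analyticAt_const.add analyticAt_id)
  rwa [add_zero]

theorem eventually_add_mem_target {x : RatPoint f} (hx : x ∈ E.source) :
    ∀ᶠ v in 𝓝 0, E x + v ∈ E.target := by
  have h : Filter.Tendsto (fun v => E x + v) (𝓝 0) (𝓝 (E x)) := by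
    have : Continuous fun v => E x + v := by fun_prop
    simpa using this.tendsto 0
  exact h.eventually (E.open_target.mem_nhds (E.map_source hx))

theorem tendsto_symm_add {x : RatPoint f} (hx : x ∈ E.source) :
    Filter.Tendsto (fun v => E.symm (E x + v)) (𝓝 0) (𝓝 x) := by
  have h1 : Filter.Tendsto (fun v => E x + v) (𝓝 0) (𝓝 (E x)) := by
    have : Continuous fun v => E x + v := by fun_prop
    simpa using this.tendsto 0
  have h2 := E.continuousAt_symm (E.map_source hx)
  rw [ContinuousAt, E.left_inv hx] at h2
  exact h2.comp h1

/-- Taking analytic Taylor series is a ℂ-algebra homomorphism, by their uniqueness and compatibility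
with sums and products. It has the coordinates and constant terms of the jet, so the two agree. -/
theorem IsAnalyticChart.isTaylor_jet (hU : IsAffineOpen U) (hE : IsAnalyticChart E t)
    [Algebra ℂ Γ(X, U)] (halg : algebraMap ℂ Γ(X, U) = constants f U)
    (ht : (MvPolynomial.eval₂Hom (algebraMap ℂ Γ(X, U)) t).Etale) {x : RatPoint f}
    (hx : x ∈ E.source) {y : Γ(X, U) →ₐ[ℂ] ℂ} (hy : ∀ a, y a = x.value U a) (a : Γ(X, U)) :
    IsTaylor (fun v => (E.symm (E x + v)).value U a) (EtaleCoord.jet ht y a) := by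
  have hev : ∀ᶠ v in 𝓝 0, (E.symm (E x + v)).pt ∈ U :=
    tendsto_symm_add hx |>.eventually ((RatPoint.isOpen_pt_mem U).mem_nhds (hE.mem x hx))
  have hx0 : E.symm (E x + 0) = x := by rw [add_zero, E.left_inv hx]
  choose p hp using fun a => (analyticAt_symm_add (E := E) (x := x)
    (g := fun y => y.value U a) (hE.analyticAt _
    (E.map_source hx) U a (by rw [E.left_inv hx]; exact hE.mem x hx))).exists_isTaylor
  have hconst : ∀ c, p (algebraMap ℂ Γ(X, U) c) = MvPowerSeries.C c := fun c => by
    rw [← MvPolynomial.coe_C]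
    refine (hp _).eq (.eval _) ?_
    filter_upwards [hev] with v hv
    rw [RatPoint.value_eq _ hv, halg, ← RatPoint.evalHom_apply, MvPolynomial.eval_C]
    exact DFunLike.congr_fun (RatPoint.evalHom_comp_constants _ hU hv) c
  let j : Γ(X, U) →ₐ[ℂ] MvPowerSeries (Fin n) ℂ :=
    { toFun := p
      map_one' := by simpa using hconst 1
      map_zero' := by simpa using hconst 0
      map_mul' := fun a b => (hp _).eq ((hp a).mul (hp b)) <| by
        filter_upwards [hev] with v hv
        simp only [RatPoint.value_eq _ hv, ← RatPoint.evalHom_apply, map_mul]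
      map_add' := fun a b => (hp _).eq ((hp a).add (hp b)) <| by
        filter_upwards [hev] with v hv
        simp only [RatPoint.value_eq _ hv, ← RatPoint.evalHom_apply, map_add]
      commutes' := hconst }
  have hj : j = EtaleCoord.jet ht y := by
    refine EtaleCoord.eq_jet (fun i => ?_) fun r => ?_
    · have : (MvPowerSeries.C (y (t i)) + MvPowerSeries.X i : MvPowerSeries (Fin n) ℂ) =
          (MvPolynomial.C (y (t i)) + MvPolynomial.X i : MvPolynomial (Fin n) ℂ) := by simp
      rw [this]
      refine (hp (t i)).eq (.eval _) ?_
      filter_upwards [eventually_add_mem_target hx] with v hv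
      rw [← hE.apply_eq _ (E.map_target hv), E.right_inv hv, hy, ← hE.apply_eq x hx]
      simp
    · refine (hp r).constantCoeff_eq.trans ?_
      rw [hx0, hy]
  rw [← hj]
  exact hp a

/-- The affine map `T ↦ c * (T - a) + b`. -/
def affineHomeomorph (a b c : Fin n → ℂ) (hc : ∀ i, c i ≠ 0) : (Fin n → ℂ) ≃ₜ (Fin n → ℂ) where
  toFun T := c * (T - a) + b
  invFun T := c⁻¹ * (T - b) + a
  left_inv T := by
    ext i
    simp [hc i]
  right_inv T := by
    ext i
    simp [hc i]
  continuous_toFun := by fun_prop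
  continuous_invFun := by fun_prop

theorem analyticAt_mul_sub_add (a b c T : Fin n → ℂ) :
    AnalyticAt ℂ (fun T => c * (T - a) + b) T :=
  (analyticAt_const.mul (analyticAt_id.sub analyticAt_const)).add analyticAt_const

variable {ι : Type w} {D : ι → X.IdealSheafData}

/-- In analytic charts at the two points, the affine map with linear part c carrying one centre to
the other multiplies each t_i, i ∈ s, by the nonzero c_i, so it preserves strata. Invariance puts G
∘ e in the analytic ideal at p₁; its Taylor series is the rescaled jet of G at x₂. -/
theorem AnalyticInvariant.jetInvariant {I : X.IdealSheafData} (h : AnalyticInvariant f D I)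
    {U : X.affineOpens} {n : ℕ} {t : Fin n → Γ(X, U.1)} {s : Finset (Fin n)}
    (hc : IsAdaptedChart f D U t s) :
    let _ : Algebra ℂ Γ(X, U.1) := (constants f U.1).toAlgebra
    EtaleCoord.JetInvariant (k := ℂ) (F := ℂ) hc.etale s ((⊤ : Subfield ℂ) : Set ℂ)
      (I.ideal U) := by
  intro _ x₁ x₂ hx₁ hx₂ _ c _ hc0 hcs N G hG
  have hU : IsAffineOpen U.1 := U.2
  let p₁ : RatPoint f := .ofHom hU x₁.toRingHom (RingHom.ext x₁.commutes)
  let p₂ : RatPoint f := .ofHom hU x₂.toRingHom (RingHom.ext x₂.commutes)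
  have hp₁ : p₁.pt ∈ U.1 := RatPoint.pt_ofHom_mem hU _ _
  have hp₂ : p₂.pt ∈ U.1 := RatPoint.pt_ofHom_mem hU _ _
  have hv₁ : ∀ a, x₁ a = p₁.value U.1 a := fun a => by
    rw [RatPoint.value_eq _ hp₁]
    exact (DFunLike.congr_fun (RatPoint.evalHom_ofHom hU _ _ hp₁) a).symm
  have hv₂ : ∀ a, x₂ a = p₂.value U.1 a := fun a => by
    rw [RatPoint.value_eq _ hp₂]
    exact (DFunLike.congr_fun (RatPoint.evalHom_ofHom hU _ _ hp₂) a).symm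
  obtain ⟨E₁, hpE₁, hE₁⟩ := exists_isAnalyticChart hU hc.etale hp₁
  obtain ⟨E₂, hpE₂, hE₂⟩ := exists_isAnalyticChart hU hc.etale hp₂
  let σ := affineHomeomorph (E₁ p₁) (E₂ p₂) c hc0
  have hσ : ∀ T, σ T = c * (T - E₁ p₁) + E₂ p₂ := fun _ => rfl
  let e := E₁.trans (σ.toOpenPartialHomeomorph.trans E₂.symm)
  have he : ∀ x, e x = E₂.symm (σ (E₁ x)) := fun _ => rfl
  have hsource : ∀ x, x ∈ e.source ↔ x ∈ E₁.source ∧ σ (E₁ x) ∈ E₂.target := fun x => by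
    simp [e]
  have hσp : σ (E₁ p₁) = E₂ p₂ := by simp [hσ]
  have hpe : p₁ ∈ e.source :=
    (hsource _).2 ⟨hpE₁, by rw [hσp]; exact E₂.map_source hpE₂⟩
  have hep : e p₁ = p₂ := by rw [he, hσp, E₂.left_inv hpE₂]
  have hbi : IsBiholomorphic e := hE₁.isBiholomorphic hE₂
    (fun T => analyticAt_mul_sub_add _ _ _ T) fun T => analyticAt_mul_sub_add _ _ _ T
  have hstrata : ∀ Z, IsStratum D Z → ∀ x ∈ e.source, x.pt ∈ Z ↔ (e x).pt ∈ Z := by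
    intro Z hZ x hx
    obtain ⟨h1, h2⟩ := (hsource x).1 hx
    have hxU : x.pt ∈ U.1 := hE₁.mem x h1
    have hes : e x ∈ E₂.source := E₂.map_target h2
    have hexU : (e x).pt ∈ U.1 := hE₂.mem _ hes
    rw [x.pt_mem_iff hxU, (e x).pt_mem_iff hexU]
    rcases hc.ideal_stratum Z hZ with hI | ⟨S, hS, hI⟩
    · rw [hI]
      have hone : ∀ (y : RatPoint f) (hy : y.pt ∈ U.1), ¬ ∀ φ ∈ (⊤ : Ideal Γ(X, U.1)),
          y.eval U.1 hy φ = 0 := fun y hy h => by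
        have := h 1 trivial
        rw [← RatPoint.evalHom_apply, map_one] at this
        exact one_ne_zero this
      exact iff_of_false (hone x hxU) (hone (e x) hexU)
    · have hspan : ∀ (y : RatPoint f) (hy : y.pt ∈ U.1), (∀ φ ∈ Ideal.span (t '' S),
          y.eval U.1 hy φ = 0) ↔ ∀ i ∈ S, y.value U.1 (t i) = 0 := fun y hy => by
        have := Ideal.span_le (I := RingHom.ker (y.evalHom U.1 hy)) (s := t '' S)
        rw [Set.image_subset_iff] at this
        refine this.trans (forall₂_congr fun i _ => ?_)
        rw [RatPoint.value_eq _ hy]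
        rfl
      rw [hI, hspan, hspan]
      refine forall₂_congr fun i hi => ?_
      rw [← hE₁.apply_eq x h1, ← hE₂.apply_eq _ hes, he, E₂.right_inv h2, hσ]
      simp [hE₁.apply_eq p₁ hpE₁, hE₂.apply_eq p₂ hpE₂, ← hv₁, ← hv₂, hx₁ i (hS hi), hx₂ i (hS hi),
        hc0 i]
  have hmem : MemAnalyticIdeal I (fun y => y.value U.1 G) (e p₁) := by
    rw [hep]
    refine ⟨U, hp₂, 1, fun _ => G, fun _ _ => 1, fun _ => hG, fun _ => holomorphicAt_const 1 _, ?_⟩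
    filter_upwards [(RatPoint.isOpen_pt_mem U.1).mem_nhds hp₂] with y hy
    exact ⟨hy, by simp [RatPoint.value_eq _ hy]⟩
  obtain ⟨V, hV, M, φ, g, hφ, hg, hev⟩ := (h e hbi hstrata p₁ hpe _).1 hmem
  -- The generators φ_j may live on another affine open set. Near p₁ they are a_j/r_j^m with a_j ∈
  -- I(U), and the invertible denominators are absorbed into the holomorphic coefficients.
  choose r a ha m hr hra using fun j => p₁.exists_eval_mul_eq_of_mem I hp₁ hV (hφ j)
  have hr' : ∀ j, p₁.value U.1 (r j) ≠ 0 := fun j => by rw [RatPoint.value_eq _ hp₁]; exact hr j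
  have han : ∀ j, AnalyticAt ℂ (fun v => g j (E₁.symm (E₁ p₁ + v)) /
      (E₁.symm (E₁ p₁ + v)).value U.1 (r j) ^ m j) 0 := fun j => by
    refine analyticAt_symm_add (x := p₁)
      (g := fun y => g j y / y.value U.1 (r j) ^ m j) ?_
    have hs : E₁.symm (E₁ p₁) = p₁ := E₁.left_inv hpE₁
    exact ((hE₁.holomorphicAt_iff hpE₁).1 (hg j)).div
      ((hE₁.analyticAt _ (E₁.map_source hpE₁) U.1 (r j) (by rwa [hs])).pow (m j))
      (by rw [hs]; exact pow_ne_zero _ (hr' j))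
  choose q hq using fun j => (han j).exists_isTaylor
  have hT₁ := IsTaylor.sum Finset.univ fun j _ => (hq j).mul
    (hE₁.isTaylor_jet hU rfl hc.etale hpE₁ hv₁ (a j))
  have hT₂ := (hE₂.isTaylor_jet hU rfl hc.etale hpE₂ hv₂ G).rescale c
  -- Comparing the Taylor series of both expressions for G ∘ e gives an exact identity of power
  -- series, so no power of the variable ideal is needed here.
  have heq := hT₂.eq hT₁ <| by
    have h2 : ∀ j, ∀ᶠ y in 𝓝 p₁, y.value U.1 (r j) ≠ 0 := fun j =>
      ((RatPoint.continuousOn_value U.1 (r j)).continuousAt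
        ((RatPoint.isOpen_pt_mem U.1).mem_nhds hp₁)).eventually_ne (hr' j)
    have h3 := (tendsto_symm_add hpE₁).eventually
      (hev.and ((Filter.eventually_all.2 h2).and ((RatPoint.isOpen_pt_mem U.1).mem_nhds hp₁)))
    filter_upwards [eventually_add_mem_target hpE₁, h3] with v hv ⟨⟨hyV, hy1⟩, hy2, hyU⟩
    have hee : e (E₁.symm (E₁ p₁ + v)) = E₂.symm (E₂ p₂ + c * v) := by
      rw [he, E₁.right_inv hv, hσ, add_sub_cancel_left, add_comm]
    rw [Function.comp, hee] at hy1
    rw [hy1]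
    refine Finset.sum_congr rfl fun j _ => ?_
    have hy2j := hy2 j
    obtain ⟨hyV', hy3⟩ := hra j _ hyU (by rwa [← RatPoint.value_eq])
    rw [RatPoint.value_eq _ hyU] at hy2j
    rw [RatPoint.value_eq _ hyU, RatPoint.value_eq _ hyU, ← hy3]
    field_simp
  rw [heq]
  refine Ideal.mem_sup_left (Ideal.sum_mem _ fun j _ => Ideal.mul_mem_left _ _ ?_)
  exact Ideal.mem_map_of_mem (EtaleCoord.jet hc.etale x₁) (ha j)

theorem IsSNCPair.isToroidal_of_analyticInvariant [Fintype ι] (h : IsSNCPair f D)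
    {I : X.IdealSheafData} (hI : AnalyticInvariant f D I) : IsToroidal D I :=
  h.isToroidal_of_jetInvariant (L := (⊤ : Subfield ℂ)) Set.infinite_univ I
    fun _ _ _ _ hc => hI.jetInvariant hc

end StratifiedPair

end

theorem mainTheorem8 :
    -- the complex analytic setting
    (∀ (X : Scheme.{0}) (f : X ⟶ Spec (.of ℂ)) (ι : Type w) [Fintype ι]
      (D : ι → X.IdealSheafData) (I : X.IdealSheafData),
      StratifiedPair.IsSNCPair f D → StratifiedPair.AnalyticInvariant f D I →
        StratifiedPair.IsToroidal D I) ∧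
    -- the étale local setting
    (∀ (k : Type u) [Field k] (X : Scheme.{u}) (f : X ⟶ Spec (.of k)) (ι : Type w) [Fintype ι]
      (D : ι → X.IdealSheafData) (I : X.IdealSheafData),
      StratifiedPair.IsSNCPair f D → StratifiedPair.EtaleInvariant f D I →
        StratifiedPair.IsToroidal D I) ∧
    -- the formal local setting
    (∀ (k : Type u) [Field k] (X : Scheme.{u}) (f : X ⟶ Spec (.of k)) (ι : Type w) [Fintype ι]
      (D : ι → X.IdealSheafData) (I : X.IdealSheafData),
      StratifiedPair.IsSNCPair f D → StratifiedPair.FormalInvariant f D I →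
        StratifiedPair.IsToroidal D I) := by
  exact ⟨fun _ _ _ _ _ _ h hI => h.isToroidal_of_analyticInvariant hI,
    fun _ _ _ _ _ _ _ _ h hI => h.isToroidal_of_etaleInvariant hI,
    fun _ _ _ _ _ _ _ _ h hI => h.isToroidal_of_formalInvariant hI⟩
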